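/- Let $G$ be a Lie group acting smoothly on a (Hausdorff, second countable, finite-dimensional) smooth manifold $M$. Let $B=\Omega^*(M)$ be the differential graded algebra of (real) smooth differential forms on $M$, with de Rham differential $d$, and let $A$ be the algebra of smooth $B$-valued functions on $G$. For $g\in G$ let $g^*:\Omega^*(M)\to\Omega^*(M)$ be the pull-back of forms by the diffeomorphism $x\mapsto g^{-1}x$, so that $g^*h^*=(gh)^*$. The Hopf algebroid $\mathcal H(G,M)=(A,B,\alpha,\beta,\Delta,\epsilon,S)$ has the structure maps $\alpha(b)(g)=b$, $\beta(b)(g)=g^*b$, $\Delta(\phi)(g_1,g_2)=\phi(g_1g_2)$, $\epsilon(\phi)=\phi(1)$, $S(\phi)(g)=g^*(\phi(g^{-1}))$. Put $C^{0}=B$ and $C^{p}=A\otimes_B\cdots\otimes_B A$ ($p$ factors, completed tensor products), that is, $C^p=\bigoplus_q C^{p,q}$ where $C^{p,q}$ is the space of smooth maps $G^{p}\to\Omega^q(M)$ (smooth jointly in the variables of $G^p$ and $M$) and $(\phi\otimes_B\psi)(g_1,g_2)=\phi(g_1)\wedge g_1^*\psi(g_2)$. The cyclic module of $\mathcal H(G,M)$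 is given by the operators $$(\delta_i a)(g_1,\dots,g_{p+1})=\begin{cases} g_1^*\,a(g_2,\dots,g_{p+1}) & i=0,\\ a(g_1,\dots,g_ig_{i+1},\dots,g_{p+1}) & 1\le i\le p,\\ a(g_1,\dots,g_p) & i=p+1,\end{cases}$$ $$(\sigma_i a)(g_1,\dots,g_{p})=a(g_1,\dots,g_i,1,g_{i+1},\dots,g_p),\qquad (\tau a)(g_1,\dots,g_p)=(g_1\cdots g_p)^*a\big((g_1\cdots g_p)^{-1},g_1,\dots,g_{p-1}\big).$$ Let $b=\sum_i(-1)^i\delta_i:C^{p,q}\to C^{p+1,q}$, let $\lambda=(-1)^p\tau$ on $C^{p,q}$, and let $B_C=(1+\lambda+\dots+\lambda^p)\,\sigma_p\tau\,(1-\lambda):C^{p+1,q}\to C^{p,q}$ be Connes' operator. For $n\in\mathbb Z$, $HC^n(\mathcal H(G,M))$ is the degree $n$ cohomology of the complex with differential $b+(-1)^pd+B_C$ and cochain spaces $\bigoplus_{p+q+2k=n,\ k\ge 0}C^{p,q}$, and the periodic cyclic cohomology $HP^n(\mathcal H(G,M))$ is defined in the same way with $k\in\mathbb Z$ instead of $k\ge0$.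 Let $\Omega^*(M)^G$ be the complex of $G$-invariant forms, with differential $d$, and let $H^m(\Omega^*(M)^G,d)$ be its cohomology (zero for $m<0$). **Proposition.** If $G$ acts properly on $M$, then for every $n\in\mathbb Z$ the inclusion $\Omega^*(M)^G\subseteq\Omega^*(M)=C^0$ induces isomorphisms of vector spaces $$\bigoplus_{k\ge0}H^{n-2k}(\Omega^*(M)^G,d)\;\cong\;HC^{n}(\mathcal H(G,M)),\qquad \bigoplus_{k\in\mathbb Z}H^{n+2k}(\Omega^*(M)^G,d)\;\cong\;HP^{n}(\mathcal H(G,M)).$$ -/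

import Mathlib

open scoped Manifold ContDiff Topology DirectSum

set_option linter.unusedSectionVars false
set_option linter.unusedSimpArgs false
set_option linter.unnecessarySeqFocus false

noncomputable section

namespace HopfCyclic

/-! ### Differential forms on a manifold -/

section Forms

variable {E : Type*} [NormedAddCommGroup E] [NormedSpace ℝ E]
  {M : Type*} [TopologicalSpace M] [ChartedSpace E M]
  {N : Type*} [TopologicalSpace N] [ChartedSpace E N]
  {N' : Type*} [TopologicalSpace N'] [ChartedSpace E N']

variable (E M) in
/-- Differential `q`-forms on `M`, without any regularity: alternating `q`-linear forms on the
tangent spaces. -/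
abbrev RawForm (q : ℕ) : Type _ := (x : M) → TangentSpace 𝓘(ℝ, E) x [⋀^Fin q]→L[ℝ] ℝ

/-- The pull-back `f^* w`. -/
def pullback {q : ℕ} (f : N → M) (w : RawForm E M q) : RawForm E N q := fun x =>
  (w (f x)).compContinuousLinearMap (mfderiv 𝓘(ℝ, E) 𝓘(ℝ, E) f x)

/-- The pull-back of a form on `M` by a map from (an open subset of) `E`. -/
def pullbackE {q : ℕ} (f : E → M) (w : RawForm E M q) (y : E) : E [⋀^Fin q]→L[ℝ] ℝ :=
  pullback f w y

/-- The expression of a form in the preferred chart at `x₀`: its pull-back to `E` by the inverse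
chart (meaningful on the target of the chart). -/
def inChart {q : ℕ} (x₀ : M) (w : RawForm E M q) (y : E) : E [⋀^Fin q]→L[ℝ] ℝ :=
  pullbackE (extChartAt 𝓘(ℝ, E) x₀).symm w y

/-- The exterior derivative of a form: at `x` it is computed in the preferred chart at `x`. -/
def rawExtDeriv {q : ℕ} (w : RawForm E M q) : RawForm E M (q + 1) := fun x =>
  (extDeriv (inChart x w) (extChartAt 𝓘(ℝ, E) x x)).compContinuousLinearMap
    (mfderiv 𝓘(ℝ, E) 𝓘(ℝ, E) (extChartAt 𝓘(ℝ, E) x) x)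

variable {EP HP P : Type*} [NormedAddCommGroup EP] [NormedSpace ℝ EP]
  [TopologicalSpace HP] [TopologicalSpace P] [ChartedSpace HP P]
  {EP' HP' P' : Type*} [NormedAddCommGroup EP'] [NormedSpace ℝ EP']
  [TopologicalSpace HP'] [TopologicalSpace P'] [ChartedSpace HP' P']

/-- A family of `q`-forms on `M` indexed by a manifold `P` is smooth if its expression in every
chart of `M` is jointly smooth in the parameter and the point. -/
def IsSmoothFamily (J : ModelWithCorners ℝ EP HP) {q : ℕ} (w : P → RawForm E M q) : Prop :=
  ∀ x₀ : M, ContMDiffOn (J.prod 𝓘(ℝ, E)) 𝓘(ℝ, E [⋀^Fin q]→L[ℝ] ℝ) ∞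
    (fun z : P × E => inChart x₀ (w z.1) z.2) (Set.univ ×ˢ (extChartAt 𝓘(ℝ, E) x₀).target)

/-- A form is smooth if its expression in every chart is smooth. -/
def IsSmoothForm {q : ℕ} (w : RawForm E M q) : Prop :=
  ∀ x₀ : M, ContDiffOn ℝ ∞ (inChart x₀ w) (extChartAt 𝓘(ℝ, E) x₀).target

theorem isOpen_chartTarget (x₀ : M) : IsOpen (extChartAt 𝓘(ℝ, E) x₀).target :=
  isOpen_extChartAt_target x₀

theorem contDiff_compContinuousLinearMap [FiniteDimensional ℝ E] {q : ℕ} :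
    ContDiff ℝ ∞ (fun z : (E [⋀^Fin q]→L[ℝ] ℝ) × (E →L[ℝ] E) =>
      z.1.compContinuousLinearMap z.2) := by
  let T : (E [⋀^Fin q]→L[ℝ] ℝ) →ₗᵢ[ℝ] ContinuousMultilinearMap ℝ (fun _ : Fin q => E) ℝ :=
    ContinuousAlternatingMap.toContinuousMultilinearMapLI
  have : FiniteDimensional ℝ (ContinuousMultilinearMap ℝ (fun _ : Fin q => E) ℝ) :=
    Module.Finite.of_injective (ContinuousMultilinearMap.toMultilinearMapLinear :
        ContinuousMultilinearMap ℝ (fun _ : Fin q => E) ℝ →ₗ[ℝ] _)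
      ContinuousMultilinearMap.toMultilinearMap_injective
  obtain ⟨A, hA⟩ := LinearMap.exists_leftInverse_of_injective T.toLinearMap
    (LinearMap.ker_eq_bot.2 T.injective)
  let A' := LinearMap.toContinuousLinearMap A
  let K := ContinuousMultilinearMap.compContinuousLinearMapContinuousMultilinear ℝ
    (fun _ : Fin q => E) (fun _ : Fin q => E) ℝ
  have h1 : ContDiff ℝ ∞ (fun z : (E [⋀^Fin q]→L[ℝ] ℝ) × (E →L[ℝ] E) =>
      A' (K (fun _ => z.2) (T z.1))) := by
    refine A'.contDiff.comp (ContDiff.clm_apply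
      (f := fun z : (E [⋀^Fin q]→L[ℝ] ℝ) × (E →L[ℝ] E) => K (fun _ => z.2))
      (g := fun z : (E [⋀^Fin q]→L[ℝ] ℝ) × (E →L[ℝ] E) => T z.1) ?_ ?_)
    · exact (ContinuousMultilinearMap.contDiff (𝕜 := ℝ) (E := fun _ : Fin q => E →L[ℝ] E)
        (F := ContinuousMultilinearMap ℝ (fun _ : Fin q => E) ℝ →L[ℝ]
          ContinuousMultilinearMap ℝ (fun _ : Fin q => E) ℝ) K).comp
        (contDiff_pi.2 fun _ =>
          contDiff_snd (𝕜 := ℝ) (n := ∞) (E := E [⋀^Fin q]→L[ℝ] ℝ) (F := E →L[ℝ] E))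
    · exact (LinearIsometry.contDiff T).comp
        (contDiff_fst (𝕜 := ℝ) (n := ∞) (E := E [⋀^Fin q]→L[ℝ] ℝ) (F := E →L[ℝ] E))
  convert h1 using 2 with z
  have h2 : K (fun _ => z.2) (T z.1) = T (z.1.compContinuousLinearMap z.2) := rfl
  rw [h2]
  exact (LinearMap.congr_fun hA _).symm

theorem pullbackE_eq_pullback_inChart [IsManifold 𝓘(ℝ, E) ∞ M] {q : ℕ} (w : RawForm E M q)
    {f : E → M} {y : E} (x : M)
    (hf : ContMDiffAt 𝓘(ℝ, E) 𝓘(ℝ, E) ∞ f y) (hx : f y ∈ (extChartAt 𝓘(ℝ, E) x).source) :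
    pullbackE f w y = (inChart x w (extChartAt 𝓘(ℝ, E) x (f y))).compContinuousLinearMap
      (fderiv ℝ (fun z => extChartAt 𝓘(ℝ, E) x (f z)) y) := by
  have hmd : MDifferentiableAt 𝓘(ℝ, E) 𝓘(ℝ, E) f y := hf.mdifferentiableAt (by simp)
  have h1 : MDifferentiableAt 𝓘(ℝ, E) 𝓘(ℝ, E) (extChartAt 𝓘(ℝ, E) x) (f y) :=
    mdifferentiableAt_extChartAt (by simpa using hx)
  have hy : extChartAt 𝓘(ℝ, E) x (f y) ∈ (extChartAt 𝓘(ℝ, E) x).target :=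
    (extChartAt 𝓘(ℝ, E) x).map_source hx
  have h2 : MDifferentiableAt 𝓘(ℝ, E) 𝓘(ℝ, E) (extChartAt 𝓘(ℝ, E) x).symm
      (extChartAt 𝓘(ℝ, E) x (f y)) :=
    ((contMDiffOn_extChartAt_symm (n := ∞) x).contMDiffAt
      ((isOpen_chartTarget x).mem_nhds hy)).mdifferentiableAt (by simp)
  have hfx : (extChartAt 𝓘(ℝ, E) x).symm (extChartAt 𝓘(ℝ, E) x (f y)) = f y :=
    (extChartAt 𝓘(ℝ, E) x).left_inv hx
  have h3 : f =ᶠ[𝓝 y] (extChartAt 𝓘(ℝ, E) x).symm ∘ (extChartAt 𝓘(ℝ, E) x ∘ f) := by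
    have : ∀ᶠ z in 𝓝 y, f z ∈ (extChartAt 𝓘(ℝ, E) x).source :=
      hf.continuousAt.eventually ((isOpen_extChartAt_source x).mem_nhds hx)
    filter_upwards [this] with z hz
    simp only [Function.comp_apply]
    rw [(extChartAt 𝓘(ℝ, E) x).left_inv hz]
  have h4 : mfderiv 𝓘(ℝ, E) 𝓘(ℝ, E) f y =
      (mfderiv 𝓘(ℝ, E) 𝓘(ℝ, E) (extChartAt 𝓘(ℝ, E) x).symm
        (extChartAt 𝓘(ℝ, E) x (f y))).comp
        (mfderiv 𝓘(ℝ, E) 𝓘(ℝ, E) (extChartAt 𝓘(ℝ, E) x ∘ f) y) := by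
    refine h3.mfderiv_eq.trans ?_
    exact mfderiv_comp y h2 (h1.comp y hmd)
  rw [mfderiv_eq_fderiv] at h4
  ext v
  have key : ∀ a b : M, a = b → ∀ v : Fin q → E,
      (show E [⋀^Fin q]→L[ℝ] ℝ from w a) v = (show E [⋀^Fin q]→L[ℝ] ℝ from w b) v := by
    rintro a b rfl v; rfl
  have h5 : ∀ e : E, mfderiv 𝓘(ℝ, E) 𝓘(ℝ, E) f y e = _ := fun e => DFunLike.congr_fun h4 e
  refine Eq.trans ?_ (key _ _ hfx.symm _)
  show (show E [⋀^Fin q]→L[ℝ] ℝ from w (f y)) (fun i => mfderiv 𝓘(ℝ, E) 𝓘(ℝ, E) f y (v i)) = _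
  congr 1
  ext i
  exact h5 (v i)

/-- Partial derivatives of a smooth function with parameters in a manifold. -/
theorem contMDiffAt_fderiv_param {V W : Type*} [NormedAddCommGroup V] [NormedSpace ℝ V]
    [NormedAddCommGroup W] [NormedSpace ℝ W]
    (J : ModelWithCorners ℝ EP HP) [J.Boundaryless] {f : P → V → W} {s : P} {y : V}
    (hf : ContMDiffAt (J.prod 𝓘(ℝ, V)) 𝓘(ℝ, W) ∞ (Function.uncurry f) (s, y)) :
    ContMDiffAt (J.prod 𝓘(ℝ, V)) 𝓘(ℝ, V →L[ℝ] W) ∞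
      (fun z : P × V => fderiv ℝ (f z.1) z.2) (s, y) := by
  have h := (contMDiffAt_iff.1 hf).2
  have hr : Set.range (J.prod 𝓘(ℝ, V)) = Set.univ := by
    rw [modelWithCorners_prod_coe, Set.range_prodMap]
    simp [ModelWithCorners.range_eq_univ]
  rw [hr, contDiffWithinAt_univ] at h
  have h' : ContDiffAt ℝ ∞ (Function.uncurry fun (t : EP) (v : V) => f ((extChartAt J s).symm t) v)
      (extChartAt J s s, y) := by
    exact h
  have h2 : ContDiffAt ℝ ∞ (fun z : EP × V =>
      fderiv ℝ (f ((extChartAt J s).symm z.1)) z.2) (extChartAt J s s, y) :=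
    ContDiffAt.fderiv (f := fun (z : EP × V) (v : V) => f ((extChartAt J s).symm z.1) v)
      (g := fun z => z.2) (n := ∞) (m := ∞)
      (ContDiffAt.comp (((extChartAt J s s, y), y) : (EP × V) × V) h'
        ((contDiffAt_fst.comp _ contDiffAt_fst).prodMk contDiffAt_snd))
      contDiffAt_snd (by simp)
  have h3 : ContMDiffAt (J.prod 𝓘(ℝ, V)) 𝓘(ℝ, EP × V) ∞
      (fun z : P × V => (extChartAt J s z.1, z.2)) (s, y) := by
    refine ContMDiffAt.prodMk_space ?_ contMDiffAt_snd
    exact ContMDiffAt.comp (s, y) contMDiffAt_extChartAt contMDiffAt_fst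
  have h4 := ContMDiffAt.comp (s, y) (g := fun z : EP × V =>
      fderiv ℝ (f ((extChartAt J s).symm z.1)) z.2) h2.contMDiffAt h3
  refine h4.congr_of_eventuallyEq ?_
  have h5 : ∀ᶠ z : P × V in 𝓝 (s, y), z.1 ∈ (extChartAt J s).source :=
    continuous_fst.continuousAt.eventually (extChartAt_source_mem_nhds s)
  filter_upwards [h5] with z hz
  simp only [Function.comp_apply]
  rw [(extChartAt J s).left_inv hz]

/-- Smoothness of the pull-back of a smooth family by a smooth family of maps. -/
theorem contMDiffAt_pullback [FiniteDimensional ℝ E] [IsManifold 𝓘(ℝ, E) ∞ M] {q : ℕ}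
    (J : ModelWithCorners ℝ EP HP)
    (J' : ModelWithCorners ℝ EP' HP') [J'.Boundaryless] {w : P → RawForm E M q}
    (hw : IsSmoothFamily J w) {v : P' → P} (hv : ContMDiff J' J ∞ v) {f : P' → E → M} {s : P'}
    {y : E} (hev : ∀ᶠ z in 𝓝 (s, y),
      ContMDiffAt (J'.prod 𝓘(ℝ, E)) 𝓘(ℝ, E) ∞ (Function.uncurry f) z) :
    ContMDiffAt (J'.prod 𝓘(ℝ, E)) 𝓘(ℝ, E [⋀^Fin q]→L[ℝ] ℝ) ∞
      (fun z : P' × E => pullbackE (f z.1) (w (v z.1)) z.2) (s, y) := by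
  have hf := hev.self_of_nhds
  set x := f s y with hx
  set u : P' → E → E := fun t z => extChartAt 𝓘(ℝ, E) x (f t z) with hu
  have hsrc : ∀ᶠ z : P' × E in 𝓝 (s, y), f z.1 z.2 ∈ (extChartAt 𝓘(ℝ, E) x).source :=
    hf.continuousAt.eventually (extChartAt_source_mem_nhds x)
  have hus : ContMDiffAt (J'.prod 𝓘(ℝ, E)) 𝓘(ℝ, E) ∞ (Function.uncurry u) (s, y) :=
    ContMDiffAt.comp (s, y) (g := extChartAt 𝓘(ℝ, E) x) contMDiffAt_extChartAt hf
  have h1 := contMDiffAt_fderiv_param J' hus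
  have h2 : ContMDiffAt (J'.prod 𝓘(ℝ, E)) 𝓘(ℝ, E [⋀^Fin q]→L[ℝ] ℝ) ∞
      (fun z : P' × E => inChart x (w (v z.1)) (u z.1 z.2)) (s, y) := by
    have h3 := (hw x).contMDiffAt (x := (v s, u s y))
      ((isOpen_univ.prod (isOpen_chartTarget x)).mem_nhds
        ⟨Set.mem_univ _, mem_extChartAt_target x⟩)
    exact ContMDiffAt.comp (s, y) (g := fun z : P × E => inChart x (w z.1) z.2)
      (f := fun z : P' × E => (v z.1, u z.1 z.2)) h3
      (((hv s).comp (s, y) contMDiffAt_fst).prodMk hus)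
  have h4 := ContMDiffAt.comp (s, y)
    (contDiff_compContinuousLinearMap (E := E) (q := q)).contMDiff.contMDiffAt
    (h2.prodMk_space h1)
  refine h4.congr_of_eventuallyEq ?_
  filter_upwards [hsrc, hev] with z hz hz'
  exact pullbackE_eq_pullback_inChart (w (v z.1)) x
    (ContMDiffAt.comp z.2 (g := Function.uncurry f) (f := fun b => (z.1, b)) hz'
      (contMDiffAt_const.prodMk contMDiffAt_id)) hz

/-- Members of smooth families are smooth forms. -/
theorem IsSmoothFamily.form {J : ModelWithCorners ℝ EP HP} {q : ℕ} {w : P → RawForm E M q}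
    (hw : IsSmoothFamily J w) (s : P) : IsSmoothForm (w s) := by
  intro x₀
  rw [← contMDiffOn_iff_contDiffOn]
  exact ContMDiffOn.comp (hw x₀) (f := fun y : E => (s, y))
    (contMDiffOn_const.prodMk contMDiffOn_id) (fun y hy => ⟨Set.mem_univ _, hy⟩)

/-- Constant families of smooth forms are smooth. -/
theorem IsSmoothForm.const (J : ModelWithCorners ℝ EP HP) {q : ℕ} {w : RawForm E M q}
    (hw : IsSmoothForm w) : IsSmoothFamily J (fun _ : P => w) := by
  intro x₀
  exact ContMDiffOn.comp (contMDiffOn_iff_contDiffOn.2 (hw x₀)) (f := fun z : P × E => z.2)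
    contMDiffOn_snd (fun z hz => hz.2)

theorem inChart_add {q : ℕ} (x₀ : M) (w w' : RawForm E M q) (y : E) :
    inChart x₀ (w + w') y = inChart x₀ w y + inChart x₀ w' y := rfl

theorem inChart_smul {q : ℕ} (x₀ : M) (c : ℝ) (w : RawForm E M q) (y : E) :
    inChart x₀ (c • w) y = c • inChart x₀ w y := rfl

theorem inChart_zero {q : ℕ} (x₀ : M) (y : E) :
    inChart x₀ (0 : RawForm E M q) y = 0 := rfl

section

theorem IsSmoothForm.contDiffAt {q : ℕ} {w : RawForm E M q} (hw : IsSmoothForm w) (x : M) :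
    ContDiffAt ℝ ∞ (inChart x w) (extChartAt 𝓘(ℝ, E) x x) :=
  (hw x).contDiffAt ((isOpen_chartTarget x).mem_nhds (mem_extChartAt_target x))

theorem rawExtDeriv_add {q : ℕ} {w w' : RawForm E M q} (hw : IsSmoothForm w)
    (hw' : IsSmoothForm w') : rawExtDeriv (w + w') = rawExtDeriv w + rawExtDeriv w' := by
  funext x
  have h := extDeriv_add ((hw.contDiffAt x).differentiableAt (by simp))
    ((hw'.contDiffAt x).differentiableAt (by simp))
  have h' : inChart x (w + w') = inChart x w + inChart x w' := rfl
  unfold rawExtDeriv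
  rw [h', h]
  rfl

theorem rawExtDeriv_smul {q : ℕ} (c : ℝ) (w : RawForm E M q) :
    rawExtDeriv (c • w) = c • rawExtDeriv w := by
  funext x
  have h' : inChart x (c • w) = c • inChart x w := rfl
  unfold rawExtDeriv
  rw [h', extDeriv_smul]
  rfl

theorem minSmoothness_two_le : minSmoothness ℝ 2 ≤ ∞ := by
  simp only [minSmoothness_of_isRCLikeNormedField]
  exact ENat.LEInfty.out

variable [IsManifold 𝓘(ℝ, E) ∞ M]

theorem extDeriv_pullbackE {q : ℕ} {w : RawForm E M q} (hw : IsSmoothForm w) {f : E → M} {y : E}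
    (hf : ∀ᶠ z in 𝓝 y, ContMDiffAt 𝓘(ℝ, E) 𝓘(ℝ, E) ∞ f z) :
    extDeriv (pullbackE f w) y = pullbackE f (rawExtDeriv w) y := by
  set x := f y with hx
  have hsrc : ∀ᶠ z in 𝓝 y, f z ∈ (extChartAt 𝓘(ℝ, E) x).source :=
    hf.self_of_nhds.continuousAt.eventually (extChartAt_source_mem_nhds x)
  have h1 : pullbackE f w =ᶠ[𝓝 y] fun z =>
      (inChart x w (extChartAt 𝓘(ℝ, E) x (f z))).compContinuousLinearMap
        (fderiv ℝ (fun z => extChartAt 𝓘(ℝ, E) x (f z)) z) := by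
    filter_upwards [hf, hsrc] with z hz hz'
    exact pullbackE_eq_pullback_inChart w x hz hz'
  have hu : ContMDiffAt 𝓘(ℝ, E) 𝓘(ℝ, E) ∞ (fun z => extChartAt 𝓘(ℝ, E) x (f z)) y :=
    ContMDiffAt.comp y (g := extChartAt 𝓘(ℝ, E) x) contMDiffAt_extChartAt hf.self_of_nhds
  have h2 : mfderiv 𝓘(ℝ, E) 𝓘(ℝ, E) (extChartAt 𝓘(ℝ, E) x ∘ f) y =
      (mfderiv 𝓘(ℝ, E) 𝓘(ℝ, E) (extChartAt 𝓘(ℝ, E) x) x).comp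
        (mfderiv 𝓘(ℝ, E) 𝓘(ℝ, E) f y) :=
    mfderiv_comp y (mdifferentiableAt_extChartAt (mem_chart_source E x))
      (hf.self_of_nhds.mdifferentiableAt (by simp))
  rw [mfderiv_eq_fderiv] at h2
  rw [h1.extDeriv_eq, extDeriv_pullback (r := ∞) (f := fun z => extChartAt 𝓘(ℝ, E) x (f z))
    ((hw.contDiffAt x).differentiableAt (by simp)) hu.contDiffAt minSmoothness_two_le]
  ext v
  show (extDeriv (inChart x w) (extChartAt 𝓘(ℝ, E) x x)) _ =
    (extDeriv (inChart x w) (extChartAt 𝓘(ℝ, E) x x)) _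
  congr 1
  ext i
  exact DFunLike.congr_fun h2 (v i)

theorem contMDiffAt_chartSymm (x₀ : M) {y : E} (hy : y ∈ (extChartAt 𝓘(ℝ, E) x₀).target) :
    ∀ᶠ z in 𝓝 y, ContMDiffAt 𝓘(ℝ, E) 𝓘(ℝ, E) ∞ (extChartAt 𝓘(ℝ, E) x₀).symm z := by
  filter_upwards [(isOpen_chartTarget x₀).mem_nhds hy] with z hz
  exact (contMDiffOn_extChartAt_symm x₀).contMDiffAt ((isOpen_chartTarget x₀).mem_nhds hz)

/-- The exterior derivative may be computed in any preferred chart. -/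
theorem inChart_rawExtDeriv {q : ℕ} {w : RawForm E M q} (hw : IsSmoothForm w) (x₀ : M) {y : E}
    (hy : y ∈ (extChartAt 𝓘(ℝ, E) x₀).target) :
    inChart x₀ (rawExtDeriv w) y = extDeriv (inChart x₀ w) y :=
  (extDeriv_pullbackE hw (contMDiffAt_chartSymm x₀ hy)).symm

theorem rawExtDeriv_rawExtDeriv {q : ℕ} {w : RawForm E M q} (hw : IsSmoothForm w) :
    rawExtDeriv (rawExtDeriv w) = 0 := by
  funext x
  have h1 : inChart x (rawExtDeriv w) =ᶠ[𝓝 (extChartAt 𝓘(ℝ, E) x x)]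
      extDeriv (inChart x w) := by
    filter_upwards [(isOpen_chartTarget x).mem_nhds (mem_extChartAt_target x)] with y hy
    exact inChart_rawExtDeriv hw x hy
  rw [rawExtDeriv, h1.extDeriv_eq, extDeriv_extDeriv_apply (hw.contDiffAt x)
    minSmoothness_two_le]
  rfl

theorem IsSmoothFamily.extDeriv {J : ModelWithCorners ℝ EP HP} [J.Boundaryless] {q : ℕ}
    {w : P → RawForm E M q} (hw : IsSmoothFamily J w) :
    IsSmoothFamily J (fun s => rawExtDeriv (w s)) := by
  intro x₀
  rintro ⟨s, y⟩ ⟨-, hy⟩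
  refine ContMDiffAt.contMDiffWithinAt ?_
  have hn := (isOpen_univ.prod (isOpen_chartTarget x₀)).mem_nhds
    (⟨Set.mem_univ s, hy⟩ : (s, y) ∈ Set.univ ×ˢ (extChartAt 𝓘(ℝ, E) x₀).target)
  have h1 := contMDiffAt_fderiv_param J (f := fun s y => inChart x₀ (w s) y)
    ((hw x₀).contMDiffAt hn)
  have h2 := ContMDiffAt.comp (s, y)
    (ContinuousAlternatingMap.alternatizeUncurryFinCLM ℝ E ℝ (n := q)).contDiff.contMDiff.contMDiffAt
    h1
  refine h2.congr_of_eventuallyEq ?_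
  filter_upwards [hn] with z hz
  exact inChart_rawExtDeriv (hw.form z.1) x₀ hz.2

end

/-- Functoriality of the pull-back. -/
theorem pullback_pullback {q : ℕ} (w : RawForm E M q) {f : N → M} {g : N' → N}
    (hf : MDifferentiable 𝓘(ℝ, E) 𝓘(ℝ, E) f) (hg : MDifferentiable 𝓘(ℝ, E) 𝓘(ℝ, E) g) :
    pullback g (pullback f w) = pullback (f ∘ g) w := by
  funext x
  have h := mfderiv_comp x (hf (g x)) (hg x)
  ext v
  show (w (f (g x))) _ = (w (f (g x))) _
  congr 1
  ext i
  exact (DFunLike.congr_fun h (v i)).symm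

theorem pullback_id {q : ℕ} (w : RawForm E M q) : pullback id w = w := by
  funext x
  ext v
  show (w x) _ = (w x) _
  congr 1
  ext i
  exact DFunLike.congr_fun (mfderiv_id (I := 𝓘(ℝ, E)) (x := x)) (v i)

theorem inChart_pullback {q : ℕ} [IsManifold 𝓘(ℝ, E) ∞ N] (w : RawForm E M q) {f : N → M}
    (hf : MDifferentiable 𝓘(ℝ, E) 𝓘(ℝ, E) f) (x₀ : N) {y : E}
    (hy : y ∈ (extChartAt 𝓘(ℝ, E) x₀).target) :
    inChart x₀ (pullback f w) y = pullbackE (f ∘ (extChartAt 𝓘(ℝ, E) x₀).symm) w y := by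
  have h := mfderiv_comp y (hf ((extChartAt 𝓘(ℝ, E) x₀).symm y))
    ((contMDiffAt_chartSymm x₀ hy).self_of_nhds.mdifferentiableAt (by simp))
  ext v
  show (w (f ((extChartAt 𝓘(ℝ, E) x₀).symm y))) _ = (w (f ((extChartAt 𝓘(ℝ, E) x₀).symm y))) _
  congr 1
  ext i
  exact (DFunLike.congr_fun h (v i)).symm

/-- The exterior derivative commutes with pull-backs. -/
theorem rawExtDeriv_pullback [IsManifold 𝓘(ℝ, E) ∞ M] [IsManifold 𝓘(ℝ, E) ∞ N] {q : ℕ}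
    {w : RawForm E M q} (hw : IsSmoothForm w) {f : N → M}
    (hf : ContMDiff 𝓘(ℝ, E) 𝓘(ℝ, E) ∞ f) :
    rawExtDeriv (pullback f w) = pullback f (rawExtDeriv w) := by
  funext x
  set y := extChartAt 𝓘(ℝ, E) x x with hy
  have hyt : y ∈ (extChartAt 𝓘(ℝ, E) x).target := mem_extChartAt_target x
  have hmd : MDifferentiable 𝓘(ℝ, E) 𝓘(ℝ, E) f := hf.mdifferentiable (by simp)
  have h1 : inChart x (pullback f w) =ᶠ[𝓝 y]
      pullbackE (f ∘ (extChartAt 𝓘(ℝ, E) x).symm) w := by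
    filter_upwards [(isOpen_chartTarget x).mem_nhds hyt] with z hz
    exact inChart_pullback w hmd x hz
  have h2 : extDeriv (inChart x (pullback f w)) y =
      inChart x (pullback f (rawExtDeriv w)) y := by
    rw [h1.extDeriv_eq, extDeriv_pullbackE hw, inChart_pullback _ hmd x hyt]
    filter_upwards [contMDiffAt_chartSymm x hyt] with z hz
    exact ContMDiffAt.comp z (hf _) hz
  have h3 : pullback (extChartAt 𝓘(ℝ, E) x) (pullback (extChartAt 𝓘(ℝ, E) x).symm
      (pullback f (rawExtDeriv w))) x = pullback f (rawExtDeriv w) x := by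
    set η := pullback f (rawExtDeriv w)
    have hx : (extChartAt 𝓘(ℝ, E) x).symm (extChartAt 𝓘(ℝ, E) x x) = x :=
      extChartAt_to_inv x
    have h4 : (extChartAt 𝓘(ℝ, E) x).symm ∘ extChartAt 𝓘(ℝ, E) x =ᶠ[𝓝 x] id := by
      filter_upwards [extChartAt_source_mem_nhds (I := 𝓘(ℝ, E)) x] with z hz
      exact (extChartAt 𝓘(ℝ, E) x).left_inv hz
    have h5 := mfderiv_comp x (f := extChartAt 𝓘(ℝ, E) x)
      ((contMDiffAt_chartSymm x hyt).self_of_nhds.mdifferentiableAt (by simp))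
      (mdifferentiableAt_extChartAt (I := 𝓘(ℝ, E)) (mem_chart_source E x))
    rw [h4.mfderiv_eq, mfderiv_id] at h5
    have key : ∀ a b : N, a = b → ∀ v : Fin (q + 1) → E,
        (show E [⋀^Fin (q + 1)]→L[ℝ] ℝ from η a) v =
          (show E [⋀^Fin (q + 1)]→L[ℝ] ℝ from η b) v := by
      rintro a b rfl v; rfl
    ext v
    refine Eq.trans (key _ _ hx _) ?_
    congr 1
    ext i
    exact (DFunLike.congr_fun h5 (v i)).symm
  rw [rawExtDeriv, ← hy, h2]
  exact h3

/-- Pull-backs of smooth families by smooth families of maps are smooth. -/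
theorem IsSmoothFamily.pullback [FiniteDimensional ℝ E] [IsManifold 𝓘(ℝ, E) ∞ M]
    [IsManifold 𝓘(ℝ, E) ∞ N] {q : ℕ}
    {J : ModelWithCorners ℝ EP HP} {J' : ModelWithCorners ℝ EP' HP'} [J'.Boundaryless]
    {w : P → RawForm E M q} (hw : IsSmoothFamily J w) {v : P' → P} (hv : ContMDiff J' J ∞ v)
    {f : P' → N → M}
    (hf : ContMDiff (J'.prod 𝓘(ℝ, E)) 𝓘(ℝ, E) ∞ (Function.uncurry f)) :
    IsSmoothFamily J' (fun s => HopfCyclic.pullback (f s) (w (v s))) := by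
  intro x₀
  rintro ⟨s, y⟩ ⟨-, hy⟩
  refine ContMDiffAt.contMDiffWithinAt ?_
  have hn := (isOpen_univ.prod (isOpen_chartTarget x₀)).mem_nhds
    (⟨Set.mem_univ s, hy⟩ : (s, y) ∈ Set.univ ×ˢ (extChartAt 𝓘(ℝ, E) x₀).target)
  have h1 : ∀ᶠ z : P' × E in 𝓝 (s, y), ContMDiffAt (J'.prod 𝓘(ℝ, E)) 𝓘(ℝ, E) ∞
      (Function.uncurry fun (s : P') (y : E) => f s ((extChartAt 𝓘(ℝ, E) x₀).symm y)) z := by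
    filter_upwards [hn] with z hz
    refine ContMDiffAt.comp z (g := Function.uncurry f)
      (f := fun z : P' × E => (z.1, (extChartAt 𝓘(ℝ, E) x₀).symm z.2)) (hf _) ?_
    exact contMDiffAt_fst.prodMk
      (ContMDiffAt.comp z (contMDiffAt_chartSymm x₀ hz.2).self_of_nhds contMDiffAt_snd)
  refine (contMDiffAt_pullback J J' hw hv h1).congr_of_eventuallyEq ?_
  filter_upwards [hn] with z hz
  refine inChart_pullback _ ?_ x₀ hz.2
  have h2 : ContMDiff 𝓘(ℝ, E) 𝓘(ℝ, E) ∞ (f z.1) :=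
    hf.comp (f := fun x : N => (z.1, x)) (contMDiff_const.prodMk contMDiff_id)
  exact h2.mdifferentiable (by simp)

end Forms
/-! ### Cocyclic modules and their cyclic cohomology -/

universe u

/-- A cocyclic object in the category of (nonnegatively graded) cochain complexes of real vector
spaces: `X p q` is the part of cosimplicial degree `p` and of internal degree `q`, `d` is the
internal differential, `δ`, `σ`, `τ` are the cofaces, the codegeneracies and the cyclic
operators. -/
structure DGCocyclicModule where
  X : ℕ → ℕ → Type u
  [addCommGroup : ∀ p q, AddCommGroup (X p q)]
  [module : ∀ p q, Module ℝ (X p q)]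
  d : ∀ {p q : ℕ}, X p q →ₗ[ℝ] X p (q + 1)
  δ : ∀ {p q : ℕ}, Fin (p + 2) → (X p q →ₗ[ℝ] X (p + 1) q)
  σ : ∀ {p q : ℕ}, Fin (p + 1) → (X (p + 1) q →ₗ[ℝ] X p q)
  τ : ∀ {p q : ℕ}, X p q →ₗ[ℝ] X p q
  d_d : ∀ {p q : ℕ} (x : X p q), d (d x) = 0
  d_δ : ∀ {p q : ℕ} (i : Fin (p + 2)) (x : X p q), d (δ i x) = δ i (d x)
  d_σ : ∀ {p q : ℕ} (i : Fin (p + 1)) (x : X (p + 1) q), d (σ i x) = σ i (d x)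
  d_τ : ∀ {p q : ℕ} (x : X p q), d (τ x) = τ (d x)
  δ_δ : ∀ {p q : ℕ} {i j : Fin (p + 2)} (_ : i ≤ j) (x : X p q),
    δ j.succ (δ i x) = δ i.castSucc (δ j x)
  σ_δ_of_le : ∀ {p q : ℕ} {i : Fin (p + 2)} {j : Fin (p + 1)} (_ : i ≤ j.castSucc)
    (x : X (p + 1) q), σ j.succ (δ i.castSucc x) = δ i (σ j x)
  σ_δ_self : ∀ {p q : ℕ} (i : Fin (p + 1)) (x : X p q), σ i (δ i.castSucc x) = x
  σ_δ_succ : ∀ {p q : ℕ} (i : Fin (p + 1)) (x : X p q), σ i (δ i.succ x) = x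
  σ_δ_of_gt : ∀ {p q : ℕ} {i : Fin (p + 2)} {j : Fin (p + 1)} (_ : j.castSucc < i)
    (x : X (p + 1) q), σ j.castSucc (δ i.succ x) = δ i (σ j x)
  σ_σ : ∀ {p q : ℕ} {i j : Fin (p + 1)} (_ : i ≤ j) (x : X (p + 2) q),
    σ j (σ i.castSucc x) = σ i (σ j.succ x)
  τ_δ_zero : ∀ {p q : ℕ} (x : X p q), τ (δ 0 x) = δ (Fin.last (p + 1)) x
  τ_δ_succ : ∀ {p q : ℕ} (i : Fin (p + 1)) (x : X p q),
    τ (δ i.succ x) = δ i.castSucc (τ x)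
  τ_σ_zero : ∀ {p q : ℕ} (x : X (p + 1) q), τ (σ 0 x) = σ (Fin.last p) (τ (τ x))
  τ_σ_succ : ∀ {p q : ℕ} (i : Fin p) (x : X (p + 1) q),
    τ (σ i.succ x) = σ i.castSucc (τ x)
  τ_pow : ∀ {p q : ℕ} (x : X p q), (τ ^ (p + 1)) x = x

attribute [instance] DGCocyclicModule.addCommGroup DGCocyclicModule.module

namespace DGCocyclicModule

variable (C : DGCocyclicModule.{u}) {p q : ℕ}

/-- The Hochschild coboundary `b = ∑ᵢ (-1)ⁱ δᵢ`. -/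
def b : C.X p q →ₗ[ℝ] C.X (p + 1) q := ∑ i : Fin (p + 2), (-1 : ℝ) ^ (i : ℕ) • C.δ i

/-- The signed cyclic operator `(-1)^p τ`. -/
def lam : C.X p q →ₗ[ℝ] C.X p q := (-1 : ℝ) ^ p • C.τ

/-- The norm operator `1 + λ + ⋯ + λ^p`. -/
def norm : C.X p q →ₗ[ℝ] C.X p q := ∑ i ∈ Finset.range (p + 1), C.lam ^ i

/-- The extra codegeneracy `σ_p τ`. -/
def extra : C.X (p + 1) q →ₗ[ℝ] C.X p q := C.σ (Fin.last p) ∘ₗ C.τ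

/-- Connes' operator `B`, lowering the cosimplicial degree. -/
def connesB : C.X (p + 1) q →ₗ[ℝ] C.X p q :=
  C.norm ∘ₗ C.extra ∘ₗ (LinearMap.id - C.lam)

/-- The direct sum of all components. -/
abbrev Total : Type u := ⨁ pq : ℕ × ℕ, C.X pq.1 pq.2

/-- The inclusion of a component. -/
def incl (p q : ℕ) : C.X p q →ₗ[ℝ] C.Total :=
  DirectSum.lof ℝ (ℕ × ℕ) (fun pq => C.X pq.1 pq.2) (p, q)

/-- The total differential on one component: `b + (-1)^p d + B`. -/
def totalDComponent : ∀ p q : ℕ, C.X p q →ₗ[ℝ] C.Total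
  | 0, q => C.incl 1 q ∘ₗ C.b + C.incl 0 (q + 1) ∘ₗ C.d
  | p + 1, q => C.incl (p + 2) q ∘ₗ C.b + (-1 : ℝ) ^ (p + 1) • C.incl (p + 1) (q + 1) ∘ₗ C.d +
      C.incl p q ∘ₗ C.connesB

/-- The total differential `b + (-1)^p d + B`. -/
def totalD : C.Total →ₗ[ℝ] C.Total :=
  DirectSum.toModule ℝ (ℕ × ℕ) C.Total (fun pq => C.totalDComponent pq.1 pq.2)

/-- signed cofaces with a natural number index -/
def sface (i : ℕ) : C.X p q →ₗ[ℝ] C.X (p + 1) q :=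
  if h : i < p + 2 then (-1 : ℝ) ^ i • C.δ ⟨i, h⟩ else 0

theorem b_eq : (C.b : C.X p q →ₗ[ℝ] _) = ∑ i ∈ Finset.range (p + 2), C.sface i := by
  rw [Finset.sum_range, b]
  refine Finset.sum_congr rfl fun i _ => ?_
  simp [sface]

/-- The coboundary without its last term. -/
def b' : C.X p q →ₗ[ℝ] C.X (p + 1) q := ∑ i ∈ Finset.range (p + 1), C.sface i

theorem b_eq_b' (x : C.X p q) : C.b x = C.b' x + C.sface (p + 1) x := by
  rw [b_eq, Finset.sum_range_succ, b']; rfl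

theorem lam_sface_zero (x : C.X p q) : C.lam (C.sface 0 x) = C.sface (p + 1) x := by
  have := C.τ_δ_zero x
  simp only [lam, sface]
  simp only [Nat.zero_lt_succ, dite_true, Nat.lt_succ_self, LinearMap.smul_apply, pow_zero,
    one_smul]
  congr 1

theorem lam_sface_succ {i : ℕ} (hi : i < p + 1) (x : C.X p q) :
    C.lam (C.sface (i + 1) x) = C.sface i (C.lam x) := by
  have := C.τ_δ_succ ⟨i, hi⟩ x
  simp only [Fin.succ_mk, Fin.castSucc_mk] at this
  simp only [lam, sface, dif_pos (show i + 1 < p + 2 by omega), dif_pos (show i < p + 2 by omega),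
    LinearMap.smul_apply, map_smul, this, smul_smul]
  congr 1
  ring

theorem lam_pow (x : C.X p q) : (C.lam ^ (p + 1)) x = x := by
  rw [lam, smul_pow, LinearMap.smul_apply, C.τ_pow, ← pow_mul,
    Even.neg_one_pow (Nat.even_mul_succ_self p), one_smul]

theorem norm_apply (x : C.X p q) :
    C.norm x = ∑ i ∈ Finset.range (p + 1), (C.lam ^ i) x := by
  simp [norm]

theorem norm_lam (x : C.X p q) : C.norm (x - C.lam x) = 0 := by
  have h : ∀ i, (C.lam ^ i) (C.lam x) = (C.lam ^ (i + 1)) x := fun i => by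
    rw [pow_succ]; rfl
  rw [map_sub, norm_apply, norm_apply]
  simp only [h]
  rw [← neg_sub, ← Finset.sum_sub_distrib, Finset.sum_range_sub (fun i => (C.lam ^ i) x), lam_pow]
  simp

theorem lam_norm (x : C.X p q) : C.norm x - C.lam (C.norm x) = 0 := by
  have h : ∀ i, C.lam ((C.lam ^ i) x) = (C.lam ^ (i + 1)) x := fun i => by
    rw [pow_succ']; rfl
  rw [norm_apply, map_sum]
  simp only [h]
  rw [← neg_sub, ← Finset.sum_sub_distrib, Finset.sum_range_sub (fun i => (C.lam ^ i) x), lam_pow]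
  simp

theorem one_sub_lam_b (x : C.X p q) : C.b x - C.lam (C.b x) = C.b' (x - C.lam x) := by
  have h1 : C.lam (C.b x) = C.b' (C.lam x) + C.sface (p + 1) x := by
    rw [b_eq, Finset.sum_range_succ', b', LinearMap.add_apply, map_add, lam_sface_zero]
    simp only [LinearMap.sum_apply, map_sum]
    congr 1
    exact Finset.sum_congr rfl fun i hi => C.lam_sface_succ (Finset.mem_range.1 hi) x
  rw [h1, b_eq_b', map_sub]
  abel

theorem lam_pow_sface {k i : ℕ} (hk : k ≤ i) (hi : i < p + 2) (x : C.X p q) :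
    (C.lam ^ k) (C.sface i x) = C.sface (i - k) ((C.lam ^ k) x) := by
  induction k generalizing i x with
  | zero => simp
  | succ k ih =>
    obtain ⟨i, rfl⟩ : ∃ j, i = j + 1 := ⟨i - 1, by omega⟩
    rw [pow_succ, Module.End.mul_apply, C.lam_sface_succ (by omega), ih (by omega) (by omega)]
    congr 1
    · congr 1; omega

theorem lam_pow_sface' {k i : ℕ} (hk : i < k) (hk' : k ≤ p + 1) (hi : i < p + 1)
    (x : C.X p q) :
    (C.lam ^ k) (C.sface i x) = C.sface (p + 2 + i - k) ((C.lam ^ (k - 1)) x) := by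
  obtain ⟨l, rfl⟩ : ∃ l, k = l + (1 + i) := ⟨k - (1 + i), by omega⟩
  rw [pow_add, pow_add, Module.End.mul_apply, Module.End.mul_apply,
    C.lam_pow_sface le_rfl (by omega), Nat.sub_self, pow_one, C.lam_sface_zero,
    C.lam_pow_sface (by omega) (by omega), show l + (1 + i) - 1 = l + i by omega, pow_add,
    Module.End.mul_apply]
  congr 1
  congr 1; omega

theorem b_norm (x : C.X p q) : C.b (C.norm x) = C.norm (C.b' x) := by
  have h1 : C.b (C.norm x) = ∑ z ∈ Finset.range (p + 2) ×ˢ Finset.range (p + 1),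
      C.sface z.1 ((C.lam ^ z.2) x) := by
    rw [Finset.sum_product, b_eq, norm_apply]
    simp only [LinearMap.sum_apply, map_sum]
    exact Finset.sum_comm
  have h2 : C.norm (C.b' x) = ∑ z ∈ Finset.range (p + 2) ×ˢ Finset.range (p + 1),
      (C.lam ^ z.1) (C.sface z.2 x) := by
    rw [Finset.sum_product, b', norm_apply]
    simp [LinearMap.sum_apply, map_sum]
  rw [h1, h2]
  refine (Finset.sum_bij' (fun z _ => if z.1 ≤ z.2 then (z.2 - z.1, z.1)
      else (p + 2 + z.2 - z.1, z.1 - 1))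
    (fun z _ => if z.1 + z.2 ≤ p then (z.2, z.1 + z.2)
      else (z.2 + 1, z.1 + z.2 - p - 1)) ?_ ?_ ?_ ?_ ?_).symm
  · rintro ⟨k, i⟩ hz
    simp only [Finset.mem_product, Finset.mem_range] at hz ⊢
    split_ifs <;> (simp only; omega)
  · rintro ⟨k, i⟩ hz
    simp only [Finset.mem_product, Finset.mem_range] at hz ⊢
    split_ifs <;> (simp only; omega)
  · rintro ⟨k, i⟩ hz
    simp only [Finset.mem_product, Finset.mem_range] at hz ⊢
    rcases le_or_gt k i with h | h
    · simp only [if_pos h]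
      rw [if_pos (by omega), Prod.mk.injEq]
      omega
    · simp only [if_neg (not_le.2 h)]
      rw [if_neg (by omega), Prod.mk.injEq]
      omega
  · rintro ⟨k, i⟩ hz
    simp only [Finset.mem_product, Finset.mem_range] at hz ⊢
    rcases le_or_gt (k + i) p with h | h
    · simp only [if_pos h]
      rw [if_pos (by omega), Prod.mk.injEq]
      omega
    · simp only [if_neg (not_le.2 h)]
      rw [if_neg (by omega), Prod.mk.injEq]
      omega
  · rintro ⟨k, i⟩ hz
    simp only [Finset.mem_product, Finset.mem_range] at hz ⊢
    split_ifs with h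
    · exact C.lam_pow_sface h (by omega) x
    · exact C.lam_pow_sface' (by omega) (by omega) (by omega) x

theorem extra_b' (x : C.X (p + 1) q) : C.extra (C.b' x) + C.b' (C.extra x) = x := by
  have h0 : C.extra (C.sface 0 x) = x := by
    have h1 : C.sface 0 x = C.δ 0 x := by simp [sface]
    rw [h1, extra, LinearMap.comp_apply, C.τ_δ_zero]
    exact C.σ_δ_succ (Fin.last (p + 1)) x
  have hs : ∀ i < p + 1, C.extra (C.sface (i + 1) x) = - C.sface i (C.extra x) := by
    intro i hi
    have h1 := C.τ_δ_succ ⟨i, by omega⟩ x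
    have h2 := C.σ_δ_of_le (i := ⟨i, by omega⟩) (j := Fin.last p)
      (by rw [Fin.le_def]; simp; omega) (C.τ x)
    simp only [Fin.succ_mk, Fin.castSucc_mk] at h1 h2
    simp only [extra, sface, dif_pos (show i + 1 < p + 1 + 2 by omega),
      dif_pos (show i < p + 2 by omega), LinearMap.comp_apply, LinearMap.smul_apply, map_smul, h1]
    rw [Fin.succ_last] at h2
    rw [h2, pow_succ]
    simp
  have h1 : C.b' x = ∑ i ∈ Finset.range (p + 1), C.sface (i + 1) x + C.sface 0 x := by
    rw [b', Finset.sum_range_succ']; simp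
  have h2 : C.b' (C.extra x) = ∑ i ∈ Finset.range (p + 1), C.sface i (C.extra x) := by
    simp [b']
  rw [h1, h2, map_add, h0, map_sum, Finset.sum_congr rfl fun i hi => hs i (Finset.mem_range.1 hi),
    Finset.sum_neg_distrib]
  abel

theorem b_apply (x : C.X p q) :
    C.b x = ∑ i : Fin (p + 2), (-1 : ℝ) ^ (i : ℕ) • C.δ i x := by
  simp [b]

theorem b_b (x : C.X p q) : C.b (C.b x) = 0 := by
  have h : C.b (C.b x) = ∑ z : Fin (p + 3) × Fin (p + 2),
      (-1 : ℝ) ^ ((z.1 : ℕ) + z.2) • C.δ z.1 (C.δ z.2 x) := by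
    rw [Fintype.sum_prod_type, b_apply, b_apply]
    simp only [map_sum, map_smul, Finset.smul_sum, smul_smul, pow_add]
  rw [h]
  refine Finset.sum_involution (fun z _ => if hz : (z.2 : ℕ) < z.1 then
      (z.2.castSucc, ⟨(z.1 : ℕ) - 1, by omega⟩) else (z.2.succ, ⟨z.1, by omega⟩)) ?_ ?_ ?_ ?_
  · rintro ⟨⟨j, hj⟩, ⟨i, hi⟩⟩ -
    simp only
    split_ifs with hz
    · obtain ⟨j, rfl⟩ : ∃ l, j = l + 1 := ⟨j - 1, by omega⟩
      have := C.δ_δ (i := ⟨i, hi⟩) (j := ⟨j, by omega⟩) (by rw [Fin.le_def]; simp; omega) x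
      simp only [Fin.succ_mk, Fin.castSucc_mk, Nat.add_sub_cancel] at this ⊢
      rw [this, ← add_smul]
      convert zero_smul ℝ _
      ring
    · have := C.δ_δ (i := ⟨j, by omega⟩) (j := ⟨i, hi⟩) (by rw [Fin.le_def]; simp; omega) x
      simp only [Fin.succ_mk, Fin.castSucc_mk] at this ⊢
      rw [this, ← add_smul]
      convert zero_smul ℝ _
      ring
  · rintro ⟨⟨j, hj⟩, ⟨i, hi⟩⟩ - -
    simp only
    split_ifs with hz
    · intro h
      simp only [Fin.castSucc_mk, Prod.mk.injEq, Fin.mk.injEq] at h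
      have hz' : i < j := hz
      omega
    · intro h
      simp only [Fin.succ_mk, Prod.mk.injEq, Fin.mk.injEq] at h
      have hz' : ¬ i < j := hz
      omega
  · intros; exact Finset.mem_univ _
  · rintro ⟨⟨j, hj⟩, ⟨i, hi⟩⟩ -
    by_cases hz : i < j
    · simp only [hz, dite_true, Fin.castSucc_mk]
      rw [dif_neg (by omega)]
      refine Prod.ext (Fin.ext ?_) (Fin.ext ?_) <;> simp only [Fin.succ_mk] <;> omega
    · simp only [hz, dite_false, Fin.succ_mk]
      rw [dif_pos (by omega)]
      refine Prod.ext (Fin.ext ?_) (Fin.ext ?_) <;> simp only [Fin.castSucc_mk] <;> omega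

theorem connesB_apply (x : C.X (p + 1) q) :
    C.connesB x = C.norm (C.extra (x - C.lam x)) := rfl

theorem connesB_connesB (x : C.X (p + 2) q) : C.connesB (C.connesB x) = 0 := by
  rw [connesB_apply, connesB_apply C x, lam_norm, map_zero, map_zero]

theorem b_connesB (x : C.X (p + 1) q) : C.b (C.connesB x) + C.connesB (C.b x) = 0 := by
  rw [connesB_apply, connesB_apply, one_sub_lam_b, b_norm, ← map_add, add_comm (C.b' _), extra_b',
    norm_lam]

theorem connesB_b_zero (x : C.X 0 q) : C.connesB (C.b x) = 0 := by
  have h1 : C.lam x = x := by simpa using C.lam_pow x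
  rw [connesB_apply, one_sub_lam_b, h1]
  simp

theorem d_b (x : C.X p q) : C.d (C.b x) = C.b (C.d x) := by
  simp [b_apply, map_sum, C.d_δ]

theorem d_lam (x : C.X p q) : C.d (C.lam x) = C.lam (C.d x) := by
  simp [lam, C.d_τ]

theorem d_connesB (x : C.X (p + 1) q) : C.d (C.connesB x) = C.connesB (C.d x) := by
  have h : ∀ (i : ℕ) (y : C.X p q), C.d ((C.lam ^ i) y) = (C.lam ^ i) (C.d y) := by
    intro i
    induction i with
    | zero => intro y; rfl
    | succ i ih => intro y; rw [pow_succ, Module.End.mul_apply, ih, d_lam]; rfl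
  simp only [connesB_apply, norm_apply, map_sum, h, extra, LinearMap.comp_apply, C.d_σ, C.d_τ,
    map_sub, C.d_lam]

theorem totalD_incl_zero (q : ℕ) (x : C.X 0 q) :
    C.totalD (C.incl 0 q x) = C.incl 1 q (C.b x) + C.incl 0 (q + 1) (C.d x) := by
  rw [totalD, incl, DirectSum.toModule_lof]
  rfl

theorem totalD_incl_succ (p q : ℕ) (x : C.X (p + 1) q) :
    C.totalD (C.incl (p + 1) q x) = C.incl (p + 2) q (C.b x) +
      (-1 : ℝ) ^ (p + 1) • C.incl (p + 1) (q + 1) (C.d x) + C.incl p q (C.connesB x) := by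
  rw [totalD, incl, DirectSum.toModule_lof]
  rfl

theorem totalD_totalD (x : C.Total) : C.totalD (C.totalD x) = 0 := by
  suffices h : C.totalD ∘ₗ C.totalD = 0 from LinearMap.congr_fun h x
  refine DirectSum.linearMap_ext ℝ ?_
  rintro ⟨p, q⟩
  refine LinearMap.ext fun x => ?_
  change C.totalD (C.totalD (C.incl p q x)) = 0
  rcases p with _ | _ | p
  · simp only [totalD_incl_zero, totalD_incl_succ, map_add, b_b, d_b, C.d_d, connesB_b_zero,
      map_zero]
    simp
  · have h1 := C.b_connesB x
    simp only [totalD_incl_zero, totalD_incl_succ, map_add, b_b, d_b, C.d_d, map_zero, map_smul,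
      d_connesB, eq_neg_of_add_eq_zero_left h1, map_neg]
    simp only [zero_add, pow_one]
    module
  · have h1 := C.b_connesB x
    simp only [totalD_incl_succ, map_add, b_b, d_b, C.d_d, map_zero, map_smul, d_connesB,
      connesB_connesB, eq_neg_of_add_eq_zero_left h1, map_neg, pow_succ]
    module

end DGCocyclicModule

/-! ### The wedge product -/

section Wedge

variable {V : Type*} [AddCommGroup V] [Module ℝ V] [TopologicalSpace V]
  {V' : Type*} [AddCommGroup V'] [Module ℝ V'] [TopologicalSpace V'] {i j n : ℕ}

/-- The product `(v₁, …, v_n) ↦ a(v₁, …, v_i) b(v_{i+1}, …, v_n)`, where `n = i + j`. -/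
def mulMultilinear (h : i + j = n) (a : V [⋀^Fin i]→L[ℝ] ℝ) (b : V [⋀^Fin j]→L[ℝ] ℝ) :
    ContinuousMultilinearMap ℝ (fun _ : Fin n => V) ℝ where
  toMultilinearMap := ((LinearMap.mul' ℝ ℝ).compMultilinearMap
    (MultilinearMap.domCoprod a.toMultilinearMap b.toMultilinearMap)).domDomCongr
      (finSumFinEquiv.trans (finCongr h))
  cont := by
    change Continuous fun v : Fin n → V =>
      a (fun k => v (finCongr h (finSumFinEquiv (Sum.inl k)))) *
        b (fun k => v (finCongr h (finSumFinEquiv (Sum.inr k))))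
    fun_prop

theorem mulMultilinear_apply (h : i + j = n) (a : V [⋀^Fin i]→L[ℝ] ℝ) (b : V [⋀^Fin j]→L[ℝ] ℝ)
    (v : Fin n → V) : mulMultilinear h a b v =
      a (fun k => v (finCongr h (finSumFinEquiv (Sum.inl k)))) *
        b (fun k => v (finCongr h (finSumFinEquiv (Sum.inr k)))) := rfl

/-- The wedge product of alternating forms, normalized by `1 / (i! j!)`. -/
def wedge (h : i + j = n) (a : V [⋀^Fin i]→L[ℝ] ℝ) (b : V [⋀^Fin j]→L[ℝ] ℝ) :
    V [⋀^Fin n]→L[ℝ] ℝ :=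
  ((i.factorial * j.factorial : ℝ)⁻¹) • (mulMultilinear h a b).alternatization

theorem wedge_apply (h : i + j = n) (a : V [⋀^Fin i]→L[ℝ] ℝ) (b : V [⋀^Fin j]→L[ℝ] ℝ)
    (v : Fin n → V) : wedge h a b v = ((i.factorial * j.factorial : ℝ)⁻¹) *
      ∑ σ : Equiv.Perm (Fin n), (Equiv.Perm.sign σ : ℤ) •
        (a (fun k => v (σ (finCongr h (finSumFinEquiv (Sum.inl k))))) *
        b (fun k => v (σ (finCongr h (finSumFinEquiv (Sum.inr k)))))) := by
  rw [wedge, ContinuousAlternatingMap.smul_apply,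
    ContinuousMultilinearMap.alternatization_apply_apply]
  rfl

theorem wedge_comp (h : i + j = n) (a : V [⋀^Fin i]→L[ℝ] ℝ) (b : V [⋀^Fin j]→L[ℝ] ℝ)
    (L : V' →L[ℝ] V) : (wedge h a b).compContinuousLinearMap L =
      wedge h (a.compContinuousLinearMap L) (b.compContinuousLinearMap L) := by
  ext v
  simp only [ContinuousAlternatingMap.compContinuousLinearMap_apply, wedge_apply]
  rfl

variable (V) in
/-- The constant `1` as a form of degree zero. -/
def unitForm : V [⋀^Fin 0]→L[ℝ] ℝ := ContinuousAlternatingMap.constOfIsEmpty ℝ V (Fin 0) 1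

theorem wedge_unit_left (a : V [⋀^Fin n]→L[ℝ] ℝ) : wedge (zero_add n) (unitForm V) a = a := by
  ext v
  have h : ∀ σ : Equiv.Perm (Fin n),
      a (fun k => v (σ (finCongr (zero_add n) (finSumFinEquiv (Sum.inr k))))) =
        (Equiv.Perm.sign σ : ℤ) • a v := by
    intro σ
    have h1 : ∀ k, finCongr (zero_add n) (finSumFinEquiv (Sum.inr k)) = k := fun k => by
      ext; simp
    simp only [h1]
    exact a.map_perm v σ
  rw [wedge_apply]
  simp only [h, unitForm, ContinuousAlternatingMap.constOfIsEmpty_apply, one_mul, smul_smul,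
    ← Units.val_mul, ← map_mul]
  simp [Fintype.card_perm, n.factorial_ne_zero]

theorem wedge_unit_right (a : V [⋀^Fin n]→L[ℝ] ℝ) : wedge (add_zero n) a (unitForm V) = a := by
  ext v
  have h : ∀ σ : Equiv.Perm (Fin n),
      a (fun k => v (σ (finCongr (add_zero n) (finSumFinEquiv (Sum.inl k))))) =
        (Equiv.Perm.sign σ : ℤ) • a v := fun σ => a.map_perm v σ
  rw [wedge_apply]
  simp only [h, unitForm, ContinuousAlternatingMap.constOfIsEmpty_apply, mul_one, smul_smul,
    ← Units.val_mul, ← map_mul]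
  simp [Fintype.card_perm, n.factorial_ne_zero]

theorem mulMultilinear_add_left (h : i + j = n) (a a' : V [⋀^Fin i]→L[ℝ] ℝ)
    (b : V [⋀^Fin j]→L[ℝ] ℝ) :
    mulMultilinear h (a + a') b = mulMultilinear h a b + mulMultilinear h a' b := by
  ext v
  simp [mulMultilinear_apply, add_mul]

theorem mulMultilinear_add_right (h : i + j = n) (a : V [⋀^Fin i]→L[ℝ] ℝ)
    (b b' : V [⋀^Fin j]→L[ℝ] ℝ) :
    mulMultilinear h a (b + b') = mulMultilinear h a b + mulMultilinear h a b' := by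
  ext v
  simp [mulMultilinear_apply, mul_add]

variable (V) in
/-- The wedge product as a bilinear map. -/
def wedgeLinear (h : i + j = n) :
    (V [⋀^Fin i]→L[ℝ] ℝ) →ₗ[ℝ] (V [⋀^Fin j]→L[ℝ] ℝ) →ₗ[ℝ] (V [⋀^Fin n]→L[ℝ] ℝ) :=
  LinearMap.mk₂ ℝ (wedge h)
    (fun a a' b => by rw [wedge, mulMultilinear_add_left, map_add, smul_add]; rfl)
    (fun r a b => by
      ext v
      simp [wedge_apply, mul_assoc, mul_left_comm r, Finset.mul_sum])
    (fun a b b' => by rw [wedge, mulMultilinear_add_right, map_add, smul_add]; rfl)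
    (fun r a b => by
      ext v
      simp [wedge_apply, mul_left_comm _ r, Finset.mul_sum])

end Wedge

section SmoothWedge

variable {E : Type*} [NormedAddCommGroup E] [NormedSpace ℝ E] [FiniteDimensional ℝ E]
  {M : Type*} [TopologicalSpace M] [ChartedSpace E M]
  {EP HP P : Type*} [NormedAddCommGroup EP] [NormedSpace ℝ EP]
  [TopologicalSpace HP] [TopologicalSpace P] [ChartedSpace HP P] {i j n : ℕ}

theorem finiteDimensional_alternating (q : ℕ) : FiniteDimensional ℝ (E [⋀^Fin q]→L[ℝ] ℝ) :=
  Module.Finite.of_injective (ContinuousMultilinearMap.toMultilinearMapLinear ∘ₗ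
      ContinuousAlternatingMap.toContinuousMultilinearMapLinear (R := ℝ) (A := ℝ) :
      (E [⋀^Fin q]→L[ℝ] ℝ) →ₗ[ℝ] MultilinearMap ℝ (fun _ : Fin q => E) ℝ)
    (ContinuousMultilinearMap.toMultilinearMap_injective.comp
      ContinuousAlternatingMap.toContinuousMultilinearMap_injective)

theorem contDiff_wedge (h : i + j = n) :
    ContDiff ℝ ∞ (fun z : (E [⋀^Fin i]→L[ℝ] ℝ) × (E [⋀^Fin j]→L[ℝ] ℝ) => wedge h z.1 z.2) := by
  have := finiteDimensional_alternating (E := E) i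
  have := finiteDimensional_alternating (E := E) j
  let K : (E [⋀^Fin i]→L[ℝ] ℝ) →L[ℝ] (E [⋀^Fin j]→L[ℝ] ℝ) →L[ℝ] (E [⋀^Fin n]→L[ℝ] ℝ) :=
    LinearMap.toContinuousLinearMap
      { toFun := fun a => LinearMap.toContinuousLinearMap (wedgeLinear E h a)
        map_add' := fun a a' => by rw [map_add, map_add]
        map_smul' := fun r a => by rw [map_smul, map_smul]; rfl }
  exact ContDiff.clm_apply (K.contDiff.comp contDiff_fst) contDiff_snd

theorem IsSmoothFamily.wedge {J : ModelWithCorners ℝ EP HP} (h : i + j = n)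
    {w : P → RawForm E M i} {w' : P → RawForm E M j} (hw : IsSmoothFamily J w)
    (hw' : IsSmoothFamily J w') :
    IsSmoothFamily J (fun s x => HopfCyclic.wedge h (w s x) (w' s x) : P → RawForm E M n) := by
  intro x₀
  refine ContMDiffOn.congr (ContMDiff.comp_contMDiffOn (contDiff_wedge h).contMDiff
    ((hw x₀).prodMk_space (hw' x₀))) fun z _ => ?_
  exact wedge_comp h _ _ _

end SmoothWedge

/-! ### Powers of a Lie group, cochains -/

section Group

variable {F : Type*} [NormedAddCommGroup F] [NormedSpace ℝ F]
  {E : Type*} [NormedAddCommGroup E] [NormedSpace ℝ E]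
  {G : Type*} [TopologicalSpace G] [ChartedSpace F G]
  {M : Type*} [TopologicalSpace M] [ChartedSpace E M]

variable (F) in
/-- The model with corners of the power `G^p` of a manifold `G` modelled on `F`. -/
abbrev powModel (p : ℕ) : ModelWithCorners ℝ (Fin p → F) (ModelPi fun _ : Fin p => F) :=
  ModelWithCorners.pi fun _ : Fin p => 𝓘(ℝ, F)

instance powModel_boundaryless (p : ℕ) : (powModel F p).Boundaryless := by
  constructor
  ext v
  simp only [Set.mem_range, Set.mem_univ, iff_true]
  exact ⟨v, rfl⟩

section Pi

variable {EP HP P : Type*} [NormedAddCommGroup EP] [NormedSpace ℝ EP]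
  [TopologicalSpace HP] [TopologicalSpace P] [ChartedSpace HP P]

theorem contMDiff_pow_iff {J : ModelWithCorners ℝ EP HP} {p : ℕ} {f : P → Fin p → G} :
    ContMDiff J (powModel F p) ∞ f ↔ ∀ i, ContMDiff J 𝓘(ℝ, F) ∞ fun s => f s i := by
  have h : ∀ s, ContMDiffAt J (powModel F p) ∞ f s ↔
      ∀ i, ContMDiffAt J 𝓘(ℝ, F) ∞ (fun s => f s i) s := by
    intro s
    simp only [contMDiffAt_iff, continuousAt_pi, forall_and]
    refine and_congr Iff.rfl ?_
    exact contDiffWithinAt_pi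
  exact ⟨fun hf i s => (h s).1 (hf s) i, fun hf s => (h s).2 fun i => hf i s⟩

theorem contMDiff_coord {p : ℕ} (i : Fin p) :
    ContMDiff (powModel F p) 𝓘(ℝ, F) ∞ fun g : Fin p → G => g i :=
  contMDiff_pow_iff.1 (contMDiff_id (I := powModel F p) (M := Fin p → G)) i

end Pi

variable (F E G M) in
/-- Smooth maps from `G^p` to the space of differential `q`-forms on `M`. -/
def Cochain (p q : ℕ) : Submodule ℝ ((Fin p → G) → RawForm E M q) where
  carrier := {c | IsSmoothFamily (powModel F p) c}
  add_mem' h h' x₀ := (h x₀).add (h' x₀)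
  zero_mem' _ := by exact contMDiffOn_const (c := (0 : E [⋀^Fin q]→L[ℝ] ℝ))
  smul_mem' r _ h x₀ := by
    exact ContMDiff.comp_contMDiffOn (g := fun a : E [⋀^Fin q]→L[ℝ] ℝ => r • a)
      (contDiff_id.const_smul r).contMDiff (h x₀)

variable (E M) in
/-- The space `Ω^q(M)` of smooth differential `q`-forms on `M`. -/
def Form (q : ℕ) : Submodule ℝ (RawForm E M q) where
  carrier := {w | IsSmoothForm w}
  add_mem' h h' x₀ := (h x₀).add (h' x₀)
  zero_mem' _ := by exact contDiffOn_const (c := (0 : E [⋀^Fin q]→L[ℝ] ℝ))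
  smul_mem' r _ h x₀ := (contDiffOn_const (c := r)).smul (h x₀)

variable [IsManifold 𝓘(ℝ, E) ∞ M]

/-- The de Rham differential of forms. -/
def formD {q : ℕ} : Form E M q →ₗ[ℝ] Form E M (q + 1) where
  toFun w := ⟨rawExtDeriv w.1, IsSmoothFamily.form
    (IsSmoothFamily.extDeriv
    (IsSmoothForm.const (w := w.1) (P := ℝ) 𝓘(ℝ, ℝ) w.2)) (0 : ℝ)⟩
  map_add' w w' := Subtype.ext (rawExtDeriv_add (w := w.1) (w' := w'.1) w.2 w'.2)
  map_smul' r w := Subtype.ext (rawExtDeriv_smul r w.1)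

/-- The de Rham differential of form-valued maps. -/
def cochainD {p q : ℕ} : Cochain F E G M p q →ₗ[ℝ] Cochain F E G M p (q + 1) where
  toFun c := ⟨fun g => rawExtDeriv (c.1 g), IsSmoothFamily.extDeriv c.2⟩
  map_add' c c' := Subtype.ext (funext fun g =>
    rawExtDeriv_add (IsSmoothFamily.form c.2 g) (IsSmoothFamily.form c'.2 g))
  map_smul' r c := Subtype.ext (funext fun g => rawExtDeriv_smul r (c.1 g))

variable [Group G] [MulAction G M]

/-- The action `g^*` of `G` on forms: the pull-back by the action of `g⁻¹`. With this convention
`g^* h^* = (gh)^*`. -/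
def act {q : ℕ} (g : G) (w : RawForm E M q) : RawForm E M q := pullback (fun x => g⁻¹ • x) w

theorem act_add {q : ℕ} (g : G) (w w' : RawForm E M q) : act g (w + w') = act g w + act g w' := rfl

theorem act_smul {q : ℕ} (g : G) (r : ℝ) (w : RawForm E M q) : act g (r • w) = r • act g w := rfl

theorem act_one {q : ℕ} (w : RawForm E M q) : act (1 : G) w = w := by
  have : (fun x : M => (1 : G)⁻¹ • x) = id := by funext x; simp
  rw [act, this, pullback_id]

variable [LieGroup 𝓘(ℝ, F) ∞ G] [ContMDiffSMul 𝓘(ℝ, F) 𝓘(ℝ, E) ∞ G M]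

variable (F E M) in
theorem contMDiff_smul_inv :
    ContMDiff ((𝓘(ℝ, F)).prod 𝓘(ℝ, E)) 𝓘(ℝ, E) ∞ fun z : G × M => z.1⁻¹ • z.2 :=
  (contMDiff_smul (I := 𝓘(ℝ, F)) (I' := 𝓘(ℝ, E)) (n := ∞) (G := G) (M := M)).comp
    (f := fun z : G × M => (z.1⁻¹, z.2))
    ((contMDiff_fst.inv (I := 𝓘(ℝ, F))).prodMk contMDiff_snd)

theorem contMDiff_inv_smul (F : Type*) [NormedAddCommGroup F] [NormedSpace ℝ F]
    [ChartedSpace F G] [LieGroup 𝓘(ℝ, F) ∞ G] [ContMDiffSMul 𝓘(ℝ, F) 𝓘(ℝ, E) ∞ G M] (g : G) :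
    ContMDiff 𝓘(ℝ, E) 𝓘(ℝ, E) ∞ fun x : M => g⁻¹ • x :=
  (contMDiff_smul_inv F E M).comp (f := fun x : M => (g, x)) (contMDiff_const.prodMk contMDiff_id)

theorem act_act (F : Type*) [NormedAddCommGroup F] [NormedSpace ℝ F]
    [ChartedSpace F G] [LieGroup 𝓘(ℝ, F) ∞ G] [ContMDiffSMul 𝓘(ℝ, F) 𝓘(ℝ, E) ∞ G M] {q : ℕ} (g h : G) (w : RawForm E M q) : act g (act h w) = act (g * h) w := by
  rw [act, act, pullback_pullback w ((contMDiff_inv_smul F h).mdifferentiable (by simp))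
    ((contMDiff_inv_smul F g).mdifferentiable (by simp)), act]
  congr 1
  funext x
  simp [mul_smul]

theorem rawExtDeriv_act (F : Type*) [NormedAddCommGroup F] [NormedSpace ℝ F]
    [ChartedSpace F G] [LieGroup 𝓘(ℝ, F) ∞ G] [ContMDiffSMul 𝓘(ℝ, F) 𝓘(ℝ, E) ∞ G M] {q : ℕ} (g : G) {w : RawForm E M q} (hw : IsSmoothForm w) :
    rawExtDeriv (act g w) = act g (rawExtDeriv w) :=
  rawExtDeriv_pullback hw (contMDiff_inv_smul F g)

variable [FiniteDimensional ℝ E]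

/-- For smooth maps `u : G^p' → G` and `v : G^p' → G^p`, the operator
`c ↦ (g ↦ u(g)^* c(v(g)))` on form-valued smooth maps. -/
def reparam {p p' q : ℕ} (u : (Fin p' → G) → G) (v : (Fin p' → G) → (Fin p → G))
    (hu : ContMDiff (powModel F p') 𝓘(ℝ, F) ∞ u)
    (hv : ContMDiff (powModel F p') (powModel F p) ∞ v) :
    Cochain F E G M p q →ₗ[ℝ] Cochain F E G M p' q where
  toFun c := ⟨fun g => act (u g) (c.1 (v g)), IsSmoothFamily.pullback c.2 hv
    (f := fun g x => (u g)⁻¹ • x) ((contMDiff_smul_inv F E M).comp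
      (f := fun z : (Fin p' → G) × M => (u z.1, z.2))
      ((hu.comp contMDiff_fst).prodMk contMDiff_snd))⟩
  map_add' _ _ := rfl
  map_smul' _ _ := rfl

theorem reparam_apply {p p' q : ℕ} {u : (Fin p' → G) → G} {v : (Fin p' → G) → (Fin p → G)}
    (hu : ContMDiff (powModel F p') 𝓘(ℝ, F) ∞ u)
    (hv : ContMDiff (powModel F p') (powModel F p) ∞ v) (c : Cochain F E G M p q)
    (g : Fin p' → G) : (reparam u v hu hv c).1 g = act (u g) (c.1 (v g)) := rfl

theorem cochainD_reparam {p p' q : ℕ} {u : (Fin p' → G) → G} {v : (Fin p' → G) → (Fin p → G)}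
    (hu : ContMDiff (powModel F p') 𝓘(ℝ, F) ∞ u)
    (hv : ContMDiff (powModel F p') (powModel F p) ∞ v) (c : Cochain F E G M p q) :
    cochainD (reparam u v hu hv c) = reparam u v hu hv (cochainD c) :=
  Subtype.ext (funext fun g => rawExtDeriv_act F (u g) (IsSmoothFamily.form c.2 (v g)))

theorem contMDiff_partialProd {p : ℕ} (i : Fin (p + 1)) :
    ContMDiff (powModel F p) 𝓘(ℝ, F) ∞ fun g : Fin p → G => Fin.partialProd g i := by
  induction i using Fin.induction with
  | zero => simpa using contMDiff_const
  | succ i ih =>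
    simp only [Fin.partialProd_succ]
    exact ih.mul (contMDiff_coord i)

theorem contMDiff_contractNth {p : ℕ} (j : Fin (p + 1)) :
    ContMDiff (powModel F (p + 1)) (powModel F p) ∞
      fun g : Fin (p + 1) → G => Fin.contractNth j (· * ·) g := by
  refine contMDiff_pow_iff.2 fun i => ?_
  unfold Fin.contractNth
  split_ifs
  · exact contMDiff_coord _
  · exact (contMDiff_coord _).mul (contMDiff_coord _)
  · exact contMDiff_coord _

theorem contMDiff_insertOne {p : ℕ} (i : Fin (p + 1)) :
    ContMDiff (powModel F p) (powModel F (p + 1)) ∞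
      fun g : Fin p → G => (i.insertNth 1 g : Fin (p + 1) → G) := by
  refine contMDiff_pow_iff.2 fun j => ?_
  induction j using Fin.succAboveCases i with
  | x => simpa using contMDiff_const
  | p j => simpa using contMDiff_coord j

/-- The coface operators: `(δ₀ c)(g₁, …, g_{p+1}) = g₁^* c(g₂, …, g_{p+1})`,
`(δᵢ c)(g₁, …, g_{p+1}) = c(g₁, …, gᵢ gᵢ₊₁, …, g_{p+1})` for `1 ≤ i ≤ p`, and
`(δ_{p+1} c)(g₁, …, g_{p+1}) = c(g₁, …, g_p)`; note that `Fin.contractNth` with the last index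
drops the last entry. -/
def coface {p q : ℕ} (i : Fin (p + 2)) :
    Cochain F E G M p q →ₗ[ℝ] Cochain F E G M (p + 1) q :=
  Fin.cases (motive := fun _ => Cochain F E G M p q →ₗ[ℝ] Cochain F E G M (p + 1) q)
    (reparam (fun g => g 0) (fun g => Fin.tail g) (contMDiff_coord 0)
      (contMDiff_pow_iff.2 fun i => contMDiff_coord i.succ))
    (fun j => reparam (fun _ => 1) (fun g => Fin.contractNth j (· * ·) g) contMDiff_const
      (contMDiff_contractNth j)) i

/-- The codegeneracy operators: `(σᵢ c)(g₁, …, g_p) = c(g₁, …, gᵢ, 1, gᵢ₊₁, …, g_p)`. -/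
def codegeneracy {p q : ℕ} (i : Fin (p + 1)) :
    Cochain F E G M (p + 1) q →ₗ[ℝ] Cochain F E G M p q :=
  reparam (fun _ => 1) (fun g => i.insertNth 1 g) contMDiff_const (contMDiff_insertOne i)

/-- The tuple `((g₁ ⋯ g_p)⁻¹, g₁, …, g_{p-1})`. -/
def cyclicTuple {p : ℕ} (g : Fin p → G) : Fin p → G := fun i =>
  if (i : ℕ) = 0 then (Fin.partialProd g (Fin.last p))⁻¹
  else g ⟨(i : ℕ) - 1, lt_of_le_of_lt (Nat.sub_le _ _) i.2⟩

theorem contMDiff_cyclicTuple {p : ℕ} :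
    ContMDiff (powModel F p) (powModel F p) ∞ fun g : Fin p → G => cyclicTuple g := by
  refine contMDiff_pow_iff.2 fun i => ?_
  unfold cyclicTuple
  split_ifs
  · exact (contMDiff_partialProd _).inv
  · exact contMDiff_coord _

/-- The cyclic operator:
`(τ c)(g₁, …, g_p) = (g₁ ⋯ g_p)^* c((g₁ ⋯ g_p)⁻¹, g₁, …, g_{p-1})`. -/
def cyclicOp {p q : ℕ} : Cochain F E G M p q →ₗ[ℝ] Cochain F E G M p q :=
  reparam (fun g => Fin.partialProd g (Fin.last p)) cyclicTuple (contMDiff_partialProd _)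
    contMDiff_cyclicTuple

theorem coface_zero_apply {p q : ℕ} (c : Cochain F E G M p q) (g : Fin (p + 1) → G) :
    (coface 0 c).1 g = act (g 0) (c.1 (Fin.tail g)) := rfl

theorem coface_succ_apply {p q : ℕ} (j : Fin (p + 1)) (c : Cochain F E G M p q)
    (g : Fin (p + 1) → G) : (coface j.succ c).1 g = c.1 (Fin.contractNth j (· * ·) g) :=
  act_one (c.1 (Fin.contractNth j (· * ·) g))

theorem codegeneracy_apply {p q : ℕ} (i : Fin (p + 1)) (c : Cochain F E G M (p + 1) q)
    (g : Fin p → G) : (codegeneracy i c).1 g = c.1 (i.insertNth 1 g) :=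
  act_one (c.1 (i.insertNth 1 g))

theorem cyclicOp_apply {p q : ℕ} (c : Cochain F E G M p q) (g : Fin p → G) :
    (cyclicOp c).1 g = act (Fin.partialProd g (Fin.last p)) (c.1 (cyclicTuple g)) := rfl

/-- The operator attached to a map of vertices `θ : {0, …, p} → {0, …, p'}`: if
`Pᵢ = g₁ ⋯ gᵢ`, then `c` is evaluated on the tuple with entries `P_{θ(i-1)}⁻¹ P_{θ(i)}` and
the result is translated by `P_{θ(0)}`. -/
def vertexOp {p p' q : ℕ} (θ : Fin (p + 1) → Fin (p' + 1)) :
    Cochain F E G M p q →ₗ[ℝ] Cochain F E G M p' q :=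
  reparam (fun g => Fin.partialProd g (θ 0))
    (fun g i => (Fin.partialProd g (θ i.castSucc))⁻¹ * Fin.partialProd g (θ i.succ))
    (contMDiff_partialProd _)
    (contMDiff_pow_iff.2 fun _ => (contMDiff_partialProd _).inv.mul (contMDiff_partialProd _))

theorem vertexOp_apply {p p' q : ℕ} (θ : Fin (p + 1) → Fin (p' + 1)) (c : Cochain F E G M p q)
    (g : Fin p' → G) : (vertexOp θ c).1 g = act (Fin.partialProd g (θ 0)) (c.1 fun i =>
      (Fin.partialProd g (θ i.castSucc))⁻¹ * Fin.partialProd g (θ i.succ)) := rfl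

theorem act_congr {p q : ℕ} (c : (Fin p → G) → RawForm E M q) {u u' : G} {v v' : Fin p → G}
    (h : u = u') (h' : v = v') : act u (c v) = act u' (c v') := by
  rw [h, h']

theorem partialProd_vertex {p p' : ℕ} (θ : Fin (p + 1) → Fin (p' + 1)) (g : Fin p' → G)
    (i : Fin (p + 1)) :
    Fin.partialProd (fun i : Fin p => (Fin.partialProd g (θ i.castSucc))⁻¹ *
      Fin.partialProd g (θ i.succ)) i = (Fin.partialProd g (θ 0))⁻¹ * Fin.partialProd g (θ i) := by
  induction i using Fin.induction with
  | zero => simp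
  | succ i ih => rw [Fin.partialProd_succ, ih]; group

theorem vertexOp_vertexOp {p p' p'' q : ℕ} (θ : Fin (p' + 1) → Fin (p'' + 1))
    (η : Fin (p + 1) → Fin (p' + 1)) (c : Cochain F E G M p q) :
    vertexOp θ (vertexOp η c) = vertexOp (θ ∘ η) c := by
  refine Subtype.ext (funext fun g => ?_)
  simp only [vertexOp_apply, partialProd_vertex, act_act F]
  refine act_congr c.1 ?_ (funext fun i => ?_)
  · simp
  · simp [mul_assoc]

theorem vertexOp_id {p q : ℕ} (c : Cochain F E G M p q) : vertexOp id c = c := by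
  refine Subtype.ext (funext fun g => ?_)
  simp only [vertexOp_apply, id, Fin.partialProd_zero, act_one,
    Fin.partialProd_right_inv]

theorem coface_eq {p q : ℕ} (i : Fin (p + 2)) :
    (coface i : Cochain F E G M p q →ₗ[ℝ] _) = vertexOp i.succAbove := by
  refine LinearMap.ext fun c => Subtype.ext (funext fun g => ?_)
  induction i using Fin.cases with
  | zero =>
    refine act_congr c.1 ?_ (funext fun i => ?_)
    · dsimp only
      rw [Fin.zero_succAbove, Fin.partialProd_succ]; simp
    · dsimp only
      rw [Fin.zero_succAbove, Fin.zero_succAbove, ← Fin.castSucc_succ, Fin.partialProd_right_inv]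
      rfl
  | succ j =>
    refine act_congr c.1 ?_ (funext fun i => ?_)
    · simp
    · change Fin.contractNth j (· * ·) g i = _
      dsimp only
      rw [Fin.succ_succAbove_succ, Fin.inv_partialProd_mul_eq_contractNth]

theorem succAbove_val {n : ℕ} (i : Fin (n + 1)) (k : Fin n) :
    ((i.succAbove k : Fin (n + 1)) : ℕ) = if (k : ℕ) < i then (k : ℕ) else k + 1 := by
  simp only [Fin.succAbove, Fin.lt_def, Fin.val_castSucc]
  split_ifs <;> rfl

theorem predAbove_val {n : ℕ} (i : Fin n) (k : Fin (n + 1)) :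
    ((i.predAbove k : Fin n) : ℕ) = if (i : ℕ) < k then (k : ℕ) - 1 else k := by
  simp only [Fin.predAbove, Fin.lt_def, Fin.val_castSucc]
  split_ifs <;> rfl

theorem partialProd_insertOne {p : ℕ} (i : Fin (p + 1)) (g : Fin p → G) (j : Fin (p + 2)) :
    Fin.partialProd (i.insertNth 1 g : Fin (p + 1) → G) j =
      Fin.partialProd g (i.predAbove j) := by
  induction j using Fin.induction with
  | zero => simp
  | succ j ih =>
    rw [Fin.partialProd_succ, ih]
    induction j using Fin.succAboveCases i with
    | x => simp
    | p j =>
      have h1 : i.predAbove (i.succAbove j).castSucc = j.castSucc := by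
        ext
        simp only [predAbove_val, succAbove_val, Fin.val_castSucc, Fin.val_succ]
        split_ifs <;> omega
      have h2 : i.predAbove (i.succAbove j).succ = j.succ := by
        ext
        simp only [predAbove_val, succAbove_val, Fin.val_castSucc, Fin.val_succ]
        split_ifs <;> omega
      rw [Fin.insertNth_apply_succAbove, h1, h2, Fin.partialProd_succ]

theorem codegeneracy_eq {p q : ℕ} (i : Fin (p + 1)) :
    (codegeneracy i : Cochain F E G M (p + 1) q →ₗ[ℝ] _) = vertexOp i.predAbove := by
  refine LinearMap.ext fun c => Subtype.ext (funext fun g => ?_)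
  refine act_congr c.1 ?_ (funext fun j => ?_)
  · simp
  · dsimp only
    rw [← partialProd_insertOne, ← partialProd_insertOne, Fin.partialProd_right_inv]

/-- The cyclic rotation of the vertices: `0 ↦ p`, `i + 1 ↦ i`. -/
def rot {p : ℕ} (i : Fin (p + 1)) : Fin (p + 1) :=
  if (i : ℕ) = 0 then Fin.last p else ⟨(i : ℕ) - 1, lt_of_le_of_lt (Nat.sub_le _ _) i.2⟩

theorem rot_val {p : ℕ} (i : Fin (p + 1)) :
    ((rot i : Fin (p + 1)) : ℕ) = if (i : ℕ) = 0 then p else (i : ℕ) - 1 := by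
  unfold rot
  split_ifs <;> rfl

theorem cyclicOp_eq {p q : ℕ} :
    (cyclicOp : Cochain F E G M p q →ₗ[ℝ] _) = vertexOp rot := by
  refine LinearMap.ext fun c => Subtype.ext (funext fun g => ?_)
  refine act_congr c.1 (by simp [rot]) (funext fun i => ?_)
  dsimp only [cyclicTuple]
  split_ifs with h
  · have h1 : rot i.castSucc = Fin.last p := by simp [rot, h]
    have h2 : rot i.succ = 0 := by ext; simp [rot, h]
    rw [h1, h2]; simp
  · have h1 : rot i.castSucc = Fin.castSucc ⟨(i : ℕ) - 1, by omega⟩ := by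
      ext; simp [rot, h]
    have h2 : rot i.succ = Fin.succ ⟨(i : ℕ) - 1, by omega⟩ := by
      ext; simp [rot]; omega
    rw [h1, h2, Fin.partialProd_right_inv]

theorem rot_iterate {p : ℕ} (m : ℕ) (hm : m ≤ p + 1) (i : Fin (p + 1)) :
    ((rot^[m] i : Fin (p + 1)) : ℕ) = if m ≤ i then (i : ℕ) - m else i + (p + 1) - m := by
  induction m with
  | zero => simp
  | succ m ih =>
    have h := ih (by omega)
    have hi := i.2
    rw [Function.iterate_succ_apply', rot]
    split_ifs at * <;> simp_all <;> omega


variable (F E G M) in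
/-- The cyclic module of the Hopf algebroid of a Lie group `G` acting on a manifold `M`. Its part
`A ⊗_B ⋯ ⊗_B A` (`p` factors, completed tensor products, `B = Ω^*(M)`, `A = C^∞(G, B)`) is the
space of smooth maps `G^p → Ω^*(M)`; the expressions of the operators through the structure maps
of the Hopf algebroid are proved below, see `tensor`. -/
def hopfCocyclicModule : DGCocyclicModule where
  X p q := Cochain F E G M p q
  d := cochainD
  δ := coface
  σ := codegeneracy
  τ := cyclicOp
  d_d c := Subtype.ext (funext fun g => rawExtDeriv_rawExtDeriv (IsSmoothFamily.form c.2 g))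
  d_δ i c := by rw [coface_eq, coface_eq]; exact cochainD_reparam _ _ c
  d_σ i c := cochainD_reparam _ _ c
  d_τ c := cochainD_reparam _ _ c
  δ_δ {p q i j} h c := by
    simp only [coface_eq, vertexOp_vertexOp]
    congr 2
    ext k
    have hk := k.2
    simp only [Function.comp_apply, id, succAbove_val, predAbove_val, rot_val, Fin.val_succ,
      Fin.val_castSucc, Fin.val_last, Fin.val_zero, Fin.lt_def, Fin.le_def] at h ⊢
    split_ifs <;> omega
  σ_δ_of_le {p q i j} h c := by
    simp only [coface_eq, codegeneracy_eq, vertexOp_vertexOp]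
    congr 2
    ext k
    have hk := k.2
    simp only [Function.comp_apply, id, succAbove_val, predAbove_val, rot_val, Fin.val_succ,
      Fin.val_castSucc, Fin.val_last, Fin.val_zero, Fin.lt_def, Fin.le_def] at h ⊢
    split_ifs <;> omega
  σ_δ_self {p q} i c := by
    simp only [coface_eq, codegeneracy_eq, vertexOp_vertexOp]
    refine Eq.trans ?_ (vertexOp_id c)
    congr 2
    ext k
    have hk := k.2
    simp only [Function.comp_apply, id, succAbove_val, predAbove_val, rot_val, Fin.val_succ,
      Fin.val_castSucc, Fin.val_last, Fin.val_zero, Fin.lt_def, Fin.le_def]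
    split_ifs <;> omega
  σ_δ_succ {p q} i c := by
    simp only [coface_eq, codegeneracy_eq, vertexOp_vertexOp]
    refine Eq.trans ?_ (vertexOp_id c)
    congr 2
    ext k
    have hk := k.2
    simp only [Function.comp_apply, id, succAbove_val, predAbove_val, rot_val, Fin.val_succ,
      Fin.val_castSucc, Fin.val_last, Fin.val_zero, Fin.lt_def, Fin.le_def]
    split_ifs <;> omega
  σ_δ_of_gt {p q i j} h c := by
    simp only [coface_eq, codegeneracy_eq, vertexOp_vertexOp]
    congr 2
    ext k
    have hk := k.2
    simp only [Function.comp_apply, id, succAbove_val, predAbove_val, rot_val, Fin.val_succ,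
      Fin.val_castSucc, Fin.val_last, Fin.val_zero, Fin.lt_def, Fin.le_def] at h ⊢
    split_ifs <;> omega
  σ_σ {p q i j} h c := by
    simp only [codegeneracy_eq, vertexOp_vertexOp]
    congr 2
    ext k
    have hk := k.2
    simp only [Function.comp_apply, id, succAbove_val, predAbove_val, rot_val, Fin.val_succ,
      Fin.val_castSucc, Fin.val_last, Fin.val_zero, Fin.lt_def, Fin.le_def] at h ⊢
    split_ifs <;> omega
  τ_δ_zero {p q} c := by
    simp only [coface_eq, cyclicOp_eq, vertexOp_vertexOp]
    congr 2
    ext k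
    have hk := k.2
    simp only [Function.comp_apply, id, succAbove_val, predAbove_val, rot_val, Fin.val_succ,
      Fin.val_castSucc, Fin.val_last, Fin.val_zero, Fin.lt_def, Fin.le_def]
    grind
  τ_δ_succ {p q} i c := by
    simp only [coface_eq, cyclicOp_eq, vertexOp_vertexOp]
    congr 2
    ext k
    have hk := k.2
    simp only [Function.comp_apply, id, succAbove_val, predAbove_val, rot_val, Fin.val_succ,
      Fin.val_castSucc, Fin.val_last, Fin.val_zero, Fin.lt_def, Fin.le_def]
    grind
  τ_σ_zero {p q} c := by
    simp only [codegeneracy_eq, cyclicOp_eq, vertexOp_vertexOp]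
    congr 2
    ext k
    have hk := k.2
    simp only [Function.comp_apply, id, succAbove_val, predAbove_val, rot_val, Fin.val_succ,
      Fin.val_castSucc, Fin.val_last, Fin.val_zero, Fin.lt_def, Fin.le_def]
    grind
  τ_σ_succ {p q} i c := by
    simp only [codegeneracy_eq, cyclicOp_eq, vertexOp_vertexOp]
    congr 2
    ext k
    have hk := k.2
    simp only [Function.comp_apply, id, succAbove_val, predAbove_val, rot_val, Fin.val_succ,
      Fin.val_castSucc, Fin.val_last, Fin.val_zero, Fin.lt_def, Fin.le_def]
    grind
  τ_pow {p q} c := by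
    have h : ∀ m : ℕ, ((cyclicOp : Cochain F E G M p q →ₗ[ℝ] _) ^ m) c =
        vertexOp (rot^[m]) c := by
      intro m
      induction m with
      | zero => exact (vertexOp_id c).symm
      | succ m ih =>
        rw [pow_succ', Module.End.mul_apply, ih, cyclicOp_eq, vertexOp_vertexOp,
          Function.iterate_succ']
    rw [h]
    refine Eq.trans ?_ (vertexOp_id c)
    congr 2
    ext k
    rw [rot_iterate _ le_rfl]
    have := k.2
    simp only [id]
    split_ifs <;> omega

end Group

/-! ### The Hopf algebroid of a Lie group acting on a manifold -/

section HopfAlgebroid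

variable {F : Type*} [NormedAddCommGroup F] [NormedSpace ℝ F]
  {E : Type*} [NormedAddCommGroup E] [NormedSpace ℝ E] [FiniteDimensional ℝ E]
  {G : Type*} [TopologicalSpace G] [ChartedSpace F G] [Group G] [LieGroup 𝓘(ℝ, F) ∞ G]
  {M : Type*} [TopologicalSpace M] [ChartedSpace E M] [IsManifold 𝓘(ℝ, E) ∞ M]
  [MulAction G M] [ContMDiffSMul 𝓘(ℝ, F) 𝓘(ℝ, E) ∞ G M] {p q m n i j k : ℕ}

/-- The constant maps `G^p → Ω^q(M)`. -/
def constCochain (p : ℕ) : Form E M q →ₗ[ℝ] Cochain F E G M p q where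
  toFun w := ⟨fun _ => w.1, IsSmoothForm.const (powModel F p) w.2⟩
  map_add' _ _ := rfl
  map_smul' _ _ := rfl

variable (E M) in
/-- The function `1`, the unit of `B = Ω^*(M)`. -/
def formOne : Form E M 0 :=
  ⟨fun x => unitForm (TangentSpace 𝓘(ℝ, E) x), fun _ => contDiffOn_const (c := unitForm E)⟩

/-- The pointwise product of form-valued maps. On `G^1` this is the product of the algebra `A` of
`B`-valued functions on `G`. -/
def cochainMul (h : i + j = q) (φ : Cochain F E G M p i) (ψ : Cochain F E G M p j) :
    Cochain F E G M p q :=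
  ⟨fun g x => wedge h (φ.1 g x) (ψ.1 g x), IsSmoothFamily.wedge h φ.2 ψ.2⟩

/-- The source map `α : B → A`, `α(b)(g) = b`. -/
def source : Form E M q →ₗ[ℝ] Cochain F E G M 1 q := constCochain 1

/-- The target map `β : B → A`, `β(b)(g) = g^* b`. -/
def target : Form E M q →ₗ[ℝ] Cochain F E G M 1 q :=
  reparam (fun g => g 0) id (contMDiff_coord 0) contMDiff_id ∘ₗ source

/-- The comultiplication `Δ(φ)(g₁, g₂) = φ(g₁ g₂)`. -/
def comul : Cochain F E G M 1 q →ₗ[ℝ] Cochain F E G M 2 q :=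
  reparam (fun _ => 1) (fun g _ => g 0 * g 1) contMDiff_const
    (contMDiff_pow_iff.2 fun _ => (contMDiff_coord 0).mul (contMDiff_coord 1))

/-- The iterated comultiplication `φ ↦ ((g₁, …, g_p) ↦ φ(g₁ ⋯ g_p))`. -/
def iteratedComul (p : ℕ) : Cochain F E G M 1 q →ₗ[ℝ] Cochain F E G M p q :=
  reparam (fun _ => 1) (fun g _ => Fin.partialProd g (Fin.last p)) contMDiff_const
    (contMDiff_pow_iff.2 fun _ => contMDiff_partialProd _)

/-- The counit `ε(φ) = φ(1)`. -/
def counit : Cochain F E G M 1 q →ₗ[ℝ] Form E M q where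
  toFun φ := ⟨φ.1 fun _ => 1, φ.2.form _⟩
  map_add' _ _ := rfl
  map_smul' _ _ := rfl

/-- The antipode `S(φ)(g) = g^* φ(g⁻¹)`. -/
def antipode : Cochain F E G M 1 q →ₗ[ℝ] Cochain F E G M 1 q :=
  reparam (fun g => g 0) (fun g _ => (g 0)⁻¹) (contMDiff_coord 0)
    (contMDiff_pow_iff.2 fun _ => (contMDiff_coord 0).inv)

/-- The first `m` entries of a tuple of length `p = m + n`. -/
def leftPart (h : m + n = p) (g : Fin p → G) : Fin m → G := fun l => g ⟨l, by omega⟩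

/-- The last `n` entries of a tuple of length `p = m + n`. -/
def rightPart (h : m + n = p) (g : Fin p → G) : Fin n → G := fun l => g ⟨m + l, by omega⟩

/-- The (completed) tensor product over `B` of `A ⊗_B ⋯ ⊗_B A` (`m` factors) and
`A ⊗_B ⋯ ⊗_B A` (`n` factors), realized by smooth maps on powers of `G`:
`(φ ⊗ ψ)(g, h) = φ(g) ∧ (g₁ ⋯ g_m)^* ψ(h)`. -/
def tensor (hp : m + n = p) (hq : i + j = q) (φ : Cochain F E G M m i) (ψ : Cochain F E G M n j) :
    Cochain F E G M p q :=
  cochainMul hq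
    (reparam (fun _ => 1) (leftPart hp) contMDiff_const
      (contMDiff_pow_iff.2 fun _ => contMDiff_coord _) φ)
    (reparam (fun g => Fin.partialProd (leftPart hp g) (Fin.last m)) (rightPart hp)
      ((contMDiff_partialProd _).comp (contMDiff_pow_iff.2 fun _ => contMDiff_coord _))
      (contMDiff_pow_iff.2 fun _ => contMDiff_coord _) ψ)

theorem tensor_apply (hp : m + n = p) (hq : i + j = q) (φ : Cochain F E G M m i)
    (ψ : Cochain F E G M n j) (g : Fin p → G) : (tensor hp hq φ ψ).1 g = fun x =>
      wedge hq (φ.1 (leftPart hp g) x) (act (Fin.partialProd (leftPart hp g) (Fin.last m))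
        (ψ.1 (rightPart hp g)) x) := by
  funext x
  exact congrArg (fun w : RawForm E M i => wedge hq (w x) _) (act_one (φ.1 (leftPart hp g)))

theorem act_wedge (h : i + j = q) (g : G) (w : RawForm E M i) (w' : RawForm E M j) :
    (act g (fun x => wedge h (w x) (w' x)) : RawForm E M q) =
      fun x => wedge h (act g w x) (act g w' x) := by
  funext x
  exact wedge_comp h _ _ _

theorem act_formOne (g : G) : act g (formOne E M).1 = (formOne E M).1 := by
  funext x
  rfl

theorem coface_zero_eq_tensor (c : Cochain F E G M p q) :
    coface 0 c = tensor (add_comm 1 p) (zero_add q) (source (formOne E M)) c := by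
  refine Subtype.ext (funext fun g => ?_)
  rw [tensor_apply, coface_zero_apply]
  funext x
  refine Eq.trans ?_ (wedge_unit_left _).symm
  refine congrFun (act_congr c.1 ?_ (funext fun l => ?_)) x
  · have h : Fin.last 1 = Fin.succ 0 := rfl
    rw [h, Fin.partialProd_succ]
    simp [leftPart]
  · exact congrArg g (Fin.ext (by simp; omega))

theorem coface_last_eq_tensor (c : Cochain F E G M p q) :
    coface (Fin.last (p + 1)) c = tensor rfl (add_zero q) c (source (formOne E M)) := by
  refine Subtype.ext (funext fun g => ?_)
  rw [tensor_apply, ← Fin.succ_last, coface_succ_apply]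
  funext x
  refine Eq.trans ?_ ((congrArg (wedge _ _) (congrFun (act_formOne _) x)).trans
    (wedge_unit_right _)).symm
  refine congrFun (congrArg c.1 (funext fun l => ?_)) x
  rw [Fin.contractNth_apply_of_lt _ _ _ _ (by simp)]
  rfl

theorem coface_middle_eq_tensor {r s : ℕ} (a : Cochain F E G M m i) (x : Cochain F E G M 1 j)
    (c : Cochain F E G M n k) (h1 : 1 + n = r) (h2 : m + r = p) (h3 : j + k = s)
    (h4 : i + s = q) (l : Fin (p + 2)) (hl : (l : ℕ) = m + 1) :
    coface l (tensor h2 h4 a (tensor h1 h3 x c)) =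
      tensor (n := r + 1) (by omega) h4 a (tensor (m := 2) (by omega) h3 (comul x) c) := by
  obtain ⟨l, rfl⟩ := Fin.eq_succ_of_ne_zero (i := l) (by rintro rfl; simp at hl)
  simp only [Fin.val_succ, Nat.add_right_cancel_iff] at hl
  refine Subtype.ext (funext fun g => ?_)
  have h5 : m + (r + 1) = p + 1 := by omega
  have h6 : 2 + n = r + 1 := by omega
  have e1 : leftPart h2 (Fin.contractNth l (· * ·) g) = leftPart h5 g := by
    funext t
    exact Fin.contractNth_apply_of_lt _ _ _ _ (by have := t.2; simp; omega)
  have e2 : leftPart h1 (rightPart h2 (Fin.contractNth l (· * ·) g)) =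
      fun _ => leftPart h6 (rightPart h5 g) 0 * leftPart h6 (rightPart h5 g) 1 := by
    funext t
    refine (Fin.contractNth_apply_of_eq _ _ _ _ (by simp; omega)).trans ?_
    exact congrArg₂ (· * ·) (congrArg g (Fin.ext (by simp))) (congrArg g (Fin.ext (by simp)))
  have e3 : rightPart h1 (rightPart h2 (Fin.contractNth l (· * ·) g)) =
      rightPart h6 (rightPart h5 g) := by
    funext t
    refine (Fin.contractNth_apply_of_gt _ _ _ _ (by simp; omega)).trans ?_
    exact congrArg g (Fin.ext (by simp; omega))
  have e4 : Fin.partialProd (fun _ : Fin 1 => leftPart h6 (rightPart h5 g) 0 *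
      leftPart h6 (rightPart h5 g) 1) (Fin.last 1) =
      Fin.partialProd (leftPart h6 (rightPart h5 g)) (Fin.last 2) := by
    have t1 : Fin.last 1 = Fin.succ 0 := rfl
    have t2 : Fin.last 2 = Fin.succ (Fin.succ 0) := rfl
    rw [t1, t2, Fin.partialProd_succ, Fin.partialProd_succ, Fin.castSucc_succ,
      Fin.partialProd_succ]
    simp
  have e5 : (comul x).1 (leftPart h6 (rightPart h5 g)) =
      x.1 (fun _ => leftPart h6 (rightPart h5 g) 0 * leftPart h6 (rightPart h5 g) 1) :=
    act_one (x.1 _)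
  rw [coface_succ_apply, tensor_apply, tensor_apply, tensor_apply, tensor_apply, e1, e2, e3, e4,
    e5]

theorem codegeneracy_eq_tensor {r s : ℕ} (a : Cochain F E G M m i) (x : Cochain F E G M 1 j)
    (c : Cochain F E G M n k) (h1 : 1 + n = r) (h2 : m + r = p + 1) (h3 : j + k = s)
    (h4 : i + s = q) (l : Fin (p + 1)) (hl : (l : ℕ) = m) :
    codegeneracy l (tensor h2 h4 a (tensor h1 h3 x c)) =
      tensor (by omega) h4 a (tensor (zero_add n) h3 (constCochain 0 (counit x)) c) := by
  refine Subtype.ext (funext fun g => ?_)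
  have h5 : m + n = p := by omega
  have e1 : leftPart h2 (l.insertNth 1 g : Fin (p + 1) → G) = leftPart h5 g := by
    funext t
    have ht : (⟨t, by omega⟩ : Fin (p + 1)) = l.succAbove ⟨t, by omega⟩ := by
      ext
      rw [succAbove_val]
      have := t.2
      simp; omega
    exact Eq.trans (congrArg (l.insertNth 1 g : Fin (p + 1) → G) ht) (Fin.insertNth_apply_succAbove _ _ _ _)
  have e2 : leftPart h1 (rightPart h2 (l.insertNth 1 g : Fin (p + 1) → G)) = fun _ => 1 := by
    funext t
    have ht : (⟨m + t, by omega⟩ : Fin (p + 1)) = l := by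
      ext; simp [hl]
    exact Eq.trans (congrArg (l.insertNth 1 g : Fin (p + 1) → G) ht) (Fin.insertNth_apply_same _ _ _)
  have e3 : rightPart h1 (rightPart h2 (l.insertNth 1 g : Fin (p + 1) → G)) =
      rightPart (zero_add n) (rightPart h5 g) := by
    funext t
    have ht : (⟨m + (1 + t), by omega⟩ : Fin (p + 1)) = l.succAbove ⟨m + (0 + t), by omega⟩ := by
      ext
      rw [succAbove_val, if_neg (by simp; omega)]
      simp; omega
    exact Eq.trans (congrArg (l.insertNth 1 g : Fin (p + 1) → G) ht) (Fin.insertNth_apply_succAbove _ _ _ _)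
  have e4 : Fin.partialProd (fun _ : Fin 1 => (1 : G)) (Fin.last 1) =
      Fin.partialProd (leftPart (zero_add n) (rightPart h5 g)) (Fin.last 0) := by
    have t1 : Fin.last 1 = Fin.succ 0 := rfl
    rw [t1, Fin.partialProd_succ]
    simp
  rw [codegeneracy_apply, tensor_apply, tensor_apply, tensor_apply, tensor_apply, e1, e2, e3, e4]
  rfl

theorem cyclicOp_eq_tensor (x : Cochain F E G M 1 i) (c : Cochain F E G M n j)
    (h1 : 1 + n = p) (h2 : i + j = q) :
    cyclicOp (tensor h1 h2 x c) = cochainMul h2 (iteratedComul p (antipode x))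
      (tensor (by omega) (add_zero j) c (source (formOne E M))) := by
  have h3 : n + 1 = p := by omega
  refine Subtype.ext (funext fun g => ?_)
  have e1 : leftPart h1 (cyclicTuple g) = fun _ => (Fin.partialProd g (Fin.last p))⁻¹ := by
    funext t
    exact if_pos (by simp)
  have e2 : rightPart h1 (cyclicTuple g) = leftPart h3 g := by
    funext t
    exact (if_neg (by simp)).trans (congrArg g (Fin.ext (by simp)))
  have e3 : Fin.partialProd (fun _ : Fin 1 => (Fin.partialProd g (Fin.last p))⁻¹) (Fin.last 1) =
      (Fin.partialProd g (Fin.last p))⁻¹ := by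
    have t1 : Fin.last 1 = Fin.succ 0 := rfl
    rw [t1, Fin.partialProd_succ]
    simp
  have e4 : (iteratedComul p (antipode x)).1 g = act (Fin.partialProd g (Fin.last p))
      (x.1 fun _ => (Fin.partialProd g (Fin.last p))⁻¹) := act_one _
  have e5 : (tensor h3 (add_zero j) c (source (formOne E M))).1 g = c.1 (leftPart h3 g) := by
    rw [tensor_apply]
    funext y
    exact (congrArg (wedge _ _) (congrFun (act_formOne _) y)).trans (wedge_unit_right _)
  rw [cyclicOp_apply, tensor_apply, e1, e2, e3, act_wedge, act_act F, mul_inv_cancel, act_one]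
  change _ = fun y => wedge h2 ((iteratedComul p (antipode x)).1 g y)
    ((tensor h3 (add_zero j) c (source (formOne E M))).1 g y)
  rw [e4, e5]

end HopfAlgebroid

/-! ### Cohomology -/

/-- The degree `n` cohomology `{x ∈ Fₙ | D x = 0} / D(Fₙ₋₁)` of a space with a differential `D`
and a family of subspaces `Fₙ` with `D(Fₙ) ⊆ Fₙ₊₁`. -/
abbrev gradedCohomology {T : Type*} [AddCommGroup T] [Module ℝ T] (D : T →ₗ[ℝ] T)
    (F : ℤ → Submodule ℝ T) (n : ℤ) : Type _ :=
  (F n ⊓ LinearMap.ker D : Submodule ℝ T) ⧸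
    ((F (n - 1)).map D).submoduleOf (F n ⊓ LinearMap.ker D)

/-- The map induced in cohomology by a map commuting with the differentials. -/
def gradedCohomologyMap {T T' : Type*} [AddCommGroup T] [Module ℝ T] [AddCommGroup T']
    [Module ℝ T'] {D : T →ₗ[ℝ] T} {D' : T' →ₗ[ℝ] T'} {F : ℤ → Submodule ℝ T}
    {F' : ℤ → Submodule ℝ T'} (f : T →ₗ[ℝ] T') (hf : ∀ x, D' (f x) = f (D x)) {m n : ℤ}
    (h : ∀ x ∈ F m, f x ∈ F' n) (h' : ∀ x ∈ F (m - 1), f x ∈ F' (n - 1)) :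
    gradedCohomology D F m →ₗ[ℝ] gradedCohomology D' F' n :=
  Submodule.mapQ _ _
    (f.restrict (p := F m ⊓ LinearMap.ker D) (q := F' n ⊓ LinearMap.ker D') fun x hx =>
      ⟨h x hx.1, (hf x).trans ((congrArg f (LinearMap.mem_ker.1 hx.2)).trans (map_zero f))⟩)
    (by
      rintro ⟨x, hx⟩ ⟨y, hy, hyx⟩
      exact ⟨f y, h' y hy, (hf y).trans (congrArg f hyx)⟩)

namespace DGCocyclicModule

variable (C : DGCocyclicModule.{u})

/-- The cochains of degree `n` of the total complex of the `(b, B)`-bicomplex: finite sums of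
elements of the `C.X p q` with `n - (p + q)` nonnegative and even. -/
def cyclicCochains (n : ℤ) : Submodule ℝ C.Total where
  carrier := {x | ∀ p q : ℕ, x (p, q) ≠ 0 → ∃ k : ℕ, (p : ℤ) + q + 2 * k = n}
  add_mem' {x y} hx hy p q h := by
    by_cases hxp : x (p, q) = 0
    · refine hy p q fun h' => h ?_
      rw [DirectSum.add_apply, hxp, h', add_zero]
    · exact hx p q hxp
  zero_mem' _ _ h := (h rfl).elim
  smul_mem' r x hx p q h := hx p q fun h' => h (by rw [DirectSum.smul_apply, h', smul_zero])

/-- The cochains of degree `n` of the total complex of the periodic `(b, B)`-bicomplex: finite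
sums of elements of the `C.X p q` with `n - (p + q)` even. -/
def periodicCochains (n : ℤ) : Submodule ℝ C.Total where
  carrier := {x | ∀ p q : ℕ, x (p, q) ≠ 0 → ∃ k : ℤ, (p : ℤ) + q + 2 * k = n}
  add_mem' {x y} hx hy p q h := by
    by_cases hxp : x (p, q) = 0
    · refine hy p q fun h' => h ?_
      rw [DirectSum.add_apply, hxp, h', add_zero]
    · exact hx p q hxp
  zero_mem' _ _ h := (h rfl).elim
  smul_mem' r x hx p q h := hx p q fun h' => h (by rw [DirectSum.smul_apply, h', smul_zero])

theorem incl_mem_cyclicCochains {p q : ℕ} {n : ℤ} (h : ∃ k : ℕ, (p : ℤ) + q + 2 * k = n)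
    (x : C.X p q) : C.incl p q x ∈ C.cyclicCochains n := by
  intro p' q' h'
  by_cases he : (p, q) = (p', q')
  · obtain ⟨rfl, rfl⟩ := Prod.mk.inj he
    exact h
  · exact (h' (DirectSum.of_eq_of_ne _ _ _ (Ne.symm he))).elim

theorem incl_mem_periodicCochains {p q : ℕ} {n : ℤ} (h : ∃ k : ℤ, (p : ℤ) + q + 2 * k = n)
    (x : C.X p q) : C.incl p q x ∈ C.periodicCochains n := by
  intro p' q' h'
  by_cases he : (p, q) = (p', q')
  · obtain ⟨rfl, rfl⟩ := Prod.mk.inj he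
    exact h
  · exact (h' (DirectSum.of_eq_of_ne _ _ _ (Ne.symm he))).elim

/-- A subspace contains `x` mapped by `f` as soon as it contains the images of the
homogeneous components of `x`. -/
theorem map_mem_of_components {C : DGCocyclicModule.{u}} {f : C.Total →ₗ[ℝ] C.Total}
    {S : Submodule ℝ C.Total}
    {x : C.Total} (h : ∀ p q : ℕ, x (p, q) ≠ 0 → f (C.incl p q (x (p, q))) ∈ S) : f x ∈ S := by
  classical
  rw [← DirectSum.sum_support_of x, map_sum]
  refine S.sum_mem fun pq hpq => ?_
  exact h pq.1 pq.2 (DFinsupp.mem_support_iff.1 hpq)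

/-- The total differential has degree one. -/
theorem totalD_mem_cyclicCochains {n : ℤ} {x : C.Total} (hx : x ∈ C.cyclicCochains n) :
    C.totalD x ∈ C.cyclicCochains (n + 1) := by
  refine map_mem_of_components fun p q h => ?_
  obtain ⟨k, hk⟩ := hx p q h
  rcases p with _ | p
  · rw [totalD_incl_zero]
    exact add_mem (C.incl_mem_cyclicCochains ⟨k, by push_cast at *; omega⟩ _)
      (C.incl_mem_cyclicCochains ⟨k, by push_cast at *; omega⟩ _)
  · rw [totalD_incl_succ]
    exact add_mem (add_mem (C.incl_mem_cyclicCochains ⟨k, by push_cast at *; omega⟩ _)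
      (Submodule.smul_mem _ _ (C.incl_mem_cyclicCochains ⟨k, by push_cast at *; omega⟩ _)))
      (C.incl_mem_cyclicCochains ⟨k + 1, by push_cast at *; omega⟩ _)

theorem totalD_mem_periodicCochains {n : ℤ} {x : C.Total} (hx : x ∈ C.periodicCochains n) :
    C.totalD x ∈ C.periodicCochains (n + 1) := by
  refine map_mem_of_components fun p q h => ?_
  obtain ⟨k, hk⟩ := hx p q h
  rcases p with _ | p
  · rw [totalD_incl_zero]
    exact add_mem (C.incl_mem_periodicCochains ⟨k, by push_cast at *; omega⟩ _)
      (C.incl_mem_periodicCochains ⟨k, by push_cast at *; omega⟩ _)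
  · rw [totalD_incl_succ]
    exact add_mem (add_mem (C.incl_mem_periodicCochains ⟨k, by push_cast at *; omega⟩ _)
      (Submodule.smul_mem _ _ (C.incl_mem_periodicCochains ⟨k, by push_cast at *; omega⟩ _)))
      (C.incl_mem_periodicCochains ⟨k + 1, by push_cast at *; omega⟩ _)

/-- The cyclic cohomology `HCⁿ`. -/
abbrev HC (n : ℤ) : Type u := gradedCohomology C.totalD C.cyclicCochains n

/-- The periodic cyclic cohomology `HPⁿ`. -/
abbrev HP (n : ℤ) : Type u := gradedCohomology C.totalD C.periodicCochains n

end DGCocyclicModule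

/-! ### Invariant forms -/

section Invariant

variable (E : Type*) [NormedAddCommGroup E] [NormedSpace ℝ E]
  (G : Type*) [Group G]
  (M : Type*) [TopologicalSpace M] [ChartedSpace E M] [MulAction G M]

/-- The subspace of `G`-invariant smooth forms. -/
def invariantForms (q : ℕ) : Submodule ℝ (RawForm E M q) where
  carrier := {w | w ∈ Form E M q ∧ ∀ g : G, act g w = w}
  add_mem' h h' := ⟨add_mem h.1 h'.1, fun g => congrArg₂ (· + ·) (h.2 g) (h'.2 g)⟩
  zero_mem' := ⟨zero_mem _, fun _ => rfl⟩
  smul_mem' r _ h := ⟨Submodule.smul_mem _ r h.1, fun g => congrArg (r • ·) (h.2 g)⟩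

/-- The space `Ω^q(M)^G`. -/
def InvForm (q : ℕ) : Type _ := invariantForms E G M q

instance invFormAddCommGroup (q : ℕ) : AddCommGroup (InvForm E G M q) :=
  inferInstanceAs (AddCommGroup (invariantForms E G M q))

instance invFormModule (q : ℕ) : Module ℝ (InvForm E G M q) :=
  inferInstanceAs (Module ℝ (invariantForms E G M q))

/-- The space `Ω^*(M)^G`. -/
abbrev InvForms : Type _ := ⨁ q : ℕ, InvForm E G M q

/-- The part of degree `m` of `Ω^*(M)^G`; it vanishes for negative `m`. -/
def invFormsOfDegree (m : ℤ) : Submodule ℝ (InvForms E G M) where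
  carrier := {x | ∀ q : ℕ, x q ≠ 0 → (q : ℤ) = m}
  add_mem' {x y} hx hy q h := by
    by_cases hxq : x q = 0
    · refine hy q fun h' => h ?_
      rw [DirectSum.add_apply, hxq, h', add_zero]
    · exact hx q hxq
  zero_mem' _ h := (h rfl).elim
  smul_mem' r x hx q h := hx q fun h' => h (by rw [DirectSum.smul_apply, h', smul_zero])

variable (F : Type*) [NormedAddCommGroup F] [NormedSpace ℝ F]
  [TopologicalSpace G] [ChartedSpace F G] [LieGroup 𝓘(ℝ, F) ∞ G]
  [IsManifold 𝓘(ℝ, E) ∞ M] [ContMDiffSMul 𝓘(ℝ, F) 𝓘(ℝ, E) ∞ G M]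

/-- The de Rham differential of `Ω^*(M)^G` on forms of degree `q`. -/
def invDComponent (q : ℕ) : InvForm E G M q →ₗ[ℝ] InvForm E G M (q + 1) where
  toFun w := ⟨rawExtDeriv w.1, (formD (⟨w.1, w.2.1⟩ : Form E M q)).2, fun g =>
    (rawExtDeriv_act F g (w := w.1) w.2.1).symm.trans (congrArg rawExtDeriv (w.2.2 g))⟩
  map_add' w w' := Subtype.ext (rawExtDeriv_add (w := w.1) (w' := w'.1) w.2.1 w'.2.1)
  map_smul' r w := Subtype.ext (rawExtDeriv_smul r w.1)

/-- The de Rham differential of `Ω^*(M)^G`. -/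
def invD : InvForms E G M →ₗ[ℝ] InvForms E G M :=
  DirectSum.toModule ℝ ℕ (InvForms E G M) fun q =>
    DirectSum.lof ℝ ℕ (fun q => InvForm E G M q) (q + 1) ∘ₗ invDComponent E G M F q

theorem invD_lof (q : ℕ) (w : InvForm E G M q) :
    invD E G M F (DirectSum.lof ℝ ℕ (fun q => InvForm E G M q) q w) =
      DirectSum.lof ℝ ℕ (fun q => InvForm E G M q) (q + 1) (invDComponent E G M F q w) := by
  rw [invD, DirectSum.toModule_lof]; rfl

theorem invD_invD (x : InvForms E G M) : invD E G M F (invD E G M F x) = 0 := by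
  suffices h : invD E G M F ∘ₗ invD E G M F = 0 from LinearMap.congr_fun h x
  refine DirectSum.linearMap_ext ℝ fun q => LinearMap.ext fun w => ?_
  have h : invDComponent E G M F (q + 1) (invDComponent E G M F q w) = 0 :=
    Subtype.ext (rawExtDeriv_rawExtDeriv w.2.1)
  simp only [LinearMap.comp_apply, invD_lof, h, map_zero, LinearMap.zero_apply]

theorem invD_mem {m : ℤ} {x : InvForms E G M} (hx : x ∈ invFormsOfDegree E G M m) :
    invD E G M F x ∈ invFormsOfDegree E G M (m + 1) := by
  classical
  rw [← DirectSum.sum_support_of x, map_sum]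
  refine Submodule.sum_mem _ fun q hq => ?_
  have h := hx q (DFinsupp.mem_support_iff.1 hq)
  have h' := invD_lof E G M F q (x q)
  intro q' hq'
  by_cases he : q + 1 = q'
  · omega
  · exact (hq' ((congrArg (fun y : InvForms E G M => y q') h').trans
      (DirectSum.of_eq_of_ne _ _ _ (Ne.symm he)))).elim

/-- The cohomology `H^m(Ω^*(M)^G, d)`. -/
abbrev InvCohomology (m : ℤ) : Type _ :=
  gradedCohomology (T := InvForms E G M) (invD E G M F) (invFormsOfDegree E G M) m

variable [FiniteDimensional ℝ E]

/-- The invariant forms as cochains of cosimplicial degree zero. -/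
def invInclComponent (q : ℕ) : InvForm E G M q →ₗ[ℝ] (hopfCocyclicModule F E G M).X 0 q where
  toFun w := (constCochain 0 (⟨w.1, w.2.1⟩ : Form E M q) : Cochain F E G M 0 q)
  map_add' _ _ := rfl
  map_smul' _ _ := rfl

/-- The inclusion of `Ω^*(M)^G` into the total complex of the cyclic module, through
`Ω^*(M)^G ⊆ Ω^*(M)`, the part of cosimplicial degree zero. -/
def invIncl : InvForms E G M →ₗ[ℝ] (hopfCocyclicModule F E G M).Total :=
  DirectSum.toModule ℝ ℕ _ fun q =>
    (hopfCocyclicModule F E G M).incl 0 q ∘ₗ invInclComponent E G M F q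

theorem invIncl_lof (q : ℕ) (w : InvForm E G M q) :
    invIncl E G M F (DirectSum.lof ℝ ℕ (fun q => InvForm E G M q) q w) =
      (hopfCocyclicModule F E G M).incl 0 q (invInclComponent E G M F q w) := by
  rw [invIncl, DirectSum.toModule_lof]; rfl

/-- The inclusion is compatible with the differentials. -/
theorem totalD_invIncl (x : InvForms E G M) :
    (hopfCocyclicModule F E G M).totalD (invIncl E G M F x) =
      invIncl E G M F (invD E G M F x) := by
  suffices h : (hopfCocyclicModule F E G M).totalD ∘ₗ invIncl E G M F =
      invIncl E G M F ∘ₗ invD E G M F from LinearMap.congr_fun h x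
  refine DirectSum.linearMap_ext ℝ fun q => LinearMap.ext fun w => ?_
  have hb : (hopfCocyclicModule F E G M).b (invInclComponent E G M F q w) = 0 := by
    have h0 : (coface 0 (invInclComponent E G M F q w) : Cochain F E G M 1 q) =
        (coface 1 (invInclComponent E G M F q w) : Cochain F E G M 1 q) := by
      refine Subtype.ext (funext fun g => ?_)
      exact (w.2.2 (g 0)).trans (act_one w.1).symm
    rw [DGCocyclicModule.b_apply, Fin.sum_univ_two]
    change (-1 : ℝ) ^ 0 • (coface 0 (invInclComponent E G M F q w) : Cochain F E G M 1 q) +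
      (-1 : ℝ) ^ 1 • (coface 1 (invInclComponent E G M F q w) : Cochain F E G M 1 q) = 0
    rw [h0]
    module
  simp only [LinearMap.comp_apply]
  rw [invIncl_lof, DGCocyclicModule.totalD_incl_zero, hb, map_zero, zero_add, invD,
    DirectSum.toModule_lof, LinearMap.comp_apply, invIncl_lof]
  rfl

theorem invIncl_mem {S : Submodule ℝ (hopfCocyclicModule F E G M).Total} {x : InvForms E G M}
    (h : ∀ q : ℕ, x q ≠ 0 → (hopfCocyclicModule F E G M).incl 0 q
      (invInclComponent E G M F q (x q)) ∈ S) : invIncl E G M F x ∈ S := by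
  classical
  rw [← DirectSum.sum_support_of x, map_sum]
  refine S.sum_mem fun q hq => ?_
  have := h q (DFinsupp.mem_support_iff.1 hq)
  rw [← invIncl_lof] at this
  exact this

theorem invIncl_mem_cyclicCochains {m n : ℤ} (h : ∃ k : ℕ, m + 2 * k = n) {x : InvForms E G M}
    (hx : x ∈ invFormsOfDegree E G M m) :
    invIncl E G M F x ∈ (hopfCocyclicModule F E G M).cyclicCochains n := by
  obtain ⟨k, hk⟩ := h
  refine invIncl_mem E G M F fun q hq => ?_
  exact DGCocyclicModule.incl_mem_cyclicCochains _ ⟨k, by have := hx q hq; push_cast; omega⟩ _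

theorem invIncl_mem_periodicCochains {m n : ℤ} (h : ∃ k : ℤ, m + 2 * k = n) {x : InvForms E G M}
    (hx : x ∈ invFormsOfDegree E G M m) :
    invIncl E G M F x ∈ (hopfCocyclicModule F E G M).periodicCochains n := by
  obtain ⟨k, hk⟩ := h
  refine invIncl_mem E G M F fun q hq => ?_
  exact DGCocyclicModule.incl_mem_periodicCochains _ ⟨k, by have := hx q hq; push_cast; omega⟩ _

/-- The map `H^{n-2k}(Ω^*(M)^G, d) → HC^n` induced by the inclusion. -/
def inclHC (n : ℤ) (k : ℕ) :
    InvCohomology E G M F (n - 2 * k) →ₗ[ℝ] (hopfCocyclicModule F E G M).HC n :=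
  gradedCohomologyMap (invIncl E G M F) (totalD_invIncl E G M F)
    (fun _ hx => invIncl_mem_cyclicCochains E G M F ⟨k, by omega⟩ hx)
    (fun _ hx => invIncl_mem_cyclicCochains E G M F ⟨k, by omega⟩ hx)

/-- The map `H^{n+2k}(Ω^*(M)^G, d) → HP^n` induced by the inclusion. -/
def inclHP (n k : ℤ) :
    InvCohomology E G M F (n + 2 * k) →ₗ[ℝ] (hopfCocyclicModule F E G M).HP n :=
  gradedCohomologyMap (invIncl E G M F) (totalD_invIncl E G M F)
    (fun _ hx => invIncl_mem_periodicCochains E G M F ⟨-k, by omega⟩ hx)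
    (fun _ hx => invIncl_mem_periodicCochains E G M F ⟨-k, by omega⟩ hx)

end Invariant

end HopfCyclic

end

/-! The total differential is `b ± d + B`, and only `b` raises the cosimplicial degree `p`. For
fixed `q`, the columns `(C^{p,q}, b)` form the complex of smooth cochains of `G` with coefficients
in the `q`-forms on `M`. The theorem follows once these columns are exact for `p > 0`, with kernel
the invariant forms at `p = 0`. The kernel is immediate, since `b a` at `g` is `g^* a - a` when `p =
0`.

Exactness is where properness enters. A proper action has a smooth cut-off function `c` with `∫
c(k⁻¹x) dk = 1` for left Haar measure, and with `c(k⁻¹y) = 0` for `y` near a given point and `k`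
outside a compact set (`exists_cutoff`). For a cocycle `a` put `(ha)(g₁,…,g_p) = ∫ c(k⁻¹x) k^*
a(k⁻¹,g₁,…,g_p) dk`. The identity `b a = 0` on the tuple `(k⁻¹,g₁,…,g_{p+1})`, translated by `k^*`,
writes `a(g)` as an alternating sum of the terms `k^* a` on the contracted tuples. The average of
these terms against `c(k⁻¹x) dk` is the alternating sum of the cofaces of `ha`, left invariance of
Haar measure being needed only for `δ₀`. Hence `b(ha) = a` (`b_contraction`). The analytic input is
smoothness of integrals in their parameters (`contMDiffAt_integral`, `IsSmoothFamily.formIntegral`).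

The passage from columns to the total complex is by descent on `p`. Cochains are finite sums, so
each has a top cosimplicial degree. If the coboundary of `x` has cosimplicial degree zero, then the
components of `x` of top degree `N > 0` are `b`-cocycles, hence of the form `b y`, and subtracting
the total coboundary of `y` lowers the top degree. This ends in degree zero
(`exists_sub_totalD_mem_filtration`), where the remainder is an invariant form and the total
differential is `d`. Nothing about Connes' operator is needed beyond its bidegree and the vanishing
of the square of the total differential.

Both halves of the statement are the same argument for a set of total degrees `p + q` stable under
subtraction of two, because `b` and `d` raise `p + q` by one and `B` lowers it by one
(`bijective_toModule_invIncl`). The direct sum decomposition comes from the projections of the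
invariant forms onto their homogeneous parts (`bijective_toModule_gradedCohomologyMap`). -/

noncomputable section

namespace HopfCyclic

open MeasureTheory

/-! ### Smoothness of integrals depending on parameters -/

section ParametricIntegral

variable {F Q : Type*} [NormedAddCommGroup F] [NormedSpace ℝ F]
  [TopologicalSpace Q] [T2Space Q] [ChartedSpace F Q]
  [MeasurableSpace Q] [BorelSpace Q] {μ : Measure Q} [IsFiniteMeasureOnCompacts μ]
  {V W : Type*} [NormedAddCommGroup V] [NormedSpace ℝ V] [FiniteDimensional ℝ V]
  [NormedAddCommGroup W] [NormedSpace ℝ W]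

theorem fderiv_eq_zero_of_forall_mem {f : V → W} {U : Set V} (hU : IsOpen U)
    (h : ∀ z ∈ U, f z = 0) {z : V} (hz : z ∈ U) : fderiv ℝ f z = 0 := by
  have h1 : f =ᶠ[𝓝 z] fun _ => 0 := by
    filter_upwards [hU.mem_nhds hz] with y hy using h y hy
  rw [h1.fderiv_eq]
  exact fderiv_const_apply 0

/-- Differentiation under the integral sign. -/
theorem hasFDerivAt_integral_of_compact {Φ : Q → V → W} {U : Set V} (hU : IsOpen U) {K : Set Q}
    (hK : IsCompact K)
    (hΦ : ∀ k, ∀ z ∈ U, ContMDiffAt (𝓘(ℝ, F).prod 𝓘(ℝ, V)) 𝓘(ℝ, W) ∞ (Function.uncurry Φ) (k, z))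
    (h0 : ∀ k ∉ K, ∀ z ∈ U, Φ k z = 0) {z : V} (hz : z ∈ U) :
    Integrable (fun k => fderiv ℝ (Φ k) z) μ ∧
      HasFDerivAt (fun z => ∫ k, Φ k z ∂μ) (∫ k, fderiv ℝ (Φ k) z ∂μ) z := by
  have hD : ∀ k, ∀ z ∈ U, ContMDiffAt (𝓘(ℝ, F).prod 𝓘(ℝ, V)) 𝓘(ℝ, V →L[ℝ] W) ∞
      (fun y : Q × V => fderiv ℝ (Φ y.1) y.2) (k, z) := fun k z hz =>
    contMDiffAt_fderiv_param 𝓘(ℝ, F) (hΦ k z hz)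
  have hc : ∀ z ∈ U, Continuous fun k => Φ k z := fun z hz =>
    continuous_iff_continuousAt.2 fun k => ContinuousAt.comp (x := k)
      (g := Function.uncurry Φ) (f := fun k => (k, z)) (hΦ k z hz).continuousAt (by fun_prop)
  have hc' : Continuous fun k => fderiv ℝ (Φ k) z :=
    continuous_iff_continuousAt.2 fun k => ContinuousAt.comp (x := k)
      (g := fun y : Q × V => fderiv ℝ (Φ y.1) y.2) (f := fun k => (k, z))
      (hD k z hz).continuousAt (by fun_prop)
  have hs : ∀ z ∈ U, HasCompactSupport fun k => Φ k z := fun z hz =>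
    HasCompactSupport.intro hK fun k hk => h0 k hk z hz
  have hs' : HasCompactSupport fun k => fderiv ℝ (Φ k) z :=
    HasCompactSupport.intro hK fun k hk => fderiv_eq_zero_of_forall_mem hU (h0 k hk) hz
  -- A closed ball in the finite-dimensional space `V` is compact, so the partial derivative is
  -- bounded by some `C` on `K` times the ball. The dominating function is `C` on `K` and zero
  -- elsewhere, integrable because `K` has finite measure.
  obtain ⟨ε, hε, hεU⟩ := Metric.nhds_basis_closedBall.mem_iff.1 (hU.mem_nhds hz)
  obtain ⟨C, hC⟩ := (hK.prod (isCompact_closedBall z ε)).exists_bound_of_continuousOn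
    (f := fun y : Q × V => fderiv ℝ (Φ y.1) y.2)
    (fun y hy => (hD y.1 y.2 (hεU hy.2)).continuousAt.continuousWithinAt)
  refine ⟨hc'.integrable_of_hasCompactSupport hs',
    hasFDerivAt_integral_of_dominated_of_fderiv_le (F := fun z k => Φ k z)
      (F' := fun z k => fderiv ℝ (Φ k) z) (bound := K.indicator fun _ => C)
      (Metric.closedBall_mem_nhds z hε) ?_ ((hc z hz).integrable_of_hasCompactSupport (hs z hz))
      (hc'.integrable_of_hasCompactSupport hs').aestronglyMeasurable ?_ ?_ ?_⟩
  · filter_upwards [hU.mem_nhds hz] with y hy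
    exact ((hc y hy).integrable_of_hasCompactSupport (hs y hy)).aestronglyMeasurable
  · refine Filter.Eventually.of_forall fun k y hy => ?_
    by_cases hk : k ∈ K
    · rw [Set.indicator_of_mem hk]
      exact hC (k, y) ⟨hk, hy⟩
    · rw [Set.indicator_of_notMem hk, fderiv_eq_zero_of_forall_mem hU (h0 k hk) (hεU hy), norm_zero]
  · rw [integrable_indicator_iff hK.isClosed.measurableSet]
    exact integrableOn_const hK.measure_lt_top.ne
  · refine Filter.Eventually.of_forall fun k y hy => ?_
    have h1 : ContMDiffAt 𝓘(ℝ, V) 𝓘(ℝ, W) ∞ (Φ k) y :=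
      ContMDiffAt.comp y (g := Function.uncurry Φ) (f := fun z => (k, z)) (hΦ k y (hεU hy))
        (contMDiffAt_const.prodMk contMDiffAt_id)
    exact (h1.contDiffAt.differentiableAt (by simp)).hasFDerivAt

/-- Induction on the order of differentiability, for all integrands at once: a directional
derivative of the integral is the integral of the directional derivative, which satisfies the same
hypotheses. Testing the derivative on a fixed vector keeps the values in `W`. -/
theorem contDiffOn_integral_of_compact {Φ : Q → V → W} {U : Set V} (hU : IsOpen U) {K : Set Q}
    (hK : IsCompact K)
    (hΦ : ∀ k, ∀ z ∈ U, ContMDiffAt (𝓘(ℝ, F).prod 𝓘(ℝ, V)) 𝓘(ℝ, W) ∞ (Function.uncurry Φ) (k, z))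
    (h0 : ∀ k ∉ K, ∀ z ∈ U, Φ k z = 0) : ContDiffOn ℝ ∞ (fun z => ∫ k, Φ k z ∂μ) U := by
  refine contDiffOn_infty.2 fun n => ?_
  induction n generalizing Φ with
  | zero =>
    refine contDiffOn_zero.2 fun z hz => ContinuousAt.continuousWithinAt ?_
    exact (hasFDerivAt_integral_of_compact hU hK hΦ h0 hz).2.continuousAt
  | succ n ih =>
    push_cast
    refine (contDiffOn_succ_iff_fderiv_of_isOpen hU).2 ⟨fun z hz =>
      (hasFDerivAt_integral_of_compact hU hK hΦ h0 hz).2.differentiableAt.differentiableWithinAt,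
      by simp, contDiffOn_clm_apply.2 fun v => ?_⟩
    refine (ih (Φ := fun k z => fderiv ℝ (Φ k) z v) (fun k z hz => ?_) fun k hk z hz => ?_).congr
      fun z hz => ?_
    · exact ContMDiffAt.comp (k, z) (g := fun A : V →L[ℝ] W => A v)
        (ContinuousLinearMap.apply ℝ W v).contDiff.contMDiff.contMDiffAt
        (contMDiffAt_fderiv_param 𝓘(ℝ, F) (hΦ k z hz))
    · rw [fderiv_eq_zero_of_forall_mem hU (h0 k hk) hz, zero_apply]
    · have h1 := hasFDerivAt_integral_of_compact (μ := μ) hU hK hΦ h0 hz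
      rw [h1.2.fderiv, ContinuousLinearMap.integral_apply h1.1]

variable {EP HP P : Type*} [NormedAddCommGroup EP] [NormedSpace ℝ EP] [FiniteDimensional ℝ EP]
  [TopologicalSpace HP] [TopologicalSpace P] [ChartedSpace HP P]

/-- The integral of a smooth family of functions with locally uniformly compact supports is a
smooth function of the parameter. -/
theorem contMDiffAt_integral {J : ModelWithCorners ℝ EP HP} [J.Boundaryless] [IsManifold J ∞ P]
    {Φ : Q → P → W} {z : P} {K : Set Q} (hK : IsCompact K)
    (hΦ : ∀ᶠ y in 𝓝 z, ∀ k,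
      ContMDiffAt (𝓘(ℝ, F).prod J) 𝓘(ℝ, W) ∞ (Function.uncurry Φ) (k, y))
    (h0 : ∀ᶠ y in 𝓝 z, ∀ k ∉ K, Φ k y = 0) :
    ContMDiffAt J 𝓘(ℝ, W) ∞ (fun y => ∫ k, Φ k y ∂μ) z := by
  obtain ⟨O, hO, hOo, hzO⟩ := eventually_nhds_iff.1 (hΦ.and h0)
  set φ := extChartAt J z with hφ
  have hcs : ContinuousOn φ.symm φ.target := continuousOn_extChartAt_symm z
  have hT : IsOpen φ.target := isOpen_extChartAt_target z
  have hU : IsOpen (φ.target ∩ φ.symm ⁻¹' O) := hcs.isOpen_inter_preimage hT hOo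
  have h1 : ContDiffOn ℝ ∞ (fun t => ∫ k, Φ k (φ.symm t) ∂μ) (φ.target ∩ φ.symm ⁻¹' O) := by
    refine contDiffOn_integral_of_compact (F := F) hU hK (fun k t ht => ?_) fun k hk t ht =>
      (hO _ ht.2).2 k hk
    have h2 : ContMDiffAt 𝓘(ℝ, EP) J ∞ φ.symm t :=
      (contMDiffOn_extChartAt_symm z).contMDiffAt (hT.mem_nhds ht.1)
    exact ContMDiffAt.comp (k, t) (g := Function.uncurry Φ)
      (f := fun y : Q × EP => (y.1, φ.symm y.2)) ((hO _ ht.2).1 k)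
      (contMDiffAt_fst.prodMk (ContMDiffAt.comp (k, t) h2 contMDiffAt_snd))
  have hzU : φ z ∈ φ.target ∩ φ.symm ⁻¹' O := by
    refine ⟨mem_extChartAt_target z, ?_⟩
    rw [Set.mem_preimage, hφ, extChartAt_to_inv]
    exact hzO
  have h3 := ContMDiffAt.comp z (h1.contDiffAt (hU.mem_nhds hzU)).contMDiffAt
    (contMDiffAt_extChartAt (I := J) (n := ∞))
  refine h3.congr_of_eventuallyEq ?_
  filter_upwards [extChartAt_source_mem_nhds (I := J) z] with y hy
  simp only [Function.comp_apply]
  rw [φ.left_inv hy]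

end ParametricIntegral

/-! ### Cut-off functions of proper actions -/

section Cutoff

variable {F : Type*} [NormedAddCommGroup F] [NormedSpace ℝ F]
  {E : Type*} [NormedAddCommGroup E] [NormedSpace ℝ E] [FiniteDimensional ℝ E]
  {G : Type*} [TopologicalSpace G] [ChartedSpace F G] [Group G] [LieGroup 𝓘(ℝ, F) ∞ G]
  {M : Type*} [TopologicalSpace M] [ChartedSpace E M] [IsManifold 𝓘(ℝ, E) ∞ M]
  [MulAction G M]

variable (G) in
/-- The translates `k⁻¹ • y` of the points `y` near a given one meet the support of `f` only
for `k` in a compact set. -/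
def HasProperSupport (f : M → ℝ) : Prop :=
  ∀ x : M, ∃ K : Set G, IsCompact K ∧ ∀ᶠ y in 𝓝 x, ∀ k ∉ K, f (k⁻¹ • y) = 0

theorem isCompact_setOf_smul_mem [ProperSMul G M] {A B : Set M} (hA : IsCompact A)
    (hB : IsCompact B) :
    ∃ K : Set G, IsCompact K ∧ ∀ y ∈ A, ∀ k ∉ K, k⁻¹ • y ∉ B := by
  -- The preimage of `A × B` under the proper map `(k, z) ↦ (k • z, z)` is compact, and `K` is its
  -- projection to `G`. The pair `(k, k⁻¹ • y)` is sent to `(y, k⁻¹ • y)`.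
  refine ⟨_, ((ProperSMul.isProperMap_smul_pair (G := G) (X := M)).isCompact_preimage
    (hA.prod hB)).image continuous_fst, fun y hy k hk hB' => hk ⟨(k, k⁻¹ • y), ?_, rfl⟩⟩
  exact ⟨by simpa using hy, hB'⟩

variable [T2Space M]

/-- Properness is applied to a compact neighbourhood of the point and the compact support of `f`. -/
theorem hasProperSupport_of_hasCompactSupport [LocallyCompactSpace M] [ProperSMul G M]
    {f : M → ℝ} (hf : HasCompactSupport f) : HasProperSupport G f := by
  intro x
  obtain ⟨A, hA, hxA⟩ := exists_compact_mem_nhds x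
  obtain ⟨K, hK, h⟩ := isCompact_setOf_smul_mem (G := G) hA hf
  refine ⟨K, hK, ?_⟩
  filter_upwards [hxA] with y hy k hk
  exact image_eq_zero_of_notMem_tsupport (h y hy k hk)

variable [T2Space G] [MeasurableSpace G] [BorelSpace G] (μ : Measure G)

/-- The average `x ↦ ∫ f (k⁻¹ x) dk` of a function over the orbits. -/
def orbitIntegral (f : M → ℝ) (x : M) : ℝ := ∫ k : G, f (k⁻¹ • x) ∂μ

theorem contMDiff_orbitIntegral [ContMDiffSMul 𝓘(ℝ, F) 𝓘(ℝ, E) ∞ G M]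
    [IsFiniteMeasureOnCompacts μ] {f : M → ℝ}
    (hf : ContMDiff 𝓘(ℝ, E) 𝓘(ℝ) ∞ f) (hs : HasProperSupport G f) :
    ContMDiff 𝓘(ℝ, E) 𝓘(ℝ) ∞ (orbitIntegral μ f) := by
  intro x
  obtain ⟨K, hK, h⟩ := hs x
  exact contMDiffAt_integral (F := F) (Φ := fun (k : G) (y : M) => f (k⁻¹ • y)) hK
    (Filter.Eventually.of_forall fun y k => (hf.comp (contMDiff_smul_inv F E M)) (k, y)) h

/-- Substitution `k ↦ g⁻¹ k`. Invariance is what later allows both the multiplication of cut-offs by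
functions of orbit integrals and the normalization. -/
theorem orbitIntegral_smul [IsTopologicalGroup G] [μ.IsMulLeftInvariant] (f : M → ℝ) (g : G)
    (x : M) : orbitIntegral μ f (g • x) = orbitIntegral μ f x := by
  rw [orbitIntegral, orbitIntegral,
    ← integral_mul_left_eq_self (fun k : G => f (k⁻¹ • x)) g⁻¹]
  simp [mul_smul]

/-- The integrand is continuous in `k`, nonnegative, compactly supported and nonzero at `g`; the
measure charges open sets. -/
theorem orbitIntegral_pos [ContinuousSMul G M] [IsTopologicalGroup G]
    [IsFiniteMeasureOnCompacts μ] [μ.IsOpenPosMeasure] {f : M → ℝ}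
    (hf : Continuous f) (h0 : ∀ x, 0 ≤ f x) (hs : HasProperSupport G f) {x : M} {g : G}
    (hx : f (g⁻¹ • x) ≠ 0) : 0 < orbitIntegral μ f x := by
  obtain ⟨K, hK, h⟩ := hs x
  refine Continuous.integral_pos_of_hasCompactSupport_nonneg_nonzero (x := g)
    (hf.comp (continuous_inv.smul continuous_const))
    (HasCompactSupport.intro hK fun k hk => h.self_of_nhds k hk) (fun k => h0 _) hx

variable (E M) in
/-- Countably many smooth functions with compact supports whose positivity sets cover `M`. -/
theorem exists_bump_sequence [SecondCountableTopology M] [Nonempty M] :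
    ∃ χ : ℕ → M → ℝ, (∀ n, ContMDiff 𝓘(ℝ, E) 𝓘(ℝ) ∞ (χ n)) ∧ (∀ n, HasCompactSupport (χ n)) ∧
      (∀ n x, 0 ≤ χ n x) ∧ ∀ x, ∃ n, χ n x ≠ 0 := by
  let f : ∀ x : M, SmoothBumpFunction 𝓘(ℝ, E) x := fun x => Classical.arbitrary _
  obtain ⟨s, hs, hsU⟩ := TopologicalSpace.countable_cover_nhds
    (f := fun x => Function.support (f x)) fun x => (f x).support_mem_nhds
  have hne : s.Nonempty := by
    by_contra h
    rw [Set.not_nonempty_iff_eq_empty.1 h] at hsU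
    exact Set.empty_ne_univ (α := M) (by simpa using hsU)
  obtain ⟨e, rfl⟩ := hs.exists_eq_range hne
  refine ⟨fun n => f (e n), fun n => (f (e n)).contMDiff, fun n => (f (e n)).hasCompactSupport,
    fun n x => (f (e n)).nonneg, fun x => ?_⟩
  have hx : x ∈ ⋃ y ∈ Set.range e, Function.support (f y) := hsU ▸ Set.mem_univ x
  simp only [Set.mem_iUnion, Set.mem_range, exists_prop, exists_exists_eq_and] at hx
  exact hx

variable (F E M) in
/-- A nonnegative function with proper support that does not vanish on any orbit. -/
theorem exists_precutoff [SecondCountableTopology M] [Nonempty M] [ProperSMul G M]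
    [IsTopologicalGroup G] [ContMDiffSMul 𝓘(ℝ, F) 𝓘(ℝ, E) ∞ G M] [IsFiniteMeasureOnCompacts μ]
    [μ.IsOpenPosMeasure] [μ.IsMulLeftInvariant] :
    ∃ c : M → ℝ, ContMDiff 𝓘(ℝ, E) 𝓘(ℝ) ∞ c ∧ (∀ x, 0 ≤ c x) ∧ HasProperSupport G c ∧
      ∀ x, ∃ g : G, c (g⁻¹ • x) ≠ 0 := by
  obtain ⟨χ, hχ, hχs, hχ0, hχ1⟩ := exists_bump_sequence E M
  have := Manifold.locallyCompact_of_finiteDimensional (M := M) 𝓘(ℝ, E)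
  have hp : ∀ n, HasProperSupport G (χ n) := fun n => hasProperSupport_of_hasCompactSupport (hχs n)
  let f : ℕ → M → ℝ := fun n => orbitIntegral μ (χ n)
  have hf : ∀ n, ContMDiff 𝓘(ℝ, E) 𝓘(ℝ) ∞ (f n) := fun n =>
    contMDiff_orbitIntegral (F := F) μ (hχ n) (hp n)
  have hfg : ∀ n (g : G) x, f n (g • x) = f n x := fun n => orbitIntegral_smul μ (χ n)
  have hpos : ∀ n x, χ n x ≠ 0 → 0 < f n x := fun n x hx =>
    orbitIntegral_pos μ (hχ n).continuous (hχ0 n) (hp n) (g := 1) (by simpa using hx)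
  -- The invariant factors switch `χ n` off on every orbit where some earlier `f j` is at least `1 /
  -- n`. This makes the family locally finite along whole orbits, not merely at points of `M`,
  -- without passing to the quotient `M / G`.
  let t : ℕ → M → ℝ := fun n x =>
    χ n x * ∏ j ∈ Finset.range n, Real.smoothTransition (1 - n * f j x)
  have ht0 : ∀ n x, 0 ≤ t n x := fun n x =>
    mul_nonneg (hχ0 n x) (Finset.prod_nonneg fun j _ => Real.smoothTransition.nonneg _)
  have ht : ∀ n, ContMDiff 𝓘(ℝ, E) 𝓘(ℝ) ∞ (t n) := by
    refine fun n => (hχ n).mul (contMDiff_finsetProd fun j _ => ?_)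
    exact ContMDiff.comp (g := fun s : ℝ => Real.smoothTransition (1 - n * s))
      (Real.smoothTransition.contDiff.comp
        (contDiff_const.sub (contDiff_const.mul contDiff_id))).contMDiff (hf j)
  have hloc : ∀ x, ∃ N : ℕ, ∀ᶠ y in 𝓝 x, ∀ (g : G), ∀ n ≥ N, t n (g • y) = 0 := by
    intro x
    obtain ⟨j, hj⟩ := hχ1 x
    have hj := hpos j x hj
    obtain ⟨N, hN⟩ := exists_nat_gt (f j x)⁻¹
    have hNf : 1 < N * f j x := by rwa [inv_lt_iff_one_lt_mul₀ hj] at hN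
    have hev : ∀ᶠ y in 𝓝 x, 1 < N * f j y :=
      (continuous_const.mul (hf j).continuous).continuousAt.eventually (lt_mem_nhds hNf)
    -- The bound `j + 1` puts the index `j` among the factors of `t n`, and the bound `N` gives `n *
    -- f j > 1` near `x`, so that this factor vanishes.
    refine ⟨max N (j + 1), ?_⟩
    filter_upwards [hev] with y hy g n hn
    have hfy : 0 < f j y := by
      by_contra h
      have := mul_nonpos_of_nonneg_of_nonpos (Nat.cast_nonneg N) (not_lt.1 h)
      linarith
    refine mul_eq_zero_of_right _ (Finset.prod_eq_zero (i := j) ?_ ?_)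
    · exact Finset.mem_range.2 (lt_of_lt_of_le (Nat.lt_succ_self j)
        ((le_max_right _ _).trans hn))
    · refine Real.smoothTransition.zero_of_nonpos ?_
      rw [hfg]
      have : (N : ℝ) * f j y ≤ n * f j y :=
        mul_le_mul_of_nonneg_right (Nat.cast_le.2 ((le_max_left _ _).trans hn)) hfy.le
      linarith
  have hfin : LocallyFinite fun n => Function.support (t n) := by
    intro x
    obtain ⟨N, hN⟩ := hloc x
    refine ⟨_, hN, (Set.finite_lt_nat N).subset ?_⟩
    rintro n ⟨y, hy, hyN⟩
    by_contra h
    exact hy (by simpa using hyN 1 n (not_lt.1 h))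
  refine ⟨fun x => ∑ᶠ n, t n x, contMDiff_finsum ht hfin, fun x => finsum_nonneg (ht0 · x), ?_, ?_⟩
  · intro x
    obtain ⟨N, hN⟩ := hloc x
    choose K hK hKx using fun n => hp n x
    -- On orbits meeting a neighbourhood of `x` only the terms with `n < N` survive, so finitely
    -- many compact sets suffice.
    refine ⟨⋃ n ∈ Finset.range N, K n, (Finset.range N).isCompact_biUnion fun n _ => hK n, ?_⟩
    have hall : ∀ᶠ y in 𝓝 x, ∀ n ∈ Finset.range N, ∀ k ∉ K n, χ n (k⁻¹ • y) = 0 :=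
      (Filter.eventually_all_finset _).2 fun n _ => hKx n
    filter_upwards [hN, hall] with y hy hy' k hk
    refine finsum_eq_zero_of_forall_eq_zero fun n => ?_
    rcases lt_or_ge n N with h | h
    · have hkn : k ∉ K n := fun hkn => hk (Set.mem_biUnion (Finset.mem_range.2 h) hkn)
      exact mul_eq_zero_of_left (hy' n (Finset.mem_range.2 h) k hkn) _
    · exact hy _ n h
  · intro x
    classical
    -- For the least `n` with `f n x > 0`, all factors of `t n` on the orbit of `x` have argument at
    -- least one, hence are positive. As the integral `f n x` is nonzero, `χ n` is nonzero at some
    -- translate of `x`.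
    have hex : ∃ n, 0 < f n x := by
      obtain ⟨n, hn⟩ := hχ1 x
      exact ⟨n, hpos n x hn⟩
    have hn := Nat.find_spec hex
    have hmin : ∀ j < Nat.find hex, f j x ≤ 0 := fun j hj => not_lt.1 (Nat.find_min hex hj)
    set n := Nat.find hex
    have hg : ∃ g : G, χ n (g⁻¹ • x) ≠ 0 := by
      by_contra! h
      have : f n x = 0 := by simp [f, orbitIntegral, h]
      exact hn.ne' this
    obtain ⟨g, hg⟩ := hg
    refine ⟨g, ne_of_gt (finsum_pos (ht0 · _) ⟨n, ?_⟩ ?_)⟩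
    · refine mul_pos (lt_of_le_of_ne (hχ0 _ _) hg.symm) (Finset.prod_pos fun j hj => ?_)
      refine Real.smoothTransition.pos_of_pos ?_
      rw [hfg]
      have := mul_nonpos_of_nonneg_of_nonpos (Nat.cast_nonneg (α := ℝ) n)
        (hmin j (Finset.mem_range.1 hj))
      linarith
    · exact hfin.point_finite (g⁻¹ • x)

variable (F E M) in
/-- Proper actions have cut-off functions. -/
theorem exists_cutoff [SecondCountableTopology M] [ProperSMul G M]
    [IsTopologicalGroup G] [ContMDiffSMul 𝓘(ℝ, F) 𝓘(ℝ, E) ∞ G M] [IsFiniteMeasureOnCompacts μ]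
    [μ.IsOpenPosMeasure] [μ.IsMulLeftInvariant] :
    ∃ c : M → ℝ, ContMDiff 𝓘(ℝ, E) 𝓘(ℝ) ∞ c ∧ HasProperSupport G c ∧
      ∀ x, ∫ k : G, c (k⁻¹ • x) ∂μ = 1 := by
  -- The bump sequence comes from enumerating a nonempty index set; over the empty manifold every
  -- requirement is vacuous.
  rcases isEmpty_or_nonempty M with hM | hM
  · exact ⟨0, contMDiff_const, fun x => hM.elim x, fun x => hM.elim x⟩
  obtain ⟨c, hc, hc0, hs, hc1⟩ := exists_precutoff F E M μ
  have hpos : ∀ x, 0 < orbitIntegral μ c x := fun x => by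
    obtain ⟨g, hg⟩ := hc1 x
    exact orbitIntegral_pos μ hc.continuous hc0 hs hg
  refine ⟨fun x => c x * (orbitIntegral μ c x)⁻¹, hc.mul
    ((contMDiff_orbitIntegral (F := F) μ hc hs).inv₀ fun x => (hpos x).ne'), fun x => ?_,
    fun x => ?_⟩
  · obtain ⟨K, hK, h⟩ := hs x
    refine ⟨K, hK, ?_⟩
    filter_upwards [h] with y hy k hk
    rw [hy k hk, zero_mul]
  -- The normalizing factor is constant along the orbit, so it leaves the integral.
  · simp only [orbitIntegral_smul]
    rw [integral_mul_const]
    exact mul_inv_cancel₀ (hpos x).ne'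

end Cutoff

/-! ### Contraction of the Hochschild complex -/

/-- Transition maps of product charts act coordinatewise. The powers of `G` are the parameter
manifolds of the integrals below, where smoothness is checked in a chart of the parameter. -/
instance isManifold_pow {F G : Type*} [NormedAddCommGroup F] [NormedSpace ℝ F]
    [TopologicalSpace G] [ChartedSpace F G] [IsManifold 𝓘(ℝ, F) ∞ G] (p : ℕ) :
    IsManifold (powModel F p) ∞ (Fin p → G) := by
  refine isManifold_of_contDiffOn _ _ _ ?_
  rintro _ _ ⟨e, he, rfl⟩ ⟨e', he', rfl⟩
  refine contDiffOn_pi.2 fun i => ?_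
  have h := (contDiffGroupoid ∞ 𝓘(ℝ, F)).compatible (he i (Set.mem_univ i))
    (he' i (Set.mem_univ i))
  have h1 : ContDiffOn ℝ ∞ ((e i).symm ≫ₕ e' i) ((e i).symm ≫ₕ e' i).source := by
    simpa [contDiffPregroupoid] using (mem_groupoid_of_pregroupoid.1 h).1
  refine h1.comp (f := fun v : Fin p → F => v i) (contDiff_apply ℝ F i).contDiffOn fun v hv => ?_
  exact ⟨hv.1.1 i (Set.mem_univ i), hv.1.2 i (Set.mem_univ i)⟩

/-! ### Integrals of families of differential forms -/

section FormIntegral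

variable {F Q : Type*} [NormedAddCommGroup F] [NormedSpace ℝ F]
  [TopologicalSpace Q] [T2Space Q] [ChartedSpace F Q]
  [MeasurableSpace Q] [BorelSpace Q] (μ : Measure Q)
  {E : Type*} [NormedAddCommGroup E] [NormedSpace ℝ E] [FiniteDimensional ℝ E]
  {M N : Type*} [TopologicalSpace M] [ChartedSpace E M] [TopologicalSpace N] [ChartedSpace E N]
  {EP HP P : Type*} [NormedAddCommGroup EP] [NormedSpace ℝ EP]
  [TopologicalSpace HP] [TopologicalSpace P] [ChartedSpace HP P] {q : ℕ}

/-- The pointwise integral of a family of forms. -/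
def formIntegral (w : Q → RawForm E M q) : RawForm E M q := fun x =>
  (∫ k, (show E [⋀^Fin q]→L[ℝ] ℝ from w k x) ∂μ : E [⋀^Fin q]→L[ℝ] ℝ)

/-- At a single point the pull-back is a continuous linear map between spaces of alternating forms,
and such maps commute with integrals of integrable functions. -/
theorem pullback_formIntegral {w : Q → RawForm E M q} {f : N → M} {x : N}
    (h : Integrable (fun k => (show E [⋀^Fin q]→L[ℝ] ℝ from w k (f x))) μ) :
    pullback f (formIntegral μ w) x = formIntegral μ (fun k => pullback f (w k)) x := by
  have := finiteDimensional_alternating (E := E) q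
  have : CompleteSpace (E [⋀^Fin q]→L[ℝ] ℝ) := FiniteDimensional.complete ℝ _
  exact ((ContinuousAlternatingMap.compContinuousLinearMapCLM (𝕜 := ℝ) (F := ℝ) (ι := Fin q)
    (show E →L[ℝ] E from mfderiv 𝓘(ℝ, E) 𝓘(ℝ, E) f x)).integral_comp_comm h).symm

/-- Chain rule for the inverse chart composed with the chart, which is the identity near `x`. It
converts smoothness of local expressions into statements about the values of the form itself. -/
theorem apply_eq_inChart [IsManifold 𝓘(ℝ, E) ∞ M] (w : RawForm E M q) (x : M) :
    w x = (inChart x w (extChartAt 𝓘(ℝ, E) x x)).compContinuousLinearMap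
      (mfderiv 𝓘(ℝ, E) 𝓘(ℝ, E) (extChartAt 𝓘(ℝ, E) x) x) := by
  have hx : (extChartAt 𝓘(ℝ, E) x).symm (extChartAt 𝓘(ℝ, E) x x) = x := extChartAt_to_inv x
  have h4 : (extChartAt 𝓘(ℝ, E) x).symm ∘ extChartAt 𝓘(ℝ, E) x =ᶠ[𝓝 x] id := by
    filter_upwards [extChartAt_source_mem_nhds (I := 𝓘(ℝ, E)) x] with z hz
    exact (extChartAt 𝓘(ℝ, E) x).left_inv hz
  have h5 := mfderiv_comp x (f := extChartAt 𝓘(ℝ, E) x)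
    ((contMDiffAt_chartSymm x (mem_extChartAt_target x)).self_of_nhds.mdifferentiableAt (by simp))
    (mdifferentiableAt_extChartAt (I := 𝓘(ℝ, E)) (mem_chart_source E x))
  rw [h4.mfderiv_eq, mfderiv_id] at h5
  have key : ∀ a b : M, a = b → ∀ v : Fin q → E,
      (show E [⋀^Fin q]→L[ℝ] ℝ from w a) v = (show E [⋀^Fin q]→L[ℝ] ℝ from w b) v := by
    rintro a b rfl v; rfl
  ext v
  refine Eq.trans ?_ (key _ _ hx.symm _)
  change (show E [⋀^Fin q]→L[ℝ] ℝ from w x) _ = (show E [⋀^Fin q]→L[ℝ] ℝ from w x) _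
  congr 1
  ext i
  exact DFunLike.congr_fun h5 (v i)

/-- At a fixed point the value is a fixed continuous linear image of the local expression. Together
with compact support, this gives the integrability needed to move linear maps under the integral. -/
theorem IsSmoothFamily.continuous_apply [IsManifold 𝓘(ℝ, E) ∞ M] {J : ModelWithCorners ℝ EP HP}
    {w : P → RawForm E M q} (hw : IsSmoothFamily J w) (x : M) :
    Continuous fun s => (show E [⋀^Fin q]→L[ℝ] ℝ from w s x) := by
  have h1 : Continuous fun s => inChart x (w s) (extChartAt 𝓘(ℝ, E) x x) := by
    refine continuous_iff_continuousAt.2 fun s => ?_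
    have h2 := ((hw x).contMDiffAt ((isOpen_univ.prod (isOpen_chartTarget x)).mem_nhds
      (⟨Set.mem_univ s, mem_extChartAt_target x⟩ :
        (s, extChartAt 𝓘(ℝ, E) x x) ∈ Set.univ ×ˢ (extChartAt 𝓘(ℝ, E) x).target))).continuousAt
    exact ContinuousAt.comp (x := s) (f := fun s => (s, extChartAt 𝓘(ℝ, E) x x)) h2 (by fun_prop)
  have h3 := (ContinuousAlternatingMap.compContinuousLinearMapCLM (𝕜 := ℝ) (F := ℝ)
    (ι := Fin q) (show E →L[ℝ] E from
      mfderiv 𝓘(ℝ, E) 𝓘(ℝ, E) (extChartAt 𝓘(ℝ, E) x) x)).continuous.comp h1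
  exact h3.congr fun s => (apply_eq_inChart (w s) x).symm

theorem IsSmoothFamily.fun_smul [IsManifold 𝓘(ℝ, E) ∞ M] {J : ModelWithCorners ℝ EP HP}
    {w : P → RawForm E M q} (hw : IsSmoothFamily J w) {γ : P → M → ℝ}
    (hγ : ContMDiff (J.prod 𝓘(ℝ, E)) 𝓘(ℝ) ∞ (Function.uncurry γ)) :
    IsSmoothFamily J (fun s x => γ s x • w s x) := by
  intro x₀
  have h1 : ContMDiffOn (J.prod 𝓘(ℝ, E)) 𝓘(ℝ) ∞
      (fun z : P × E => γ z.1 ((extChartAt 𝓘(ℝ, E) x₀).symm z.2))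
      (Set.univ ×ˢ (extChartAt 𝓘(ℝ, E) x₀).target) := by
    refine hγ.comp_contMDiffOn (f := fun z : P × E => (z.1, (extChartAt 𝓘(ℝ, E) x₀).symm z.2))
      (contMDiffOn_fst.prodMk ?_)
    exact (contMDiffOn_extChartAt_symm x₀).comp contMDiffOn_snd fun z hz => hz.2
  exact h1.smul (hw x₀)

theorem inChart_formIntegral [IsManifold 𝓘(ℝ, E) ∞ M] [IsFiniteMeasureOnCompacts μ] (w : Q → RawForm E M q)
    (x₀ : M) (y : E)
    (h : Integrable (fun k => (show E [⋀^Fin q]→L[ℝ] ℝ from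
      w k ((extChartAt 𝓘(ℝ, E) x₀).symm y))) μ) :
    inChart x₀ (formIntegral μ w) y = ∫ k, inChart x₀ (w k) y ∂μ :=
  pullback_formIntegral μ h

/-- The integral of a smooth family of forms with locally uniformly compact supports is smooth
in the remaining parameters. -/
theorem IsSmoothFamily.formIntegral [IsManifold 𝓘(ℝ, E) ∞ M] [IsFiniteMeasureOnCompacts μ]
    [FiniteDimensional ℝ EP] {J : ModelWithCorners ℝ EP HP} [J.Boundaryless] [IsManifold J ∞ P]
    {w : Q × P → RawForm E M q} (hw : IsSmoothFamily (𝓘(ℝ, F).prod J) w)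
    (hs : ∀ x : M, ∃ K : Set Q, IsCompact K ∧ ∀ᶠ y in 𝓝 x, ∀ k ∉ K, ∀ s, w (k, s) y = 0) :
    IsSmoothFamily J (fun s => HopfCyclic.formIntegral μ (fun k => w (k, s))) := by
  rintro x₀ ⟨s, y⟩ ⟨-, hy⟩
  refine ContMDiffAt.contMDiffWithinAt ?_
  have hT := (isOpen_univ.prod (isOpen_chartTarget x₀)).mem_nhds
    (⟨Set.mem_univ s, hy⟩ : (s, y) ∈ Set.univ ×ˢ (extChartAt 𝓘(ℝ, E) x₀).target)
  obtain ⟨K, hK, h⟩ := hs ((extChartAt 𝓘(ℝ, E) x₀).symm y)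
  have h1 : ∀ᶠ z : P × E in 𝓝 (s, y), ∀ k ∉ K, ∀ s,
      w (k, s) ((extChartAt 𝓘(ℝ, E) x₀).symm z.2) = 0 :=
    (ContinuousAt.comp (x := (s, y)) (f := Prod.snd)
      (contMDiffAt_chartSymm x₀ hy).self_of_nhds.continuousAt continuousAt_snd).eventually h
  have h2 : ContMDiffAt (J.prod 𝓘(ℝ, E)) 𝓘(ℝ, E [⋀^Fin q]→L[ℝ] ℝ) ∞
      (fun z : P × E => ∫ k, inChart x₀ (w (k, z.1)) z.2 ∂μ) (s, y) := by
    refine contMDiffAt_integral (F := F)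
      (Φ := fun k (z : P × E) => inChart x₀ (w (k, z.1)) z.2) hK ?_ ?_
    · filter_upwards [hT] with z hz k
      have h3 := (hw x₀).contMDiffAt (x := ((k, z.1), z.2))
        ((isOpen_univ.prod (isOpen_chartTarget x₀)).mem_nhds ⟨Set.mem_univ _, hz.2⟩)
      exact ContMDiffAt.comp (k, z) (g := fun z : (Q × P) × E => inChart x₀ (w z.1) z.2)
        (f := fun u : Q × (P × E) => ((u.1, u.2.1), u.2.2)) h3
        ((contMDiffAt_fst.prodMk (contMDiffAt_fst.comp _ contMDiffAt_snd)).prodMk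
          (contMDiffAt_snd.comp _ contMDiffAt_snd))
    · filter_upwards [h1] with z hz k hk
      have h4 := hz k hk z.1
      ext v
      exact DFunLike.congr_fun h4 _
  refine h2.congr_of_eventuallyEq ?_
  filter_upwards [h1] with z hz
  -- Moving the chart pull-back under the integral requires integrability: the integrand is
  -- continuous in `k` and vanishes off `K`.
  refine inChart_formIntegral μ _ x₀ z.2 ?_
  refine Continuous.integrable_of_hasCompactSupport ?_
    (HasCompactSupport.intro hK fun k hk => hz k hk z.1)
  exact (hw.continuous_apply _).comp (f := fun k => (k, z.1)) (by fun_prop)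

end FormIntegral

/-! ### The averaging contraction and exactness of the Hochschild columns -/

section Contraction

variable {F : Type*} [NormedAddCommGroup F] [NormedSpace ℝ F]
  {E : Type*} [NormedAddCommGroup E] [NormedSpace ℝ E] [FiniteDimensional ℝ E]
  {G : Type*} [TopologicalSpace G] [ChartedSpace F G] [Group G] [LieGroup 𝓘(ℝ, F) ∞ G]
  {M : Type*} [TopologicalSpace M] [ChartedSpace E M] [IsManifold 𝓘(ℝ, E) ∞ M]
  [MulAction G M] [ContMDiffSMul 𝓘(ℝ, F) 𝓘(ℝ, E) ∞ G M] {p q : ℕ}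

theorem contractNth_zero_cons (k : G) (g : Fin (p + 1) → G) :
    Fin.contractNth 0 (· * ·) (Fin.cons k g : Fin (p + 2) → G) =
      Fin.cons (k * g 0) (Fin.tail g) := by
  funext i
  cases i using Fin.cases with
  | zero => exact Fin.contractNth_apply_of_eq _ _ _ _ rfl
  | succ i => exact Fin.contractNth_apply_of_gt _ _ _ _ (by simp)

/-- With the preceding case this matches contractions of `(k⁻¹, g)` with cofaces: later contractions
leave `k⁻¹` alone, while the first one absorbs `g₁` into it and so corresponds to `δ₀`. -/
theorem contractNth_succ_cons (j : Fin (p + 1)) (k : G) (g : Fin (p + 1) → G) :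
    Fin.contractNth j.succ (· * ·) (Fin.cons k g : Fin (p + 2) → G) =
      Fin.cons k (Fin.contractNth j (· * ·) g) := by
  funext i
  cases i using Fin.cases with
  | zero => exact Fin.contractNth_apply_of_lt _ _ _ _ (by simp)
  | succ i => simp [Fin.contractNth, Fin.castSucc_succ]

theorem contMDiff_inv_cons {EP HP P : Type*} [NormedAddCommGroup EP] [NormedSpace ℝ EP]
    [TopologicalSpace HP] [TopologicalSpace P] [ChartedSpace HP P]
    {J : ModelWithCorners ℝ EP HP} {u : P → G} {v : P → Fin p → G}
    (hu : ContMDiff J 𝓘(ℝ, F) ∞ u) (hv : ContMDiff J (powModel F p) ∞ v) :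
    ContMDiff J (powModel F (p + 1)) ∞ fun s => (Fin.cons (u s)⁻¹ (v s) : Fin (p + 1) → G) := by
  refine contMDiff_pow_iff.2 fun i => ?_
  cases i using Fin.cases with
  | zero => exact hu.inv
  | succ i => exact contMDiff_pow_iff.1 hv i

/-- Smoothness of `s ↦ u(s)^* a(v(s))`. -/
theorem isSmoothFamily_act {EP HP P : Type*} [NormedAddCommGroup EP] [NormedSpace ℝ EP]
    [TopologicalSpace HP] [TopologicalSpace P] [ChartedSpace HP P]
    {J : ModelWithCorners ℝ EP HP} [J.Boundaryless] (a : Cochain F E G M p q) {u : P → G}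
    {v : P → Fin p → G} (hu : ContMDiff J 𝓘(ℝ, F) ∞ u) (hv : ContMDiff J (powModel F p) ∞ v) :
    IsSmoothFamily J fun s => act (u s) (a.1 (v s)) :=
  IsSmoothFamily.pullback a.2 hv (f := fun s x => (u s)⁻¹ • x) ((contMDiff_smul_inv F E M).comp
    (f := fun z : P × M => (u z.1, z.2)) ((hu.comp contMDiff_fst).prodMk contMDiff_snd))

/-- The Hochschild coboundary, evaluated at a point. -/
theorem b_apply_apply (a : Cochain F E G M p q) (g : Fin (p + 1) → G) (x : M) :
    ((hopfCocyclicModule F E G M).b (p := p) (q := q) a : Cochain F E G M (p + 1) q).1 g x =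
      ∑ i : Fin (p + 2), (-1 : ℝ) ^ (i : ℕ) • (coface i a : Cochain F E G M (p + 1) q).1 g x := by
  let ev : Cochain F E G M (p + 1) q →ₗ[ℝ] (TangentSpace 𝓘(ℝ, E) x [⋀^Fin q]→L[ℝ] ℝ) :=
    { toFun := fun a => a.1 g x
      map_add' := fun _ _ => rfl
      map_smul' := fun _ _ => rfl }
  have h := congrArg ev ((hopfCocyclicModule F E G M).b_apply (p := p) (q := q) a)
  refine h.trans ((map_sum ev _ _).trans ?_)
  rfl

/-- For a Hochschild cocycle `a`, the form `a(g)` is recovered from `k^* a` on the tuples obtained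
by contracting `(k⁻¹, g)`. -/
theorem sum_act_contractNth_of_b_eq_zero {a : Cochain F E G M (p + 1) q}
    (ha : (hopfCocyclicModule F E G M).b (p := p + 1) (q := q) a = 0) (k : G)
    (g : Fin (p + 1) → G) (x : M) :
    ∑ j : Fin (p + 2), (-1 : ℝ) ^ (j : ℕ) •
      act k (a.1 (Fin.contractNth j (· * ·) (Fin.cons k⁻¹ g : Fin (p + 2) → G))) x = a.1 g x := by
  have h1 : ∑ i : Fin (p + 3), (-1 : ℝ) ^ (i : ℕ) •
      (coface i a : Cochain F E G M (p + 2) q).1 (Fin.cons k⁻¹ g) = 0 := by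
    funext y
    have h := b_apply_apply a (Fin.cons k⁻¹ g) y
    rw [ha] at h
    rw [Finset.sum_apply]
    exact h.symm
  let ev : RawForm E M q →ₗ[ℝ] (TangentSpace 𝓘(ℝ, E) x [⋀^Fin q]→L[ℝ] ℝ) :=
    { toFun := fun w => act k w x
      map_add' := fun _ _ => rfl
      map_smul' := fun _ _ => rfl }
  have h2 := congrArg ev h1
  rw [map_sum, Fin.sum_univ_succ, map_zero] at h2
  -- On `(k⁻¹, g)` the zeroth coface is `(k⁻¹)^* a(g)`, and the translation by `k^*` built into `ev`
  -- undoes it.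
  have h3 : ev ((-1 : ℝ) ^ ((0 : Fin (p + 3)) : ℕ) •
      (coface 0 a : Cochain F E G M (p + 2) q).1 (Fin.cons k⁻¹ g)) = a.1 g x := by
    rw [coface_zero_apply, Fin.cons_zero, Fin.tail_cons, Fin.val_zero, pow_zero, one_smul]
    change act k (act k⁻¹ (a.1 g)) x = _
    rw [act_act F, mul_inv_cancel, act_one]
  rw [h3] at h2
  refine Eq.trans ?_ (eq_neg_of_add_eq_zero_left h2).symm
  rw [← Finset.sum_neg_distrib]
  refine Finset.sum_congr rfl fun j _ => ?_
  -- The coface of index `j + 1` contracts at position `j`; the sign from this shift cancels the one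
  -- from moving the terms across the equation.
  rw [map_smul, coface_succ_apply, Fin.val_succ, pow_succ]
  have h4 : ∀ (r : ℝ) (v : E [⋀^Fin q]→L[ℝ] ℝ), r • v = -((r * -1) • v) := fun r v => by module
  exact h4 _ _

variable [FiniteDimensional ℝ F] [T2Space G] [MeasurableSpace G] [BorelSpace G] (μ : Measure G)
  [IsFiniteMeasureOnCompacts μ]

/-- The average `(g₁, …, g_p) ↦ ∫ c(k⁻¹ x) k^* a(k⁻¹, g₁, …, g_p) dk`. -/
def contraction {c : M → ℝ} (hc : ContMDiff 𝓘(ℝ, E) 𝓘(ℝ) ∞ c) (hs : HasProperSupport G c)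
    (a : Cochain F E G M (p + 1) q) : Cochain F E G M p q :=
  ⟨fun g => formIntegral μ fun k x => c (k⁻¹ • x) • act k (a.1 (Fin.cons k⁻¹ g)) x, by
    refine IsSmoothFamily.formIntegral (F := F) μ
      (w := fun z x => c (z.1⁻¹ • x) • act z.1 (a.1 (Fin.cons z.1⁻¹ z.2)) x)
      (IsSmoothFamily.fun_smul (isSmoothFamily_act a contMDiff_fst
        (contMDiff_inv_cons contMDiff_fst contMDiff_snd)) ?_) fun x => ?_
    · exact (hc.comp (contMDiff_smul_inv F E M)).comp
        (f := fun z : (G × (Fin p → G)) × M => (z.1.1, z.2))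
        ((contMDiff_fst.comp contMDiff_fst).prodMk contMDiff_snd)
    · obtain ⟨K, hK, h⟩ := hs x
      refine ⟨K, hK, ?_⟩
      filter_upwards [h] with y hy k hk s
      rw [hy k hk, zero_smul]⟩

/-- The integrand is continuous in `k`, and the cut-off confines it to a compact set depending on
`x`. -/
theorem integrable_smul_act {c : M → ℝ} (hc : Continuous c) (hs : HasProperSupport G c)
    (a : Cochain F E G M p q) {v : G → Fin p → G} (hv : ContMDiff 𝓘(ℝ, F) (powModel F p) ∞ v)
    (x : M) : Integrable (fun k => (show E [⋀^Fin q]→L[ℝ] ℝ from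
      c (k⁻¹ • x) • act k (a.1 (v k)) x)) μ := by
  have := topologicalGroup_of_lieGroup 𝓘(ℝ, F) ∞ (G := G)
  obtain ⟨K, hK, h⟩ := hs x
  refine Continuous.integrable_of_hasCompactSupport ?_
    (HasCompactSupport.intro hK fun k hk => ?_)
  · have h1 : Continuous fun k : G => k⁻¹ • x :=
      (contMDiff_smul_inv F E M).continuous.comp (f := fun k : G => (k, x)) (by fun_prop)
    exact (hc.comp h1).smul
      ((isSmoothFamily_act a (J := 𝓘(ℝ, F)) contMDiff_id hv).continuous_apply x)
  · dsimp only
    rw [h.self_of_nhds k hk]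
    exact zero_smul ℝ _

/-- The cofaces of a contraction. -/
theorem coface_contraction [μ.IsMulLeftInvariant] {c : M → ℝ}
    (hc : ContMDiff 𝓘(ℝ, E) 𝓘(ℝ) ∞ c)
    (hs : HasProperSupport G c) (a : Cochain F E G M (p + 1) q) (j : Fin (p + 2))
    (g : Fin (p + 1) → G) :
    (coface j (contraction μ hc hs a)).1 g = formIntegral μ fun k x =>
      c (k⁻¹ • x) • act k (a.1 (Fin.contractNth j (· * ·) (Fin.cons k⁻¹ g : Fin (p + 2) → G))) x := by
  have := topologicalGroup_of_lieGroup 𝓘(ℝ, F) ∞ (G := G)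
  cases j using Fin.cases with
  | succ j =>
    rw [coface_succ_apply]
    simp only [contractNth_succ_cons]
    rfl
  -- Only this coface translates the point, so `g₁^*` must pass under the integral and change both
  -- the argument of `c` and the form.
  | zero =>
    rw [coface_zero_apply]
    simp only [contractNth_zero_cons]
    funext x
    have h1 := pullback_formIntegral μ (f := fun x : M => (g 0)⁻¹ • x) (x := x)
      (w := fun k x => c (k⁻¹ • x) • act k (a.1 (Fin.cons k⁻¹ (Fin.tail g))) x)
      (integrable_smul_act μ hc.continuous hs a
        (contMDiff_inv_cons contMDiff_id (contMDiff_const (c := Fin.tail g))) ((g 0)⁻¹ • x))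
    refine h1.trans ?_
    let R : G → E [⋀^Fin q]→L[ℝ] ℝ := fun k =>
      c (k⁻¹ • x) • act k (a.1 (Fin.cons (k⁻¹ * g 0) (Fin.tail g))) x
    -- Left invariance, with `g₁ k` in place of `k`: `(g₁ k)^* = g₁^* k^*` and `(g₁ k)⁻¹ g₁ = k⁻¹`.
    refine Eq.trans ?_ (integral_mul_left_eq_self (μ := μ) R (g 0))
    refine congrArg (fun f : G → E [⋀^Fin q]→L[ℝ] ℝ => ∫ k, f k ∂μ)
      (a₁ := fun k => pullback (fun x : M => (g 0)⁻¹ • x)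
        (fun x => c (k⁻¹ • x) • act k (a.1 (Fin.cons k⁻¹ (Fin.tail g))) x) x)
      (a₂ := fun k => R (g 0 * k)) (funext fun k => ?_)
    have h2 : act (g 0 * k) (a.1 (Fin.cons ((g 0 * k)⁻¹ * g 0) (Fin.tail g))) =
        act (g 0) (act k (a.1 (Fin.cons k⁻¹ (Fin.tail g)))) := by
      rw [act_act F, mul_inv_rev, inv_mul_cancel_right]
    have h3 : (g 0 * k)⁻¹ • x = k⁻¹ • (g 0)⁻¹ • x := by rw [mul_inv_rev, mul_smul]
    dsimp only [R]
    rw [h2, h3]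
    rfl

/-- The contraction of a Hochschild cocycle of positive degree is a primitive. -/
theorem b_contraction [μ.IsMulLeftInvariant] {c : M → ℝ} (hc : ContMDiff 𝓘(ℝ, E) 𝓘(ℝ) ∞ c)
    (hs : HasProperSupport G c) (hc1 : ∀ x, ∫ k : G, c (k⁻¹ • x) ∂μ = 1)
    {a : Cochain F E G M (p + 1) q}
    (ha : (hopfCocyclicModule F E G M).b (p := p + 1) (q := q) a = 0) :
    (hopfCocyclicModule F E G M).b (p := p) (q := q) (contraction μ hc hs a) = a := by
  have := finiteDimensional_alternating (E := E) q
  have : CompleteSpace (E [⋀^Fin q]→L[ℝ] ℝ) := FiniteDimensional.complete ℝ _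
  refine Subtype.ext (funext fun g => funext fun x => ?_)
  refine (b_apply_apply _ g x).trans ?_
  simp only [coface_contraction]
  let R : Fin (p + 2) → G → E [⋀^Fin q]→L[ℝ] ℝ := fun j k =>
    act k (a.1 (Fin.contractNth j (· * ·) (Fin.cons k⁻¹ g : Fin (p + 2) → G))) x
  have hR : ∀ k, ∑ j : Fin (p + 2), (-1 : ℝ) ^ (j : ℕ) • R j k =
      (show E [⋀^Fin q]→L[ℝ] ℝ from a.1 g x) := fun k =>
    sum_act_contractNth_of_b_eq_zero ha k g x
  have hint : ∀ j, Integrable (fun k => c (k⁻¹ • x) • R j k) μ := fun j =>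
    integrable_smul_act μ hc.continuous hs a ((contMDiff_contractNth j).comp
      (contMDiff_inv_cons contMDiff_id (contMDiff_const (c := g)))) x
  -- The weight `c(k⁻¹x)` does not depend on `j`, and the alternating sum of the remaining factors
  -- does not depend on `k`. The average is therefore that sum times the total mass one.
  have h1 : ∀ A : E [⋀^Fin q]→L[ℝ] ℝ, (∀ k, ∑ j : Fin (p + 2), (-1 : ℝ) ^ (j : ℕ) • R j k = A) →
      ∑ j : Fin (p + 2), (-1 : ℝ) ^ (j : ℕ) • ∫ k, c (k⁻¹ • x) • R j k ∂μ = A := by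
    intro A hA
    simp only [← integral_smul]
    rw [← integral_finsetSum _ fun j _ => (hint j).fun_smul _]
    simp only [smul_comm _ (c _), ← Finset.smul_sum, hA]
    rw [integral_smul_const, hc1, one_smul]
  exact h1 _ hR

end Contraction

/-- For proper actions the Hochschild complex is exact in positive degrees. -/
theorem exists_b_eq_of_b_eq_zero {F : Type*} [NormedAddCommGroup F] [NormedSpace ℝ F]
    [FiniteDimensional ℝ F] {E : Type*} [NormedAddCommGroup E] [NormedSpace ℝ E]
    [FiniteDimensional ℝ E] {G : Type*} [TopologicalSpace G] [ChartedSpace F G] [Group G]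
    [LieGroup 𝓘(ℝ, F) ∞ G] {M : Type*} [TopologicalSpace M] [ChartedSpace E M]
    [IsManifold 𝓘(ℝ, E) ∞ M] [T2Space M] [SecondCountableTopology M] [MulAction G M]
    [ContMDiffSMul 𝓘(ℝ, F) 𝓘(ℝ, E) ∞ G M] [ProperSMul G M] {p q : ℕ}
    {a : (hopfCocyclicModule F E G M).X (p + 1) q} (ha : (hopfCocyclicModule F E G M).b a = 0) :
    ∃ y : (hopfCocyclicModule F E G M).X p q, (hopfCocyclicModule F E G M).b y = a := by
  have := topologicalGroup_of_lieGroup 𝓘(ℝ, F) ∞ (G := G)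
  have := Manifold.locallyCompact_of_finiteDimensional (M := G) 𝓘(ℝ, F)
  -- Charts make `G` a `T1` space, and a `T1` topological group is Hausdorff, so no separation
  -- hypothesis on `G` is needed. Finite dimension of `F` gives the local compactness required for
  -- Haar measure.
  have := ChartedSpace.t1Space F G
  borelize G
  obtain ⟨c, hc, hs, hc1⟩ := exists_cutoff F E M (Measure.haar (G := G))
  exact ⟨contraction Measure.haar hc hs a, b_contraction Measure.haar hc hs hc1 ha⟩

/-! ### Comparison of cohomologies -/

section Graded

variable {T T' : Type*} [AddCommGroup T] [Module ℝ T] [AddCommGroup T'] [Module ℝ T']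
  {D : T →ₗ[ℝ] T} {D' : T' →ₗ[ℝ] T'} {Γ : ℤ → Submodule ℝ T} {Γ' : ℤ → Submodule ℝ T'}

/-- The class of a cocycle. -/
def gradedClass (D : T →ₗ[ℝ] T) (Γ : ℤ → Submodule ℝ T) (n : ℤ) :
    (Γ n ⊓ LinearMap.ker D : Submodule ℝ T) →ₗ[ℝ] gradedCohomology D Γ n :=
  Submodule.mkQ _

theorem gradedClass_surjective (n : ℤ) : Function.Surjective (gradedClass D Γ n) :=
  Submodule.mkQ_surjective _

theorem gradedClass_eq_zero {n : ℤ} {x : (Γ n ⊓ LinearMap.ker D : Submodule ℝ T)} :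
    gradedClass D Γ n x = 0 ↔ ∃ y ∈ Γ (n - 1), D y = x :=
  Submodule.Quotient.mk_eq_zero _

/-- A map of complexes induces an isomorphism from a direct sum of cohomology spaces of the first
complex, split by the projections `π`, if cocycles of the second one are cohomologous to images of
cocycles, and images of elements are coboundaries only if the elements are. -/
theorem bijective_toModule_gradedCohomologyMap (f : T →ₗ[ℝ] T') (hf : ∀ x, D' (f x) = f (D x))
    {ι : Type*} [DecidableEq ι] {m : ι → ℤ} (hm : Function.Injective m) {n : ℤ}
    (h : ∀ k, ∀ x ∈ Γ (m k), f x ∈ Γ' n) (h' : ∀ k, ∀ x ∈ Γ (m k - 1), f x ∈ Γ' (n - 1))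
    (π : ℤ → T →ₗ[ℝ] T) (hπ : ∀ a x, π a x ∈ Γ a) (hπ_self : ∀ {a x}, x ∈ Γ a → π a x = x)
    (hπ_ne : ∀ {a b x}, x ∈ Γ b → a ≠ b → π a x = 0) (hπD : ∀ a x, π a (D x) = D (π (a - 1) x))
    (hinj : ∀ w, ∀ x ∈ Γ' (n - 1), D' x = f w → ∃ v, D v = w)
    (hsurj : ∀ x ∈ Γ' n, D' x = 0 → ∃ y ∈ Γ' (n - 1), ∃ s : Finset ι, ∃ w, D w = 0 ∧
      x - D' y = f w ∧ w = ∑ k ∈ s, π (m k) w) :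
    Function.Bijective (DirectSum.toModule ℝ ι (gradedCohomology D' Γ' n) fun k =>
      gradedCohomologyMap (n := n) f hf (h k) (h' k)) := by
  have hφ : ∀ k (w : (Γ (m k) ⊓ LinearMap.ker D : Submodule ℝ T)),
      ∃ hw, gradedCohomologyMap (n := n) f hf (h k) (h' k) (gradedClass D Γ (m k) w) =
        gradedClass D' Γ' n ⟨f w, hw⟩ := fun k w => ⟨_, rfl⟩
  choose hfw hφ using hφ
  classical
  constructor
  · refine (injective_iff_map_eq_zero _).2 fun z hz => ?_
    choose w hw using fun k => gradedClass_surjective (D := D) (Γ := Γ) (m k) (z k)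
    have hz' : z = ∑ k ∈ DFinsupp.support z, DirectSum.lof ℝ ι
        (fun k => gradedCohomology D Γ (m k)) k (gradedClass D Γ (m k) (w k)) := by
      conv_lhs => rw [← DirectSum.sum_support_of z]
      exact Finset.sum_congr rfl fun k _ => by rw [hw]; rfl
    have h1 : gradedClass D' Γ' n (∑ k ∈ DFinsupp.support z, ⟨f (w k), hfw k (w k)⟩) = 0 := by
      refine Eq.trans ?_ hz
      conv_rhs => rw [hz']
      rw [map_sum, map_sum]
      refine Finset.sum_congr rfl fun k _ => ?_
      rw [DirectSum.toModule_lof, hφ]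
    obtain ⟨x, hx, hDx⟩ := gradedClass_eq_zero.1 h1
    obtain ⟨v, hv⟩ := hinj (∑ k ∈ DFinsupp.support z, (w k : T)) x hx (by
      rw [hDx, map_sum, Submodule.coe_sum])
    refine DFinsupp.ext fun k => ?_
    by_cases hk : k ∈ DFinsupp.support z
    · rw [← hw k]
      -- The primitive `v` of the sum of the representatives need not be homogeneous. Its part of
      -- degree `m k - 1` is a primitive of the `k`-th representative, since distinct indices have
      -- distinct degrees.
      refine gradedClass_eq_zero.2 ⟨π (m k - 1) v, hπ _ _, ?_⟩
      rw [← hπD, hv, map_sum, Finset.sum_eq_single k]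
      · exact hπ_self (w k).2.1
      · exact fun l _ hl => hπ_ne (w l).2.1 fun hkl => hl (hm hkl.symm)
      · exact fun hk' => (hk' hk).elim
    · exact DFinsupp.notMem_support_iff.1 hk
  · intro z
    obtain ⟨⟨x, hx, hDx⟩, rfl⟩ := gradedClass_surjective n z
    obtain ⟨y, hy, s, w, hDw, hxy, hw⟩ := hsurj x hx hDx
    have hmem : ∀ k, π (m k) w ∈ Γ (m k) ⊓ LinearMap.ker D := by
      refine fun k => ⟨hπ _ _, ?_⟩
      have h1 := hπD (m k + 1) w
      rw [hDw, map_zero, add_sub_cancel_right] at h1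
      exact h1.symm
    refine ⟨∑ k ∈ s, DirectSum.lof ℝ ι (fun k => gradedCohomology D Γ (m k)) k
      (gradedClass D Γ (m k) ⟨π (m k) w, hmem k⟩), ?_⟩
    rw [map_sum]
    simp only [DirectSum.toModule_lof, hφ]
    rw [← map_sum, ← sub_eq_zero, ← map_sub, gradedClass_eq_zero]
    -- The difference in question is the image of `w` minus `x`, hence the sign.
    refine ⟨-y, neg_mem hy, ?_⟩
    rw [Submodule.coe_sub, Submodule.coe_sum, ← map_sum, ← hw, ← hxy, map_neg]
    abel

end Graded

/-! ### Descent along the filtration by cosimplicial degree -/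

namespace DGCocyclicModule

universe u

variable {C : DGCocyclicModule.{u}}

theorem incl_apply_self (p q : ℕ) (v : C.X p q) : C.incl p q v (p, q) = v :=
  DirectSum.of_eq_same _ _

theorem incl_apply_of_ne {p q p' q' : ℕ} (h : (p, q) ≠ (p', q')) (v : C.X p q) :
    C.incl p q v (p', q') = 0 :=
  DirectSum.of_eq_of_ne _ _ _ h.symm

theorem sum_incl_apply (p : ℕ) (Q : Finset ℕ) (v : ∀ q, C.X p q) (q : ℕ) :
    (∑ q ∈ Q, C.incl p q (v q)) (p, q) = if q ∈ Q then v q else 0 := by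
  rw [DFinsupp.finsetSum_apply]
  split_ifs with h
  · rw [Finset.sum_eq_single q]
    · exact incl_apply_self p q _
    · exact fun q' _ hq' => incl_apply_of_ne (by simpa using hq') _
    · exact fun h' => (h' h).elim
  · refine Finset.sum_eq_zero fun q' hq' => incl_apply_of_ne ?_ _
    rintro ⟨⟩
    exact h hq'

variable (C) in
/-- The elements with components of cosimplicial degree less than `N`. -/
def filtration (N : ℕ) : Submodule ℝ C.Total where
  carrier := {x | ∀ p q, N ≤ p → x (p, q) = 0}
  add_mem' {x y} hx hy p q h := by rw [DirectSum.add_apply, hx p q h, hy p q h, add_zero]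
  zero_mem' _ _ _ := rfl
  smul_mem' r x hx p q h := by rw [DirectSum.smul_apply, hx p q h, smul_zero]

variable (C) in
/-- The elements with components of total degree in `A`. -/
def supported (A : Set ℤ) : Submodule ℝ C.Total where
  carrier := {x | ∀ p q : ℕ, x (p, q) ≠ 0 → (p : ℤ) + q ∈ A}
  add_mem' {x y} hx hy p q h := by
    by_cases hxp : x (p, q) = 0
    · refine hy p q fun h' => h ?_
      rw [DirectSum.add_apply, hxp, h', add_zero]
    · exact hx p q hxp
  zero_mem' _ _ h := (h rfl).elim
  smul_mem' r x hx p q h := hx p q fun h' => h (by rw [DirectSum.smul_apply, h', smul_zero])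

theorem filtration_mono {N N' : ℕ} (h : N ≤ N') : C.filtration N ≤ C.filtration N' :=
  fun _ hx p q hp => hx p q (h.trans hp)

theorem incl_mem_filtration {N p q : ℕ} (h : p < N) (v : C.X p q) :
    C.incl p q v ∈ C.filtration N := fun p' q' hp =>
  incl_apply_of_ne (fun he => by have := congrArg Prod.fst he; simp only at this; omega) v

theorem incl_mem_supported {A : Set ℤ} {p q : ℕ} {v : C.X p q} (h : v ≠ 0 → (p : ℤ) + q ∈ A) :
    C.incl p q v ∈ C.supported A := by
  intro p' q' h'
  by_cases he : (p, q) = (p', q')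
  · cases he
    exact h fun h0 => h' (by rw [h0, map_zero]; rfl)
  · exact (h' (incl_apply_of_ne he v)).elim

/-- Finite support of elements of a direct sum. This is what makes the descent terminate, also for
periodic cochains, whose cosimplicial degrees are not bounded by the total degree. -/
theorem exists_mem_filtration (x : C.Total) : ∃ N, x ∈ C.filtration (N + 1) := by
  classical
  refine ⟨(DFinsupp.support x).sup Prod.fst, fun p q hp => ?_⟩
  by_contra h
  have := Finset.le_sup (f := Prod.fst) (DFinsupp.mem_support_iff.2 h)
  simp only at this
  omega

/-- The components of top cosimplicial degree. -/
theorem exists_sub_sum_incl_mem_filtration {N : ℕ} {x : C.Total}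
    (hx : x ∈ C.filtration (N + 1)) :
    ∃ Q : Finset ℕ, (∀ q ∉ Q, x (N, q) = 0) ∧
      x - ∑ q ∈ Q, C.incl N q (x (N, q)) ∈ C.filtration N := by
  classical
  have hQ : ∀ q ∉ (DFinsupp.support x).image Prod.snd, x (N, q) = 0 := by
    intro q hq
    by_contra h
    exact hq (Finset.mem_image.2 ⟨(N, q), DFinsupp.mem_support_iff.2 h, rfl⟩)
  refine ⟨(DFinsupp.support x).image Prod.snd, hQ, fun p q hp => ?_⟩
  rw [DirectSum.sub_apply]
  rcases hp.eq_or_lt with rfl | hp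
  · rw [sum_incl_apply]
    split_ifs with h
    · exact sub_self _
    · rw [hQ q h, sub_zero]
  · rw [hx p q hp, (C.filtration (N + 1)).sum_mem (fun q _ =>
      incl_mem_filtration (Nat.lt_succ_self N) _) p q hp, sub_zero]

/-- The leading part of the total differential is `b`: the internal differential preserves the
cosimplicial degree and Connes' operator lowers it. -/
theorem totalD_incl_sub_mem_filtration {p q : ℕ} (v : C.X p q) :
    C.totalD (C.incl p q v) - C.incl (p + 1) q (C.b v) ∈ C.filtration (p + 1) := by
  cases p with
  | zero =>
    rw [totalD_incl_zero, add_sub_cancel_left]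
    exact incl_mem_filtration (Nat.lt_succ_self 0) _
  | succ p =>
    rw [totalD_incl_succ]
    have h : ∀ {u v w : C.Total} {S : Submodule ℝ C.Total}, v + w ∈ S → u + v + w - u ∈ S :=
      fun h => by rwa [add_assoc, add_sub_cancel_left]
    refine h ?_
    exact add_mem (Submodule.smul_mem _ _ (incl_mem_filtration (Nat.lt_succ_self _) _))
      (incl_mem_filtration (by omega) _)

theorem totalD_mem_filtration {N : ℕ} {x : C.Total} (hx : x ∈ C.filtration N) :
    C.totalD x ∈ C.filtration (N + 1) := by
  refine map_mem_of_components fun p q h => ?_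
  have hp : p < N := by
    by_contra h'
    exact h (hx p q (not_lt.1 h'))
  rw [← sub_add_cancel (C.totalD (C.incl p q (x (p, q)))) (C.incl (p + 1) q (C.b (x (p, q))))]
  exact add_mem (filtration_mono (by omega) (totalD_incl_sub_mem_filtration _))
    (incl_mem_filtration (by omega) _)

/-- From total degree `m`, both `b` and `d` lead to `m + 1`, while Connes' operator leads to `m - 1
= (m + 1) - 2`; this is where stability of `A` is needed. -/
theorem totalD_mem_supported {A : Set ℤ} (hA : ∀ m ∈ A, m - 2 ∈ A) {x : C.Total}
    (hx : x ∈ C.supported {m | m + 1 ∈ A}) : C.totalD x ∈ C.supported A := by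
  refine map_mem_of_components fun p q h => ?_
  have h1 : (p : ℤ) + q + 1 ∈ A := hx p q h
  have h2 := hA _ h1
  cases p with
  | zero =>
    rw [totalD_incl_zero]
    refine add_mem (incl_mem_supported fun _ => ?_) (incl_mem_supported fun _ => ?_)
    · convert h1 using 1; push_cast; ring
    · convert h1 using 1; push_cast; ring
  | succ p =>
    rw [totalD_incl_succ]
    refine add_mem (add_mem (incl_mem_supported fun _ => ?_)
      (Submodule.smul_mem _ _ (incl_mem_supported fun _ => ?_))) (incl_mem_supported fun _ => ?_)
    · convert h1 using 1; push_cast; ring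
    · convert h1 using 1; push_cast; ring
    · convert h2 using 1; push_cast; ring

/-- The top component is a Hochschild cocycle if the coboundary has no component of higher
cosimplicial degree. -/
theorem b_apply_eq_zero_of_totalD_mem {N : ℕ} {x : C.Total} (hx : x ∈ C.filtration (N + 1))
    (hD : C.totalD x ∈ C.filtration (N + 1)) (q : ℕ) : C.b (x (N, q)) = 0 := by
  obtain ⟨Q, hQ, h⟩ := exists_sub_sum_incl_mem_filtration hx
  -- This sum is the whole part of cosimplicial degree `N + 1` of the coboundary, since the lower
  -- components of `x` do not reach that degree. Lying in the filtration forces it to vanish.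
  have h1 : ∑ q ∈ Q, C.incl (N + 1) q (C.b (x (N, q))) ∈ C.filtration (N + 1) := by
    have h2 := totalD_mem_filtration h
    rw [map_sub, map_sum] at h2
    have h3 := (C.filtration (N + 1)).sum_mem (t := Q) fun q _ =>
      totalD_incl_sub_mem_filtration (x (N, q))
    rw [Finset.sum_sub_distrib] at h3
    convert sub_mem (sub_mem hD h2) h3 using 1
    abel
  by_cases hq : q ∈ Q
  · have h2 := h1 (N + 1) q le_rfl
    rwa [sum_incl_apply (N + 1) Q (fun q => C.b (x (N, q))), if_pos hq] at h2
  · rw [hQ q hq, map_zero]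

/-- If the Hochschild complexes are exact in positive degrees, then an element whose coboundary has
cosimplicial degree zero is cohomologous to one of cosimplicial degree zero. -/
theorem exists_sub_totalD_mem_filtration
    (hC : ∀ {p q : ℕ} (a : C.X (p + 1) q), C.b a = 0 → ∃ y : C.X p q, C.b y = a)
    {A : Set ℤ} (hA : ∀ m ∈ A, m - 2 ∈ A) {N : ℕ} {x : C.Total} (hx : x ∈ C.filtration (N + 1))
    (hxA : x ∈ C.supported A) (hD : C.totalD x ∈ C.filtration 1) :
    ∃ y ∈ C.supported {m | m + 1 ∈ A}, x - C.totalD y ∈ C.filtration 1 ⊓ C.supported A := by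
  induction N generalizing x with
  | zero => exact ⟨0, zero_mem _, by rw [map_zero, sub_zero]; exact ⟨hx, hxA⟩⟩
  | succ N ih =>
    have hb := b_apply_eq_zero_of_totalD_mem hx (filtration_mono (by omega) hD)
    obtain ⟨Q, hQ, h⟩ := exists_sub_sum_incl_mem_filtration hx
    -- Over a zero component the primitive is chosen to be zero, so that no total degrees appear
    -- outside those allowed by `A`.
    have hex : ∀ q, ∃ y : C.X N q, C.b y = x (N + 1, q) ∧ (y ≠ 0 → x (N + 1, q) ≠ 0) := by
      intro q
      by_cases h0 : x (N + 1, q) = 0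
      · exact ⟨0, by rw [map_zero, h0], fun h => (h rfl).elim⟩
      · obtain ⟨y, hy⟩ := hC _ (hb q)
        exact ⟨y, hy, fun _ => h0⟩
    choose y hy hy0 using hex
    set Y := ∑ q ∈ Q, C.incl N q (y q) with hY
    have hYA : Y ∈ C.supported {m | m + 1 ∈ A} := by
      refine Submodule.sum_mem _ fun q _ => incl_mem_supported fun h => ?_
      have := hxA _ _ (hy0 q h)
      rw [Set.mem_ofPred_eq]
      convert this using 1
      push_cast; ring
    -- The leading part of the coboundary of `Y` is the sum of the `b y`, which cancels the top
    -- components of `x`.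
    have hx' : x - C.totalD Y ∈ C.filtration (N + 1) := by
      have h3 := (C.filtration (N + 1)).sum_mem (t := Q) fun q _ =>
        totalD_incl_sub_mem_filtration (y q)
      rw [Finset.sum_sub_distrib, ← map_sum] at h3
      simp only [hy] at h3
      convert sub_mem h h3 using 1
      rw [hY]
      abel
    obtain ⟨y', hy', h'⟩ := ih hx' (sub_mem hxA (totalD_mem_supported hA hYA)) (by
      rwa [map_sub, totalD_totalD, sub_zero])
    refine ⟨Y + y', add_mem hYA hy', ?_⟩
    rwa [map_add, ← sub_sub]

end DGCocyclicModule

open DGCocyclicModule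

/-! ### Invariant forms and the cyclic cohomology of proper actions -/

section Invariant

variable (E : Type*) [NormedAddCommGroup E] [NormedSpace ℝ E]
  (G : Type*) [Group G]
  (M : Type*) [TopologicalSpace M] [ChartedSpace E M] [MulAction G M]

theorem invForm_lof_apply_of_ne {q q' : ℕ} (h : q ≠ q') (w : InvForm E G M q) :
    DirectSum.lof ℝ ℕ (fun q => InvForm E G M q) q w q' = 0 :=
  DirectSum.of_eq_of_ne _ _ _ h.symm

theorem invForm_lof_mem (q : ℕ) (w : InvForm E G M q) :
    DirectSum.lof ℝ ℕ (fun q => InvForm E G M q) q w ∈ invFormsOfDegree E G M q := by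
  intro q' h
  by_contra h'
  exact h (invForm_lof_apply_of_ne E G M (fun h'' => h' (by rw [h''])) w)

/-- The projection of `Ω^*(M)^G` onto its part of degree `a`. -/
def invProj : ℤ → InvForms E G M →ₗ[ℝ] InvForms E G M
  | Int.ofNat q => DirectSum.lof ℝ ℕ (fun q => InvForm E G M q) q ∘ₗ
      DirectSum.component ℝ ℕ (fun q => InvForm E G M q) q
  | Int.negSucc _ => 0

theorem invProj_natCast (q : ℕ) (x : InvForms E G M) :
    invProj E G M q x = DirectSum.lof ℝ ℕ (fun q => InvForm E G M q) q (x q) := rfl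

theorem invProj_mem (a : ℤ) (x : InvForms E G M) :
    invProj E G M a x ∈ invFormsOfDegree E G M a := by
  cases a with
  | ofNat q => exact invForm_lof_mem E G M q _
  | negSucc q => exact zero_mem _

theorem invProj_self {a : ℤ} {x : InvForms E G M} (hx : x ∈ invFormsOfDegree E G M a) :
    invProj E G M a x = x := by
  refine DFinsupp.ext fun q => ?_
  by_cases hq : (q : ℤ) = a
  · subst hq
    exact DirectSum.of_eq_same _ _
  · have h0 : x q = 0 := by
      by_contra h
      exact hq (hx q h)
    rw [h0]
    by_contra h
    exact hq (invProj_mem E G M a x q h)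

theorem invProj_ne {a b : ℤ} {x : InvForms E G M} (hx : x ∈ invFormsOfDegree E G M b)
    (h : a ≠ b) : invProj E G M a x = 0 := by
  cases a with
  | ofNat q =>
    have h0 : x q = 0 := by
      by_contra h'
      exact h (hx q h')
    exact (congrArg (DirectSum.lof ℝ ℕ (fun q => InvForm E G M q) q) h0).trans (map_zero _)
  | negSucc q => rfl

/-- The homogeneous decomposition, reindexed by choosing for each degree `q` in the support an index
`k` with `m k = q`; distinct degrees necessarily get distinct indices. -/
theorem exists_eq_sum_invProj {ι : Type*} [DecidableEq ι] {m : ι → ℤ} {x : InvForms E G M}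
    (hx : ∀ q : ℕ, x q ≠ 0 → (q : ℤ) ∈ Set.range m) :
    ∃ s : Finset ι, x = ∑ k ∈ s, invProj E G M (m k) x := by
  classical
  choose k hk using fun q : DFinsupp.support x =>
    hx q (DFinsupp.mem_support_iff.1 q.2)
  refine ⟨Finset.univ.image k, ?_⟩
  rw [Finset.sum_image fun q _ q' _ h => Subtype.ext (by
    have := congrArg m h
    rw [hk, hk] at this
    exact_mod_cast this)]
  simp only [hk, invProj_natCast]
  conv_lhs => rw [← DirectSum.sum_support_of x]
  exact (Finset.sum_coe_sort (DFinsupp.support x) fun q =>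
    DirectSum.lof ℝ ℕ (fun q => InvForm E G M q) q (x q)).symm

variable (F : Type*) [NormedAddCommGroup F] [NormedSpace ℝ F]
  [TopologicalSpace G] [ChartedSpace F G] [LieGroup 𝓘(ℝ, F) ∞ G]
  [IsManifold 𝓘(ℝ, E) ∞ M] [ContMDiffSMul 𝓘(ℝ, F) 𝓘(ℝ, E) ∞ G M]

theorem invProj_invD (a : ℤ) (x : InvForms E G M) :
    invProj E G M a (invD E G M F x) = invD E G M F (invProj E G M (a - 1) x) := by
  suffices h : invProj E G M a ∘ₗ invD E G M F = invD E G M F ∘ₗ invProj E G M (a - 1) from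
    LinearMap.congr_fun h x
  refine DirectSum.linearMap_ext ℝ fun q => LinearMap.ext fun w => ?_
  simp only [LinearMap.comp_apply]
  have h1 := invForm_lof_mem E G M q w
  have h2 := invD_mem E G M F h1
  by_cases h : a = q + 1
  · subst h
    rw [invProj_self E G M h2, add_sub_cancel_right, invProj_self E G M h1]
  · rw [invProj_ne E G M h2 h, invProj_ne E G M h1 (fun h' => h (by omega)), map_zero]

variable [FiniteDimensional ℝ E]

theorem invInclComponent_injective (q : ℕ) :
    Function.Injective (invInclComponent E G M F q) := by
  intro w w' h
  exact Subtype.ext (congrFun (congrArg (fun c : Cochain F E G M 0 q => c.1) h) Fin.elim0)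

/-- A cochain of degree zero is a Hochschild cocycle only if it is an invariant form. -/
theorem exists_invInclComponent_eq {q : ℕ} {a : (hopfCocyclicModule F E G M).X 0 q}
    (ha : (hopfCocyclicModule F E G M).b a = 0) : ∃ w, invInclComponent E G M F q w = a := by
  have key : ∀ (c : Cochain F E G M 0 q), (hopfCocyclicModule F E G M).b (p := 0) (q := q) c = 0 →
      ∃ w, invInclComponent E G M F q w = c := by
    intro c hc
    have hg : ∀ g : Fin 0 → G, c.1 g = c.1 Fin.elim0 := fun g =>
      congrArg c.1 (Subsingleton.elim _ _)
    refine ⟨⟨c.1 Fin.elim0, IsSmoothFamily.form c.2 _, fun g => ?_⟩,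
      Subtype.ext (funext fun g => (hg g).symm)⟩
    funext x
    have h := b_apply_apply c (fun _ => g) x
    rw [hc, Fin.sum_univ_two] at h
    have h1 : (coface 1 c : Cochain F E G M 1 q).1 (fun _ => g) = c.1 Fin.elim0 :=
      (coface_succ_apply 0 c _).trans (hg _)
    have h0 : (coface 0 c : Cochain F E G M 1 q).1 (fun _ => g) = act g (c.1 Fin.elim0) :=
      (coface_zero_apply c _).trans (congrArg (act g) (hg _))
    rw [h1, h0] at h
    have h2 : ∀ u v : E [⋀^Fin q]→L[ℝ] ℝ, 0 = (-1 : ℝ) ^ 0 • u + (-1 : ℝ) ^ 1 • v → u = v := by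
      intro u v h
      refine sub_eq_zero.1 (Eq.trans ?_ h.symm)
      module
    exact h2 _ _ h
  exact key a ha

theorem invIncl_mem_filtration (w : InvForms E G M) :
    invIncl E G M F w ∈ (hopfCocyclicModule F E G M).filtration 1 :=
  invIncl_mem E G M F fun _ _ => incl_mem_filtration Nat.zero_lt_one _

theorem invIncl_apply_zero (w : InvForms E G M) (q : ℕ) :
    invIncl E G M F w (0, q) = invInclComponent E G M F q (w q) := by
  suffices h : DirectSum.component ℝ (ℕ × ℕ)
      (fun pq => (hopfCocyclicModule F E G M).X pq.1 pq.2) (0, q) ∘ₗ invIncl E G M F =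
      invInclComponent E G M F q ∘ₗ DirectSum.component ℝ ℕ (fun q => InvForm E G M q) q from
    LinearMap.congr_fun h w
  refine DirectSum.linearMap_ext ℝ fun q' => LinearMap.ext fun w => ?_
  simp only [LinearMap.comp_apply]
  rw [invIncl_lof]
  by_cases h : q' = q
  · subst h
    refine (incl_apply_self 0 q' _).trans ?_
    exact congrArg _ (DirectSum.of_eq_same _ _).symm
  · refine (incl_apply_of_ne (by simpa using h) _).trans ?_
    refine ((congrArg _ (invForm_lof_apply_of_ne E G M h w)).trans (map_zero _)).symm

theorem invIncl_injective : Function.Injective (invIncl E G M F) := by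
  intro w w' h
  refine DFinsupp.ext fun q => invInclComponent_injective E G M F q ?_
  rw [← invIncl_apply_zero, ← invIncl_apply_zero, h]

/-- A coboundary without part in cosimplicial degree one means that each component of `x` is a
`b`-cocycle of degree zero, that is, an invariant form. -/
theorem exists_invIncl_eq {x : (hopfCocyclicModule F E G M).Total}
    (hx : x ∈ (hopfCocyclicModule F E G M).filtration 1)
    (hD : (hopfCocyclicModule F E G M).totalD x ∈ (hopfCocyclicModule F E G M).filtration 1) :
    ∃ w, invIncl E G M F w = x := by
  choose w hw using fun q =>
    exists_invInclComponent_eq E G M F (b_apply_eq_zero_of_totalD_mem (N := 0) hx hD q)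
  obtain ⟨Q, -, h⟩ := exists_sub_sum_incl_mem_filtration (N := 0) hx
  refine ⟨∑ q ∈ Q, DirectSum.lof ℝ ℕ (fun q => InvForm E G M q) q (w q), ?_⟩
  rw [map_sum]
  simp only [invIncl_lof, hw]
  exact (sub_eq_zero.1 (DFinsupp.ext fun pq => h pq.1 pq.2 (Nat.zero_le _))).symm

/-- The inclusion of the invariant forms into the cyclic module of a proper action induces an
isomorphism for every choice of total degrees stable under subtraction of two. -/
theorem bijective_toModule_invIncl [FiniteDimensional ℝ F] [T2Space M]
    [SecondCountableTopology M] [ProperSMul G M] {ι : Type*} [DecidableEq ι] {m : ι → ℤ}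
    (hm : Function.Injective m) (hm' : ∀ k, m k - 2 ∈ Set.range m) {n : ℤ}
    {Γ : ℤ → Submodule ℝ (hopfCocyclicModule F E G M).Total}
    (hΓ : Γ n ≤ (hopfCocyclicModule F E G M).supported (Set.range m))
    (hΓ' : (hopfCocyclicModule F E G M).supported {a | a + 1 ∈ Set.range m} ≤ Γ (n - 1))
    (h : ∀ k, ∀ x ∈ invFormsOfDegree E G M (m k), invIncl E G M F x ∈ Γ n)
    (h' : ∀ k, ∀ x ∈ invFormsOfDegree E G M (m k - 1), invIncl E G M F x ∈ Γ (n - 1)) :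
    Function.Bijective (DirectSum.toModule ℝ ι
      (gradedCohomology (hopfCocyclicModule F E G M).totalD Γ n) fun k =>
      gradedCohomologyMap (n := n) (invIncl E G M F) (totalD_invIncl E G M F) (h k) (h' k)) := by
  have hC : ∀ {p q : ℕ} (a : (hopfCocyclicModule F E G M).X (p + 1) q),
      (hopfCocyclicModule F E G M).b a = 0 → ∃ y : (hopfCocyclicModule F E G M).X p q,
        (hopfCocyclicModule F E G M).b y = a := fun a ha => exists_b_eq_of_b_eq_zero ha
  refine bijective_toModule_gradedCohomologyMap (invIncl E G M F) (totalD_invIncl E G M F) hm h h'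
    (invProj E G M) (invProj_mem E G M) (invProj_self E G M) (invProj_ne E G M)
    (invProj_invD E G M F) ?_ ?_
  -- Here the descent runs with all total degrees allowed: no degree control on the primitive is
  -- required, as the projections restore it afterwards.
  · intro w x _ hxw
    obtain ⟨N, hN⟩ := exists_mem_filtration x
    obtain ⟨y, -, hy, -⟩ := exists_sub_totalD_mem_filtration hC (A := Set.univ)
      (fun _ _ => Set.mem_univ _) hN (fun _ _ _ => Set.mem_univ _)
      (by rw [hxw]; exact invIncl_mem_filtration E G M F w)
    have hD : (hopfCocyclicModule F E G M).totalD
        (x - (hopfCocyclicModule F E G M).totalD y) = invIncl E G M F w := by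
      rw [map_sub, totalD_totalD, sub_zero, hxw]
    obtain ⟨v, hv⟩ := exists_invIncl_eq E G M F hy
      (by rw [hD]; exact invIncl_mem_filtration E G M F w)
    refine ⟨v, invIncl_injective E G M F ?_⟩
    rw [← totalD_invIncl, hv, hD]
  -- Here the descent must respect degrees, so it runs with `A` the range of `m`; the correction `y`
  -- then has total degrees one less, as a cochain of degree `n - 1` must.
  · intro x hx hDx
    obtain ⟨N, hN⟩ := exists_mem_filtration x
    obtain ⟨y, hyA, hy, hxA⟩ := exists_sub_totalD_mem_filtration hC (A := Set.range m)
      (by rintro _ ⟨k, rfl⟩; exact hm' k) hN (hΓ hx) (by rw [hDx]; exact zero_mem _)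
    have hD : (hopfCocyclicModule F E G M).totalD
        (x - (hopfCocyclicModule F E G M).totalD y) = 0 := by
      rw [map_sub, totalD_totalD, sub_zero, hDx]
    obtain ⟨w, hw⟩ := exists_invIncl_eq E G M F hy (by rw [hD]; exact zero_mem _)
    obtain ⟨s, hs⟩ := exists_eq_sum_invProj E G M (m := m) (x := w) fun q hq => by
      -- In cosimplicial degree zero the total degree is the form degree, so the nonzero components
      -- of `w` have degrees in the range of `m`.
      rw [← hw] at hxA
      have := hxA 0 q fun h0 => hq (invInclComponent_injective E G M F q (by
        rw [← invIncl_apply_zero, h0, map_zero]))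
      simpa using this
    refine ⟨y, hΓ' hyA, s, w, invIncl_injective E G M F ?_, hw.symm, hs⟩
    rw [← totalD_invIncl, hw, hD, map_zero]

end Invariant

end HopfCyclic

end

/-- Two instances of `bijective_toModule_invIncl`: the total degrees are `n - 2k` with `k` natural
for `HC`, and `n + 2k` with `k` an integer for `HP`. Stability under subtraction of two is `k ↦ k +
1` in the first case and `k ↦ k - 1` in the second. -/
theorem mainTheorem3
    {E : Type*} [NormedAddCommGroup E] [NormedSpace ℝ E] [FiniteDimensional ℝ E]
    {F : Type*} [NormedAddCommGroup F] [NormedSpace ℝ F] [FiniteDimensional ℝ F]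
    {G : Type*} [TopologicalSpace G] [ChartedSpace F G] [Group G] [LieGroup 𝓘(ℝ, F) ∞ G]
    {M : Type*} [TopologicalSpace M] [ChartedSpace E M] [IsManifold 𝓘(ℝ, E) ∞ M]
    [T2Space M] [SecondCountableTopology M]
    [MulAction G M] [ContMDiffSMul 𝓘(ℝ, F) 𝓘(ℝ, E) ∞ G M] [ProperSMul G M] (n : ℤ) :
    (∃ e : (⨁ k : ℕ, HopfCyclic.InvCohomology E G M F (n - 2 * (k : ℤ))) ≃ₗ[ℝ]
        (HopfCyclic.hopfCocyclicModule F E G M).HC n,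
      ∀ (k : ℕ) (z : HopfCyclic.InvCohomology E G M F (n - 2 * (k : ℤ))),
        e (DirectSum.lof ℝ ℕ
          (fun k : ℕ => HopfCyclic.InvCohomology E G M F (n - 2 * (k : ℤ))) k z) =
          HopfCyclic.inclHC E G M F n k z) ∧
    (∃ e : (⨁ k : ℤ, HopfCyclic.InvCohomology E G M F (n + 2 * k)) ≃ₗ[ℝ]
        (HopfCyclic.hopfCocyclicModule F E G M).HP n,
      ∀ (k : ℤ) (z : HopfCyclic.InvCohomology E G M F (n + 2 * k)),
        e (DirectSum.lof ℝ ℤ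
          (fun k : ℤ => HopfCyclic.InvCohomology E G M F (n + 2 * k)) k z) =
          HopfCyclic.inclHP E G M F n k z) := by
  constructor
  · have h := HopfCyclic.bijective_toModule_invIncl E G M F (ι := ℕ) (n := n)
      (m := fun k => n - 2 * (k : ℤ)) (fun k k' h => by simp only at h; omega)
      (fun k => ⟨k + 1, by push_cast; ring⟩)
      (Γ := (HopfCyclic.hopfCocyclicModule F E G M).cyclicCochains)
      (fun x hx p q h => by
        obtain ⟨k, hk⟩ := hx p q h
        exact ⟨k, by simp only; omega⟩)
      (fun x hx p q h => by
        obtain ⟨k, hk⟩ := hx p q h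
        exact ⟨k, by simp only at hk; omega⟩)
      (fun k _ hx => HopfCyclic.invIncl_mem_cyclicCochains E G M F ⟨k, by ring⟩ hx)
      (fun k _ hx => HopfCyclic.invIncl_mem_cyclicCochains E G M F ⟨k, by ring⟩ hx)
    exact ⟨LinearEquiv.ofBijective _ h, fun k z => DirectSum.toModule_lof ℝ
      (φ := fun k => HopfCyclic.inclHC E G M F n k) k z⟩
  · have h := HopfCyclic.bijective_toModule_invIncl E G M F (ι := ℤ) (n := n)
      (m := fun k => n + 2 * k) (fun k k' h => by simp only at h; omega)
      (fun k => ⟨k - 1, by ring⟩)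
      (Γ := (HopfCyclic.hopfCocyclicModule F E G M).periodicCochains)
      (fun x hx p q h => by
        obtain ⟨k, hk⟩ := hx p q h
        exact ⟨-k, by simp only; omega⟩)
      (fun x hx p q h => by
        obtain ⟨k, hk⟩ := hx p q h
        exact ⟨-k, by simp only at hk; omega⟩)
      (fun k _ hx => HopfCyclic.invIncl_mem_periodicCochains E G M F ⟨-k, by ring⟩ hx)
      (fun k _ hx => HopfCyclic.invIncl_mem_periodicCochains E G M F ⟨-k, by ring⟩ hx)
    exact ⟨LinearEquiv.ofBijective _ h, fun k z => DirectSum.toModule_lof ℝ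
      (φ := fun k => HopfCyclic.inclHP E G M F n k) k z⟩
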